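/- **($H^2$ stability for the finite periodic channel.)** Let $L>0$, $\mathbb T_L=\mathbb R/L\mathbb Z$, and let $f,g\in W^{3,\infty}((0,1))$ be real-valued. Consider the linearized Euler equations around a monotone shear flow $(U(y),0)$ in the channel $\mathbb T_L\times[0,1]$ with impermeable walls, written with $U(y)$ as the new vertical coordinate (again called $y$, with range normalized to $[0,1]$, so that $f=U''\circ U^{-1}$, $g=U'\circ U^{-1}$), in the frame moving with the flow, and after a Fourier transform in $x$. For each frequency $k\in\frac{2\pi}{L}(\mathbb Z\setminus\{0\})$ they read $$\partial_t W=\frac{i f(y)}{k}\,\Phi,\qquad \Big(-1+\Big(g(y)\Big(\frac{\partial_y}{k}-it\Big)\Big)^2\Big)\Phi=W,\qquad \Phi|_{y=0,1}=0,\qquad (t,y)\in\mathbb R\times[0,1],$$ with unknown $W=W(t,k,\cdot)$. A solution is a differentiable curve $t\mapsto W(t)\in L^2((0,1))$, defined for $t\in\mathbb R$, such that for every $t$ there is a strong solution $\Phi(t)$ of the boundary value problem with $\partial_tW=\frac{if}{k}\Phi$. For all $c>0$ and $M$ there is $\varepsilon=\varepsilon(c,M)>0$, and for every $L>0$ a constant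 $C=C(c,M,L)$, such that the following holds. If $$c<g<c^{-1}\ \text{ on }(0,1),\qquad \|g\|_{W^{3,\infty}}\le M,\qquad L\,\|f\|_{W^{3,\infty}}\le\varepsilon,$$ then for every $k\in\frac{2\pi}{L}(\mathbb Z\setminus\{0\})$, every $\omega_0\in H^2((0,1))$ with $\omega_0|_{y=0,1}=0$ and every solution $W$ with $W(0)=\omega_0$, one has $W(t)\in H^2((0,1))$ and $$\|W(t)\|_{H^2}\le C\,\|\omega_0\|_{H^2}\qquad\text{for all }t\in\mathbb R .$$ In particular $C$ does not depend on $t$, $k$ and $\omega_0$. -/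

import Mathlib

open MeasureTheory Set
open scoped ENNReal ContDiff

namespace FiniteChannel

/-- Lebesgue measure on the interval `(0,1)`. -/
noncomputable abbrev unitVol : Measure ℝ := volume.restrict (Ioo (0 : ℝ) 1)

section Sobolev

variable {E : Type*} [NormedAddCommGroup E] [NormedSpace ℝ E]

/-- `v` is a weak (distributional) derivative of `u` on `(0,1)`. -/
structure IsWeakDeriv (u v : ℝ → E) : Prop where
  left : LocallyIntegrableOn u (Ioo (0 : ℝ) 1)
  right : LocallyIntegrableOn v (Ioo (0 : ℝ) 1)
  integral_eq : ∀ φ : ℝ → ℝ, ContDiff ℝ ∞ φ → HasCompactSupport φ →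
    tsupport φ ⊆ Ioo (0 : ℝ) 1 →
      ∫ y in Ioo (0 : ℝ) 1, deriv φ y • u y = - ∫ y in Ioo (0 : ℝ) 1, φ y • v y

open Classical in
/-- The weak derivative of `u` on `(0,1)` (unique up to null sets), and `0` if there is none. -/
noncomputable def weakDeriv (u : ℝ → E) : ℝ → E :=
  if h : ∃ v, IsWeakDeriv u v then h.choose else 0

/-- `u ∈ W^{n,p}((0,1))`: the weak derivatives of `u` up to order `n` exist and lie in `L^p`. -/
def MemSobolev (n : ℕ) (p : ℝ≥0∞) (u : ℝ → E) : Prop :=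
  (∀ j < n, ∃ v, IsWeakDeriv (weakDeriv^[j] u) v) ∧
    ∀ j ≤ n, MemLp (weakDeriv^[j] u) p unitVol

/-- The norm of `W^{n,∞}((0,1))`, for `u` in that space: the largest of the `L^∞` norms of the
weak derivatives of order at most `n`. -/
noncomputable def normWInf (n : ℕ) (u : ℝ → E) : ℝ≥0∞ :=
  (Finset.range (n + 1)).sup fun j => eLpNorm (weakDeriv^[j] u) ∞ unitVol

/-- The norm of `H^n((0,1))`, for `u` in that space: the square root of the sum of the squares of
the `L^2` norms of the weak derivatives of order at most `n`. -/
noncomputable def normH (n : ℕ) (u : ℝ → E) : ℝ≥0∞ :=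
  (∑ j ∈ Finset.range (n + 1), eLpNorm (weakDeriv^[j] u) 2 unitVol ^ 2) ^ (1 / 2 : ℝ)

/-- `u|_{y=0,1} = 0`, for a function `u` on `(0,1)` that is defined up to null sets: `u` has a
representative that is continuous on `[0,1]` and zero at both end points. -/
def VanishesAtBoundary (u : ℝ → E) : Prop :=
  ∃ v : ℝ → E, ContinuousOn v (Icc 0 1) ∧ u =ᵐ[unitVol] v ∧ v 0 = 0 ∧ v 1 = 0

end Sobolev

/-- The first order operator `u ↦ g (∂_y / k - i t) u`. -/
noncomputable def twistedDeriv (g : ℝ → ℝ) (k t : ℝ) (u : ℝ → ℂ) : ℝ → ℂ :=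
  fun y => (g y : ℂ) * (weakDeriv u y / (k : ℂ) - Complex.I * (t : ℂ) * u y)

/-- `Φ` is the stream function of `W` at time `t` and frequency `k`: the solution of
`(-1 + (g (∂_y / k - i t))²) Φ = W` on `(0,1)` with `Φ = 0` at `y = 0, 1`
(the impermeability of the walls). -/
structure IsStreamFunction (g : ℝ → ℝ) (k t : ℝ) (W Φ : ℝ → ℂ) : Prop where
  mem : MemSobolev 1 2 Φ
  mem_twistedDeriv : MemSobolev 1 2 (twistedDeriv g k t Φ)
  eqn : ∀ᵐ y ∂unitVol, -Φ y + twistedDeriv g k t (twistedDeriv g k t Φ) y = W y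
  boundary : VanishesAtBoundary Φ

/-- `W` solves, at frequency `k`, the linearized Euler equations in scattering formulation
`∂_t W = (i f / k) Φ`, `(-1 + (g (∂_y / k - i t))²) Φ = W`, `Φ|_{y=0,1} = 0` on `ℝ × [0,1]`.
The time derivative is that of a curve in `L²((0,1))`. -/
def IsScatteringSolution (f g : ℝ → ℝ) (k : ℝ) (W : ℝ → Lp ℂ 2 unitVol) : Prop :=
  ∀ t : ℝ, ∃ Φ : ℝ → ℂ, IsStreamFunction g k t (W t) Φ ∧
    ∃ D : Lp ℂ 2 unitVol,
      (D =ᵐ[unitVol] fun y => Complex.I * (f y : ℂ) / (k : ℂ) * Φ y) ∧ HasDerivAt W D t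

end FiniteChannel

/-!
The proof follows the second derivative `v = ∂_y² W` of the vorticity. Time is measured in units of
`1/k`, so that the shear is a unit shear; `κ = |k|`, `K = max κ 1`, and `m` is the norm of `f`, with
`m / K` small because `L ‖f‖` is. In the moving frame the stream function is `e^{iτy} p`, where
`p` solves an elliptic problem with time independent coefficients (`IsElliptic`). The operator
`∂_y + iτ` maps solutions to solutions, with lower order terms in the source (`twist`, `twistFlux`).
Two applications give the velocity `Q = ∂_y² (f Φ)` of `v` in terms of `p` and of its two
derivatives `q`, `q₂` in the moving frame (`forcingDeriv`).

If `q` and `q₂` vanished on the walls, energy estimates would bound `Q` in `H¹₀` by the norm of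
`e^{-iτy} v` in `H⁻¹`. In Fourier series this reads
`∑ w_n(τ) |Q_n|² ≲ m² ∑ |v_n|² / w_n(τ)` with `w_n(τ) = K² + (2πn - τ)²`. Each mode is resonant only
around the time `τ = 2πn`, and since `∫ dτ / w_n(τ) = π / K`, the Cauchy-Schwarz inequality gives
`∑ (∫ |Q_n| dτ)² ≲ (m / K)² ∑ sup |v_n|²`, whatever the length of the time interval
(`tsum_sq_lintegral_le`). A small `m / K` then closes the estimate.

The wall values of `q` and `q₂` do not vanish. They multiply the solutions `u₀`, `u₁` of the
homogeneous problem, which are boundary layers of width `1/K` (`exists_boundaryLayers`). Pairing the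
elliptic equation with these layers expresses the wall values through `∫ W u₀`, and two integrations
by parts against `e^{iτy}`, possible because `W` vanishes on the walls, show that they decay like
`1/(K² + τ²)` times a quantity `S` built from `v` and the slopes of `W` at the walls
(`stream_flux_le`). The layers therefore contribute at most `m S / ((K + |τ|) (K + |2πn - τ|))` to
`Q_n` (`exists_forcingDeriv_decomposition`); the time integrals of these kernels are square summable
in `n` (`tsum_lintegral_resonance_sq_le`), and the slopes of `W` move by an integrable amount. All
the quantities are bounded together in `tsum_sq_le_of_closure`.

A solution is a priori only a curve in `L²`, so one has to prove that `v` exists. The velocity of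
`W` is `𝒢 r(τ)`, where `𝒢` solves the Dirichlet problem for `∂_y²` and `r` is locally bounded in
`L²`, because the forcing gains two derivatives. As `𝒢` is injective and continuous, it is a
measurable embedding; hence `r` is measurable and `v` is its Bochner integral
(`eq_integral_of_hasDerivAt`).
-/

namespace FiniteChannel

/-! ### Primitives on the unit interval -/

/-- `u` is, on `[0,1]`, a primitive of the integrable function `u'`; equivalently, `u` is
absolutely continuous on `[0,1]` with derivative `u'`. -/
structure IsPrimitive (u u' : ℝ → ℂ) : Prop where
  integrable : Integrable u' unitVol
  eq : ∀ y ∈ Icc (0 : ℝ) 1, u y = u 0 + ∫ s in (0 : ℝ)..y, u' s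

theorem unitVol_eq_restrict_Ioc : unitVol = volume.restrict (Ioc (0 : ℝ) 1) :=
  restrict_Ioo_eq_restrict_Ioc

theorem ae_unitVol_iff {p : ℝ → Prop} :
    (∀ᵐ y ∂unitVol, p y) ↔ ∀ᵐ y, y ∈ Ioo (0 : ℝ) 1 → p y :=
  ae_restrict_iff' measurableSet_Ioo

theorem ae_unitVol_of_forall {p : ℝ → Prop} (h : ∀ y ∈ Icc (0 : ℝ) 1, p y) :
    ∀ᵐ y ∂unitVol, p y := by
  rw [ae_unitVol_iff]
  exact Filter.Eventually.of_forall fun y hy => h y ⟨hy.1.le, hy.2.le⟩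

theorem integral_unitVol (u : ℝ → ℂ) : ∫ y, u y ∂unitVol = ∫ y in (0 : ℝ)..1, u y := by
  rw [intervalIntegral.integral_of_le zero_le_one, unitVol_eq_restrict_Ioc]

theorem restrict_Ioc_le_unitVol {y : ℝ} (hy : y ∈ Icc (0 : ℝ) 1) :
    volume.restrict (Ioc 0 y) ≤ unitVol := by
  rw [unitVol_eq_restrict_Ioc]
  exact Measure.restrict_mono (Ioc_subset_Ioc_right hy.2) le_rfl

theorem intervalIntegrable_of_unitVol {u : ℝ → ℂ} (hu : Integrable u unitVol) :
    IntervalIntegrable u volume 0 1 := by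
  rw [intervalIntegrable_iff_integrableOn_Ioc_of_le zero_le_one, IntegrableOn,
    ← unitVol_eq_restrict_Ioc]
  exact hu

theorem intervalIntegrable_sub {u : ℝ → ℂ} (hu : Integrable u unitVol) {a b : ℝ}
    (ha : a ∈ Icc (0 : ℝ) 1) (hb : b ∈ Icc (0 : ℝ) 1) : IntervalIntegrable u volume a b :=
  (intervalIntegrable_of_unitVol hu).mono_set (by
    rw [uIcc_of_le (zero_le_one' ℝ)]; exact (convex_Icc (0 : ℝ) 1).ordConnected.uIcc_subset ha hb)

theorem integrable_of_continuousOn {u : ℝ → ℂ} (hu : ContinuousOn u (Icc 0 1)) :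
    Integrable u unitVol :=
  (hu.integrableOn_Icc).mono_set Ioo_subset_Icc_self

theorem memLp_of_continuousOn {u : ℝ → ℂ} (hu : ContinuousOn u (Icc 0 1)) (p : ℝ≥0∞) :
    MemLp u p unitVol := by
  obtain ⟨C, hC⟩ := isCompact_Icc.exists_bound_of_continuousOn hu
  exact MemLp.of_bound (integrable_of_continuousOn hu).1 C (ae_unitVol_of_forall hC)

theorem integral_zero_congr {u v : ℝ → ℂ} (h : u =ᵐ[unitVol] v) {y : ℝ}
    (hy : y ∈ Icc (0 : ℝ) 1) : ∫ s in (0 : ℝ)..y, u s = ∫ s in (0 : ℝ)..y, v s := by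
  rw [intervalIntegral.integral_of_le hy.1, intervalIntegral.integral_of_le hy.1]
  exact integral_congr_ae (ae_mono (restrict_Ioc_le_unitVol hy) h)

theorem integral_mul_primitive_add {a b : ℝ → ℂ} {y : ℝ}
    (ha : IntegrableOn a (Ioc 0 y)) (hb : IntegrableOn b (Ioc 0 y)) :
    (∫ s in Ioc 0 y, a s * ∫ r in (0 : ℝ)..s, b r) + (∫ r in Ioc 0 y, (∫ s in (0 : ℝ)..r, a s) * b r)
      = (∫ s in Ioc 0 y, a s) * ∫ r in Ioc 0 y, b r := by
  set μ := volume.restrict (Ioc 0 y) with hμ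
  have hab : Integrable (fun z : ℝ × ℝ => a z.1 * b z.2) (μ.prod μ) := Integrable.mul_prod ha hb
  have hS : MeasurableSet {z : ℝ × ℝ | z.2 ≤ z.1} := measurableSet_le measurable_snd measurable_fst
  rw [← integral_prod_mul, ← integral_add_compl hS hab]
  congr 1
  · rw [← integral_indicator hS, integral_prod _ (hab.indicator hS)]
    refine setIntegral_congr_fun measurableSet_Ioc fun s hs => ?_
    have h1 : ∀ r, {z : ℝ × ℝ | z.2 ≤ z.1}.indicator (fun z => a z.1 * b z.2) (s, r)
        = a s * (Iic s).indicator b r := by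
      intro r
      by_cases hr : r ≤ s <;> simp [hr, indicator]
    simp_rw [h1]
    rw [integral_const_mul, integral_indicator measurableSet_Iic, hμ,
      Measure.restrict_restrict measurableSet_Iic, intervalIntegral.integral_of_le hs.1.le]
    congr 3
    ext r; simp only [mem_inter_iff, mem_Iic, mem_Ioc]
    exact ⟨fun h => ⟨h.2, h.1, h.2.trans hs.2⟩, fun h => ⟨h.2.1, h.1⟩⟩
  · rw [← integral_indicator hS.compl, integral_prod_symm _ (hab.indicator hS.compl)]
    refine setIntegral_congr_fun measurableSet_Ioc fun r hr => ?_
    have h1 : ∀ s, {z : ℝ × ℝ | z.2 ≤ z.1}ᶜ.indicator (fun z => a z.1 * b z.2) (s, r)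
        = (Iio r).indicator a s * b r := by
      intro s
      by_cases hs : s < r
      · simp [hs, indicator]
      · simp [hs, indicator]
    simp_rw [h1]
    rw [integral_mul_const, integral_indicator measurableSet_Iio, hμ,
      Measure.restrict_restrict measurableSet_Iio, intervalIntegral.integral_of_le hr.1.le,
      integral_Ioc_eq_integral_Ioo]
    congr 3
    ext s; simp only [mem_inter_iff, mem_Iio, mem_Ioc, mem_Ioo]
    exact ⟨fun h => ⟨h.2, h.1, h.2.le.trans hr.2⟩, fun h => ⟨h.2.1, h.1⟩⟩

namespace IsPrimitive

variable {u u' v v' : ℝ → ℂ}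

theorem congr (h : IsPrimitive u u') (hu : ∀ y ∈ Icc (0 : ℝ) 1, v y = u y)
    (hu' : u' =ᵐ[unitVol] v') : IsPrimitive v v' where
  integrable := h.integrable.congr hu'
  eq y hy := by
    rw [hu y hy, hu 0 (by simp), h.eq y hy, integral_zero_congr hu' hy]

theorem continuousOn (h : IsPrimitive u u') : ContinuousOn u (Icc 0 1) := by
  have h1 : ContinuousOn (fun y => u 0 + ∫ s in (0 : ℝ)..y, u' s) (Icc 0 1) := by
    refine continuousOn_const.add ?_
    have := intervalIntegral.continuousOn_primitive_interval' (μ := volume) (f := u') (a := 0)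
      (intervalIntegrable_of_unitVol h.integrable) (by simp)
    rwa [uIcc_of_le zero_le_one] at this
  exact h1.congr h.eq

theorem memLp (h : IsPrimitive u u') (p : ℝ≥0∞) : MemLp u p unitVol :=
  memLp_of_continuousOn h.continuousOn p

theorem integral_eq_sub (h : IsPrimitive u u') : ∫ y, u' y ∂unitVol = u 1 - u 0 := by
  rw [integral_unitVol, h.eq 1 (by simp)]; ring

theorem const (a : ℂ) : IsPrimitive (fun _ => a) (fun _ => 0) where
  integrable := integrable_zero _ _ _
  eq y _ := by simp

theorem add (hu : IsPrimitive u u') (hv : IsPrimitive v v') :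
    IsPrimitive (fun y => u y + v y) (fun y => u' y + v' y) where
  integrable := hu.integrable.add hv.integrable
  eq y hy := by
    rw [intervalIntegral.integral_add (intervalIntegrable_sub hu.integrable (by simp) hy)
      (intervalIntegrable_sub hv.integrable (by simp) hy), hu.eq y hy, hv.eq y hy]
    ring

theorem const_mul (hu : IsPrimitive u u') (a : ℂ) :
    IsPrimitive (fun y => a * u y) (fun y => a * u' y) where
  integrable := hu.integrable.const_mul a
  eq y hy := by rw [intervalIntegral.integral_const_mul, hu.eq y hy]; ring

theorem neg (hu : IsPrimitive u u') : IsPrimitive (fun y => -u y) (fun y => -u' y) := by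
  simpa using hu.const_mul (-1)

theorem sub (hu : IsPrimitive u u') (hv : IsPrimitive v v') :
    IsPrimitive (fun y => u y - v y) (fun y => u' y - v' y) := by
  simpa [sub_eq_add_neg] using hu.add hv.neg

theorem conj (hu : IsPrimitive u u') :
    IsPrimitive (fun y => starRingEnd ℂ (u y)) (fun y => starRingEnd ℂ (u' y)) where
  integrable := (RCLike.conjCLE (K := ℂ)).toContinuousLinearMap.integrable_comp hu.integrable
  eq y hy := by
    rw [hu.eq y hy, map_add, intervalIntegral.intervalIntegral_eq_integral_uIoc,
      intervalIntegral.intervalIntegral_eq_integral_uIoc]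
    simp [hy.1, ← integral_conj]

theorem of_hasDerivAt (h : ∀ y ∈ Icc (0 : ℝ) 1, HasDerivAt u (u' y) y)
    (hc : ContinuousOn u' (Icc 0 1)) : IsPrimitive u u' where
  integrable := integrable_of_continuousOn hc
  eq y hy := by
    have hsub : uIcc 0 y ⊆ Icc (0 : ℝ) 1 := by
      rw [uIcc_of_le hy.1]; exact Icc_subset_Icc_right hy.2
    rw [intervalIntegral.integral_eq_sub_of_hasDerivAt (fun x hx => h x (hsub hx))
      ((hc.mono hsub).intervalIntegrable)]
    ring

theorem hasDerivAt (h : IsPrimitive u u') (hc : ContinuousOn u' (Icc 0 1)) {y : ℝ}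
    (hy : y ∈ Ioo (0 : ℝ) 1) : HasDerivAt u (u' y) y := by
  have hn : Icc (0 : ℝ) 1 ∈ nhds y := Icc_mem_nhds hy.1 hy.2
  have h1 : HasDerivAt (fun x => u 0 + ∫ s in (0 : ℝ)..x, u' s) (u' y) y := by
    refine HasDerivAt.const_add _ ?_
    refine intervalIntegral.integral_hasDerivAt_right
      (intervalIntegrable_sub h.integrable (by simp) ⟨hy.1.le, hy.2.le⟩) ?_ ?_
    · exact (hc.mono Ioo_subset_Icc_self).stronglyMeasurableAtFilter isOpen_Ioo y hy
    · exact hc.continuousAt hn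
  exact h1.congr_of_eventuallyEq (Filter.mem_of_superset hn fun x hx => h.eq x hx)

/-- The product rule, proved by splitting the square `(0,y]²` along its diagonal. -/
theorem mul (hu : IsPrimitive u u') (hv : IsPrimitive v v') :
    IsPrimitive (fun y => u y * v y) (fun y => u' y * v y + u y * v' y) where
  integrable := by
    obtain ⟨C, hC⟩ := isCompact_Icc.exists_bound_of_continuousOn hu.continuousOn
    obtain ⟨D, hD⟩ := isCompact_Icc.exists_bound_of_continuousOn hv.continuousOn
    refine Integrable.add ?_ ?_
    · exact hu.integrable.mul_bdd (hv.memLp 1).1 (ae_unitVol_of_forall hD)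
    · exact hv.integrable.bdd_mul (hu.memLp 1).1 (ae_unitVol_of_forall hC)
  eq y hy := by
    have hsub : ∀ s ∈ Ioc 0 y, s ∈ Icc (0 : ℝ) 1 := fun s hs => ⟨hs.1.le, hs.2.trans hy.2⟩
    have iu : IntegrableOn u' (Ioc 0 y) := hu.integrable.mono_measure (restrict_Ioc_le_unitVol hy)
    have iv : IntegrableOn v' (Ioc 0 y) := hv.integrable.mono_measure (restrict_Ioc_le_unitVol hy)
    have cu : ContinuousOn (fun s => ∫ r in (0 : ℝ)..s, u' r) (Icc 0 1) :=
      (hu.continuousOn.sub (continuousOn_const (c := u 0))).congr fun s hs => by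
        simp [hu.eq s hs]
    have cv : ContinuousOn (fun s => ∫ r in (0 : ℝ)..s, v' r) (Icc 0 1) :=
      (hv.continuousOn.sub (continuousOn_const (c := v 0))).congr fun s hs => by
        simp [hv.eq s hs]
    obtain ⟨C, hC⟩ := isCompact_Icc.exists_bound_of_continuousOn cu
    obtain ⟨D, hD⟩ := isCompact_Icc.exists_bound_of_continuousOn cv
    have i1 : IntegrableOn (fun s => u' s * ∫ r in (0 : ℝ)..s, v' r) (Ioc 0 y) :=
      (hu.integrable.mul_bdd (memLp_of_continuousOn cv 1).1
        (ae_unitVol_of_forall hD)).mono_measure (restrict_Ioc_le_unitVol hy)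
    have i2 : IntegrableOn (fun s => (∫ r in (0 : ℝ)..s, u' r) * v' s) (Ioc 0 y) :=
      (hv.integrable.bdd_mul (memLp_of_continuousOn cu 1).1
        (ae_unitVol_of_forall hC)).mono_measure (restrict_Ioc_le_unitVol hy)
    have key := integral_mul_primitive_add iu iv
    have h1 : ∫ s in (0 : ℝ)..y, (u' s * v s + u s * v' s)
        = (∫ s in Ioc 0 y, ((u' s * ∫ r in (0 : ℝ)..s, v' r) + (∫ r in (0 : ℝ)..s, u' r) * v' s
          + (v 0 * u' s + u 0 * v' s))) := by
      rw [intervalIntegral.integral_of_le hy.1]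
      refine setIntegral_congr_fun measurableSet_Ioc fun s hs => ?_
      rw [hu.eq s (hsub s hs), hv.eq s (hsub s hs)]
      ring
    have h2 := (integral_add (i1.add i2) ((iu.const_mul (v 0)).add (iv.const_mul (u 0)))).trans
      (congrArg₂ (· + ·) (integral_add i1 i2)
        (integral_add (iu.const_mul (v 0)) (iv.const_mul (u 0))))
    rw [h1]
    refine Eq.trans ?_ (congrArg _ h2.symm)
    rw [key, integral_const_mul, integral_const_mul, hu.eq y hy, hv.eq y hy,
      intervalIntegral.integral_of_le hy.1, intervalIntegral.integral_of_le hy.1]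
    ring

theorem integral_mul_eq (hu : IsPrimitive u u') (hv : IsPrimitive v v') :
    ∫ y, (u' y * v y + u y * v' y) ∂unitVol = u 1 * v 1 - u 0 * v 0 :=
  (hu.mul hv).integral_eq_sub

end IsPrimitive

end FiniteChannel

namespace FiniteChannel

/-! ### The norm of `L²(0,1)` as a real number -/

/-- The norm of `L²((0,1))` as a real number; it is meaningful for `u` in that space. -/
noncomputable def l2 (u : ℝ → ℂ) : ℝ := (eLpNorm u 2 unitVol).toReal

section

variable {u v : ℝ → ℂ}

theorem l2_nonneg (u : ℝ → ℂ) : 0 ≤ l2 u := ENNReal.toReal_nonneg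

theorem ofReal_l2 (hu : MemLp u 2 unitVol) : ENNReal.ofReal (l2 u) = eLpNorm u 2 unitVol :=
  ENNReal.ofReal_toReal hu.2.ne

theorem l2_add_le (hu : MemLp u 2 unitVol) (hv : MemLp v 2 unitVol) :
    l2 (fun y => u y + v y) ≤ l2 u + l2 v := by
  rw [l2, l2, l2, ← ENNReal.toReal_add hu.2.ne hv.2.ne]
  exact ENNReal.toReal_mono (ENNReal.add_ne_top.2 ⟨hu.2.ne, hv.2.ne⟩)
    (eLpNorm_add_le hu.1 hv.1 (by norm_num))

theorem l2_le_mul (hv : MemLp v 2 unitVol) {C : ℝ} (hC : 0 ≤ C)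
    (h : ∀ᵐ y ∂unitVol, ‖u y‖ ≤ C * ‖v y‖) : l2 u ≤ C * l2 v := by
  have h1 := eLpNorm_le_mul_eLpNorm_of_ae_le_mul h 2
  have h2 := ENNReal.toReal_mono (ENNReal.mul_ne_top ENNReal.ofReal_ne_top hv.2.ne) h1
  rwa [ENNReal.toReal_mul, ENNReal.toReal_ofReal hC] at h2

theorem l2_le_of_bound {C : ℝ} (hC : 0 ≤ C) (h : ∀ᵐ y ∂unitVol, ‖u y‖ ≤ C) : l2 u ≤ C := by
  have h1 : MemLp (fun _ : ℝ => (1 : ℂ)) 2 unitVol := memLp_const 1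
  have h2 : l2 (fun _ : ℝ => (1 : ℂ)) = 1 := by simp [l2, eLpNorm_const']
  simpa [h2] using l2_le_mul (u := u) h1 hC (by simpa using h)

theorem l2_sq (hu : MemLp u 2 unitVol) : l2 u ^ 2 = ∫ y, ‖u y‖ ^ 2 ∂unitVol := by
  have h := hu.eLpNorm_eq_integral_rpow_norm (by norm_num) (by norm_num)
  have h0 : 0 ≤ ∫ y, ‖u y‖ ^ (2 : ℝ) ∂unitVol := integral_nonneg fun y => by positivity
  rw [l2, h]
  simp only [ENNReal.toReal_ofNat, Real.rpow_two] at h0 ⊢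
  rw [ENNReal.toReal_ofReal (by positivity), ← Real.rpow_natCast, ← Real.rpow_mul h0]
  norm_num

theorem integrable_norm_sq (hu : MemLp u 2 unitVol) :
    Integrable (fun y => ‖u y‖ ^ 2) unitVol := hu.norm.integrable_sq

theorem memLp_mul_bound {m : ℝ → ℂ} (hu : MemLp u 2 unitVol) (hm : AEStronglyMeasurable m unitVol)
    {C : ℝ} (h : ∀ᵐ y ∂unitVol, ‖m y‖ ≤ C) : MemLp (fun y => m y * u y) 2 unitVol :=
  (hu.const_mul (C : ℂ)).mono (hm.mul hu.1) (h.mono fun y hy => by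
    rw [norm_mul, norm_mul, Complex.norm_real]
    gcongr
    exact hy.trans (Real.le_norm_self C))

theorem memLp_mul_continuousOn {m : ℝ → ℂ} (hu : MemLp u 2 unitVol)
    (hm : ContinuousOn m (Icc 0 1)) : MemLp (fun y => m y * u y) 2 unitVol := by
  obtain ⟨C, hC⟩ := isCompact_Icc.exists_bound_of_continuousOn hm
  exact memLp_mul_bound hu (memLp_of_continuousOn hm 1).1 (ae_unitVol_of_forall hC)

theorem memLp_conj (hu : MemLp u 2 unitVol) : MemLp (fun y => starRingEnd ℂ (u y)) 2 unitVol :=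
  hu.star

theorem l2_conj (u : ℝ → ℂ) : l2 (fun y => starRingEnd ℂ (u y)) = l2 u := by
  rw [l2, l2]
  congr 1
  exact eLpNorm_congr_norm_ae (Filter.Eventually.of_forall fun y => by simp)

theorem integrable_mul_of_memLp (hu : MemLp u 2 unitVol) (hv : MemLp v 2 unitVol) :
    Integrable (fun y => u y * v y) unitVol := hu.integrable_mul hv

theorem integral_norm_mul_le (hu : MemLp u 2 unitVol) (hv : MemLp v 2 unitVol) :
    ∫ y, ‖u y‖ * ‖v y‖ ∂unitVol ≤ l2 u * l2 v := by
  have h := integral_mul_norm_le_Lp_mul_Lq (μ := unitVol) (f := u) (g := v)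
    Real.HolderConjugate.two_two (by simpa using hu) (by simpa using hv)
  have e : ∀ w : ℝ → ℂ, MemLp w 2 unitVol →
      (∫ y, ‖w y‖ ^ (2 : ℝ) ∂unitVol) ^ (1 / (2 : ℝ)) = l2 w := by
    intro w hw
    simp only [Real.rpow_two]
    rw [← l2_sq hw, ← Real.sqrt_eq_rpow, Real.sqrt_sq (l2_nonneg w)]
  rwa [e u hu, e v hv] at h

theorem norm_integral_mul_le (hu : MemLp u 2 unitVol) (hv : MemLp v 2 unitVol) :
    ‖∫ y, u y * v y ∂unitVol‖ ≤ l2 u * l2 v :=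
  (norm_integral_le_integral_norm _).trans (by simpa using integral_norm_mul_le hu hv)

end

namespace IsPrimitive

variable {u u' : ℝ → ℂ}

theorem eq_add (h : IsPrimitive u u') {x y : ℝ} (hx : x ∈ Icc (0 : ℝ) 1) (hy : y ∈ Icc (0 : ℝ) 1) :
    u y = u x + ∫ s in x..y, u' s := by
  rw [h.eq y hy, h.eq x hx, add_assoc, intervalIntegral.integral_add_adjacent_intervals
    (intervalIntegrable_sub h.integrable (by simp) hx) (intervalIntegrable_sub h.integrable hx hy)]

/-- The `1/2`-Hölder bound of `H¹` functions. -/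
theorem norm_sub_le (h : IsPrimitive u u') (h' : MemLp u' 2 unitVol) {x y : ℝ}
    (hx : x ∈ Icc (0 : ℝ) 1) (hy : y ∈ Icc (0 : ℝ) 1) (hxy : x ≤ y) :
    ‖u y - u x‖ ≤ √(y - x) * l2 u' := by
  have hs : Ioc x y ⊆ Ioc (0 : ℝ) 1 := fun s hs => ⟨hx.1.trans_lt hs.1, hs.2.trans hy.2⟩
  have h1 : u y - u x = ∫ s, (Ioc x y).indicator 1 s * u' s ∂unitVol := by
    have e : ∀ s, (Ioc x y).indicator 1 s * u' s = (Ioc x y).indicator u' s := by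
      intro s; by_cases hs : s ∈ Ioc x y <;> simp [hs]
    simp_rw [e]
    rw [integral_indicator measurableSet_Ioc, unitVol_eq_restrict_Ioc,
      Measure.restrict_restrict measurableSet_Ioc, inter_eq_left.2 hs,
      h.eq_add hx hy, intervalIntegral.integral_of_le hxy]
    ring
  have hm : MemLp ((Ioc x y).indicator (1 : ℝ → ℂ)) 2 unitVol :=
    (memLp_const (1 : ℂ)).indicator measurableSet_Ioc
  have h2 : l2 ((Ioc x y).indicator (1 : ℝ → ℂ)) = √(y - x) := by
    rw [← Real.sqrt_sq (l2_nonneg _), l2_sq hm]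
    congr 1
    have e : ∀ s, ‖(Ioc x y).indicator (1 : ℝ → ℂ) s‖ ^ 2 = (Ioc x y).indicator (1 : ℝ → ℝ) s := by
      intro s; by_cases hs : s ∈ Ioc x y <;> simp [hs]
    simp_rw [e]
    rw [integral_indicator measurableSet_Ioc, unitVol_eq_restrict_Ioc,
      Measure.restrict_restrict measurableSet_Ioc, inter_eq_left.2 hs]
    simp [hxy]
  rw [h1, ← h2]
  exact norm_integral_mul_le hm h'

theorem norm_le_of_zero (h : IsPrimitive u u') (h' : MemLp u' 2 unitVol) (h0 : u 0 = 0) {y : ℝ}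
    (hy : y ∈ Icc (0 : ℝ) 1) : ‖u y‖ ≤ l2 u' := by
  have h1 := h.norm_sub_le h' (by simp) hy hy.1
  rw [h0, sub_zero, sub_zero] at h1
  refine h1.trans (mul_le_of_le_one_left (l2_nonneg _) ?_)
  exact Real.sqrt_le_one.2 hy.2

theorem l2_le_of_zero (h : IsPrimitive u u') (h' : MemLp u' 2 unitVol) (h0 : u 0 = 0) :
    l2 u ≤ l2 u' :=
  l2_le_of_bound (l2_nonneg _) (ae_unitVol_of_forall fun _ hy => h.norm_le_of_zero h' h0 hy)

end IsPrimitive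

/-! ### Fourier coefficients on the unit interval -/

/-- The character `y ↦ e^{iτy}`. -/
noncomputable def phase (τ y : ℝ) : ℂ := Complex.exp (Complex.I * (τ * y : ℝ))

theorem norm_phase (τ y : ℝ) : ‖phase τ y‖ = 1 := by
  rw [phase, mul_comm]; exact Complex.norm_exp_ofReal_mul_I _

theorem phase_mul (τ σ y : ℝ) : phase τ y * phase σ y = phase (τ + σ) y := by
  rw [phase, phase, phase, ← Complex.exp_add]; congr 1; push_cast; ring

theorem phase_mul_neg (τ y : ℝ) : phase τ y * phase (-τ) y = 1 := by
  rw [phase_mul]; simp [phase]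

theorem conj_phase (τ y : ℝ) : starRingEnd ℂ (phase τ y) = phase (-τ) y := by
  rw [phase, phase, ← Complex.exp_conj]; congr 1; simp

theorem hasDerivAt_phase (τ y : ℝ) : HasDerivAt (phase τ) (Complex.I * τ * phase τ y) y := by
  have h1 : HasDerivAt (fun y : ℝ => Complex.I * ((τ * y : ℝ) : ℂ)) (Complex.I * τ) y := by
    have h := ((hasDerivAt_id y).const_mul τ).ofReal_comp.const_mul Complex.I
    simpa using h
  have h2 := h1.cexp
  rwa [mul_comm (Complex.exp _)] at h2

theorem continuous_phase (τ : ℝ) : Continuous (phase τ) :=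
  continuous_iff_continuousAt.2 fun y => (hasDerivAt_phase τ y).continuousAt

theorem isPrimitive_phase (τ : ℝ) : IsPrimitive (phase τ) (fun y => Complex.I * τ * phase τ y) :=
  .of_hasDerivAt (fun y _ => hasDerivAt_phase τ y) (by
    have := continuous_phase τ
    fun_prop)

theorem memLp_phase_mul {u : ℝ → ℂ} (hu : MemLp u 2 unitVol) (τ : ℝ) :
    MemLp (fun y => phase τ y * u y) 2 unitVol :=
  memLp_mul_continuousOn hu (continuous_phase τ).continuousOn

theorem l2_phase_mul (u : ℝ → ℂ) (τ : ℝ) : l2 (fun y => phase τ y * u y) = l2 u := by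
  rw [l2, l2]
  congr 1
  exact eLpNorm_congr_norm_ae (Filter.Eventually.of_forall fun y => by simp [norm_phase])

/-- The Fourier coefficients of a function on `(0,1)`. -/
noncomputable def fc (u : ℝ → ℂ) (n : ℤ) : ℂ := ∫ y, phase (-(2 * Real.pi * n)) y * u y ∂unitVol

theorem fc_congr {u v : ℝ → ℂ} (h : u =ᵐ[unitVol] v) : fc u = fc v := by
  funext n
  exact integral_congr_ae (h.mono fun y hy => by simp [hy])

theorem fc_eq_fourierCoeffOn (u : ℝ → ℂ) (n : ℤ) :
    fc u n = fourierCoeffOn (zero_lt_one' ℝ) u n := by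
  rw [fourierCoeffOn_eq_integral, fc, integral_unitVol]
  simp only [sub_zero, div_one, one_smul]
  refine intervalIntegral.integral_congr fun y _ => ?_
  simp only [smul_eq_mul, fourier_coe_apply, phase]
  congr 2
  push_cast
  ring

/-- Parseval's identity. -/
theorem hasSum_sq_fc {u : ℝ → ℂ} (hu : MemLp u 2 unitVol) :
    HasSum (fun n => ‖fc u n‖ ^ 2) (l2 u ^ 2) := by
  have h := hasSum_sq_fourierCoeffOn (zero_lt_one' ℝ)
    (f := u) (by rwa [← unitVol_eq_restrict_Ioc])
  simp_rw [← fc_eq_fourierCoeffOn] at h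
  rw [l2_sq hu, unitVol_eq_restrict_Ioc, ← intervalIntegral.integral_of_le zero_le_one]
  simpa using h

theorem fc_add {u v : ℝ → ℂ} (hu : MemLp u 2 unitVol) (hv : MemLp v 2 unitVol) (n : ℤ) :
    fc (fun y => u y + v y) n = fc u n + fc v n := by
  rw [fc, fc, fc, ← integral_add ((memLp_phase_mul hu _).integrable (by norm_num))
    ((memLp_phase_mul hv _).integrable (by norm_num))]
  simp only [mul_add]

theorem fc_const_mul (a : ℂ) (u : ℝ → ℂ) (n : ℤ) :
    fc (fun y => a * u y) n = a * fc u n := by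
  rw [fc, fc, ← integral_const_mul]
  congr 1; ext y; ring

/-- The real part of the polarized Parseval identity. -/
theorem hasSum_re_fc_mul {u v : ℝ → ℂ} (hu : MemLp u 2 unitVol) (hv : MemLp v 2 unitVol) :
    HasSum (fun n => (fc u n * starRingEnd ℂ (fc v n)).re)
      (∫ y, u y * starRingEnd ℂ (v y) ∂unitVol).re := by
  have huv : MemLp (fun y => u y + v y) 2 unitVol := hu.add hv
  have h := ((hasSum_sq_fc huv).sub ((hasSum_sq_fc hu).add (hasSum_sq_fc hv))).div_const 2
  have key : ∀ a b : ℂ, (a * starRingEnd ℂ b).re = (‖a + b‖ ^ 2 - (‖a‖ ^ 2 + ‖b‖ ^ 2)) / 2 := by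
    intro a b
    simp only [Complex.sq_norm, Complex.normSq_apply, Complex.mul_re, Complex.conj_re,
      Complex.conj_im, Complex.add_re, Complex.add_im]
    ring
  have hi := integrable_mul_of_memLp hu (memLp_conj hv)
  have e : (l2 (fun y => u y + v y) ^ 2 - (l2 u ^ 2 + l2 v ^ 2)) / 2
      = (∫ y, u y * starRingEnd ℂ (v y) ∂unitVol).re := by
    have e1 := (integral_sub (integrable_norm_sq huv)
        ((integrable_norm_sq hu).add (integrable_norm_sq hv))).trans
      (congrArg _ (integral_add (integrable_norm_sq hu) (integrable_norm_sq hv)))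
    rw [← RCLike.re_eq_complex_re, ← integral_re hi, l2_sq huv, l2_sq hu, l2_sq hv]
    refine (congrArg (· / 2) e1.symm).trans ?_
    rw [← integral_div]
    refine integral_congr_ae (Filter.Eventually.of_forall fun y => ?_)
    exact (key (u y) (v y)).symm
  rw [e] at h
  refine h.congr_fun fun n => ?_
  rw [fc_add hu hv, key]

theorem fc_phase_mul_deriv {r r' : ℝ → ℂ} (hr : IsPrimitive r r') (τ : ℝ) (n : ℤ) :
    Complex.I * ((2 * Real.pi * n - τ : ℝ) : ℂ) * fc (fun y => phase τ y * r y) n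
      = fc (fun y => phase τ y * r' y) n
        - (phase (τ - 2 * Real.pi * n) 1 * r 1 - r 0) := by
  have h := (isPrimitive_phase (τ - 2 * Real.pi * n)).integral_mul_eq hr
  have e : ∀ w : ℝ → ℂ, fc (fun y => phase τ y * w y) n
      = ∫ y, phase (τ - 2 * Real.pi * n) y * w y ∂unitVol := by
    intro w
    refine integral_congr_ae (Filter.Eventually.of_forall fun y => ?_)
    simp only
    rw [← mul_assoc, phase_mul]; congr 2; ring
  have hb : Integrable (fun y => phase (τ - 2 * Real.pi * n) y * r' y) unitVol :=
    hr.integrable.bdd_mul (c := 1) (continuous_phase _).aestronglyMeasurable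
      (Filter.Eventually.of_forall fun y => (norm_phase _ y).le)
  have hc : Integrable (fun y => phase (τ - 2 * Real.pi * n) y * r y) unitVol :=
    integrable_of_continuousOn ((continuous_phase _).continuousOn.mul hr.continuousOn)
  have h0 : phase (τ - 2 * Real.pi * n) 0 = 1 := by simp [phase]
  have h2 : ∫ y, Complex.I * ((τ - 2 * Real.pi * n : ℝ) : ℂ) * phase (τ - 2 * Real.pi * n) y * r y
        ∂unitVol = Complex.I * ((τ - 2 * Real.pi * n : ℝ) : ℂ)
        * ∫ y, phase (τ - 2 * Real.pi * n) y * r y ∂unitVol := by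
    rw [← integral_const_mul]; congr 1; ext y; ring
  rw [integral_add ?_ hb, h2, h0] at h
  · rw [e r, e r']
    push_cast at h ⊢
    linear_combination (-1) * h
  · simpa only [mul_assoc] using (hc.const_mul
      (Complex.I * ((τ - 2 * Real.pi * n : ℝ) : ℂ)))

/-- Parseval's identity for a function of `H¹₀` in the moving frame: the operator `∂_y - iτ` acts
on the `n`-th mode as multiplication by `i (2πn - τ)`. -/
theorem hasSum_weighted_sq_fc {θ θ' : ℝ → ℂ} (hθ : IsPrimitive θ θ') (h' : MemLp θ' 2 unitVol)
    (h0 : θ 0 = 0) (h1 : θ 1 = 0) (K τ : ℝ) :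
    HasSum (fun n : ℤ => (K ^ 2 + (2 * Real.pi * n - τ) ^ 2) * ‖fc (fun y => phase τ y * θ y) n‖ ^ 2)
      (K ^ 2 * l2 θ ^ 2 + l2 θ' ^ 2) := by
  have hA := (hasSum_sq_fc (memLp_phase_mul (hθ.memLp 2) τ)).mul_left (K ^ 2)
  have hB := hasSum_sq_fc (memLp_phase_mul h' τ)
  rw [l2_phase_mul] at hA hB
  refine (hA.add hB).congr_fun fun n => ?_
  have h := fc_phase_mul_deriv hθ τ n
  rw [h0, h1, mul_zero, sub_zero, sub_zero] at h
  rw [← h, norm_mul, norm_mul, Complex.norm_I, Complex.norm_real, Real.norm_eq_abs, mul_pow,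
    one_mul, sq_abs]
  ring

/-- Decay of the Fourier coefficients of a function of bounded variation in the moving frame. -/
theorem norm_fc_phase_mul_le {r r' : ℝ → ℂ} (hr : IsPrimitive r r') {K : ℝ} (hK : 0 ≤ K)
    (τ : ℝ) (n : ℤ) :
    (K + |2 * Real.pi * n - τ|) * ‖fc (fun y => phase τ y * r y) n‖
      ≤ ‖r 0‖ + ‖r 1‖ + (∫ y, ‖r' y‖ ∂unitVol) + K * ∫ y, ‖r y‖ ∂unitVol := by
  have hb : ∀ w : ℝ → ℂ, ‖fc (fun y => phase τ y * w y) n‖ ≤ ∫ y, ‖w y‖ ∂unitVol := fun w =>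
    (norm_integral_le_integral_norm _).trans (by simp [norm_phase])
  have h := congrArg norm (fc_phase_mul_deriv hr τ n)
  rw [norm_mul, norm_mul, Complex.norm_I, Complex.norm_real, Real.norm_eq_abs, one_mul] at h
  have h2 : ‖phase (τ - 2 * Real.pi * n) 1 * r 1 - r 0‖ ≤ ‖r 1‖ + ‖r 0‖ :=
    (norm_sub_le _ _).trans (by simp [norm_phase])
  have h3 := norm_sub_le (fc (fun y => phase τ y * r' y) n)
    (phase (τ - 2 * Real.pi * n) 1 * r 1 - r 0)
  rw [add_mul, h]
  have := mul_le_mul_of_nonneg_left (hb r) hK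
  linarith [hb r']

/-- The pairing of `v` with a function of `H¹₀` is controlled by the norm of `H⁻¹` in the moving
frame, which is diagonal in the Fourier coefficients of `v`. -/
theorem re_integral_phase_mul_conj_le {v θ θ' : ℝ → ℂ} (hv : MemLp v 2 unitVol)
    (hθ : IsPrimitive θ θ') (h' : MemLp θ' 2 unitVol)
    (h0 : θ 0 = 0) (h1 : θ 1 = 0) {K : ℝ} (hK : 0 < K) (τ : ℝ) :
    |(∫ y, phase (-τ) y * v y * starRingEnd ℂ (θ y) ∂unitVol).re|
      ≤ √(∑' n : ℤ, ‖fc v n‖ ^ 2 / (K ^ 2 + (2 * Real.pi * n - τ) ^ 2)) * (K * l2 θ + l2 θ') := by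
  set w : ℤ → ℝ := fun n => K ^ 2 + (2 * Real.pi * n - τ) ^ 2 with hw
  have hwp : ∀ n, 0 < w n := fun n => by positivity
  set X : ℤ → ℂ := fun n => fc (fun y => phase τ y * θ y) n with hX
  have hs := hasSum_re_fc_mul hv (memLp_phase_mul (hθ.memLp 2) τ)
  have e : ∫ y, v y * starRingEnd ℂ (phase τ y * θ y) ∂unitVol
      = ∫ y, phase (-τ) y * v y * starRingEnd ℂ (θ y) ∂unitVol := by
    congr 1; ext y; rw [map_mul, conj_phase]; ring
  rw [e] at hs
  have hP := hasSum_weighted_sq_fc hθ h' h0 h1 K τ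
  have hV : Summable fun n => ‖fc v n‖ ^ 2 / w n := by
    refine Summable.of_nonneg_of_le (fun n => by have := hwp n; positivity) (fun n => ?_)
      ((hasSum_sq_fc hv).summable.div_const (K ^ 2))
    gcongr
    simp only [hw]; nlinarith [sq_nonneg (2 * Real.pi * n - τ)]
  have hCS := Real.summable_and_inner_le_Lp_mul_Lq_tsum_of_nonneg (f := fun n => ‖fc v n‖ / √(w n))
    (g := fun n => √(w n) * ‖X n‖) Real.HolderConjugate.two_two (fun n => by positivity)
    (fun n => by positivity)
  have e1 : ∀ n, (‖fc v n‖ / √(w n)) ^ (2 : ℝ) = ‖fc v n‖ ^ 2 / w n := fun n => by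
    rw [Real.rpow_two, div_pow, Real.sq_sqrt (hwp n).le]
  have e2 : ∀ n, (√(w n) * ‖X n‖) ^ (2 : ℝ) = w n * ‖X n‖ ^ 2 := fun n => by
    rw [Real.rpow_two, mul_pow, Real.sq_sqrt (hwp n).le]
  have e3 : ∀ n, ‖fc v n‖ / √(w n) * (√(w n) * ‖X n‖) = ‖fc v n‖ * ‖X n‖ := fun n => by
    have := Real.sqrt_pos.2 (hwp n)
    field_simp
  simp only [e1, e2, e3] at hCS
  obtain ⟨hS, hle⟩ := hCS hV hP.summable
  rw [hP.tsum_eq, ← Real.sqrt_eq_rpow, ← Real.sqrt_eq_rpow] at hle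
  have hterm : ∀ n, |(fc v n * starRingEnd ℂ (X n)).re| ≤ ‖fc v n‖ * ‖X n‖ := fun n =>
    (Complex.abs_re_le_norm _).trans (by simp)
  have h3 : |(∫ y, phase (-τ) y * v y * starRingEnd ℂ (θ y) ∂unitVol).re|
      ≤ ∑' n, ‖fc v n‖ * ‖X n‖ := by
    rw [← hs.tsum_eq]
    rw [← Real.norm_eq_abs]
    exact tsum_of_norm_bounded hS.hasSum fun n => (Real.norm_eq_abs _).trans_le (hterm n)
  refine h3.trans (hle.trans ?_)
  gcongr
  refine Real.sqrt_le_iff.2 ⟨by have := l2_nonneg θ; have := l2_nonneg θ'; positivity, ?_⟩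
  nlinarith [mul_nonneg hK.le (mul_nonneg (l2_nonneg θ) (l2_nonneg θ'))]

end FiniteChannel

namespace FiniteChannel

/-! ### The elliptic problem in divergence form -/

/-- The coefficients of the elliptic problem: `h = 1/g`, its logarithmic derivative `β = h'/h`, and
`ρ = β'/h` with derivative `ρ'`, all bounded by `A`. -/
structure Background (A : ℝ) (h : ℝ → ℝ) (β ρ ρ' : ℝ → ℂ) : Prop where
  one_le : 1 ≤ A
  le_h : ∀ y ∈ Icc (0 : ℝ) 1, A⁻¹ ≤ h y
  h_le : ∀ y ∈ Icc (0 : ℝ) 1, h y ≤ A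
  prim_h : IsPrimitive (fun y => (h y : ℂ)) (fun y => β y * h y)
  prim_β : IsPrimitive β (fun y => h y * ρ y)
  prim_ρ : IsPrimitive ρ ρ'
  norm_β_le : ∀ y ∈ Icc (0 : ℝ) 1, ‖β y‖ ≤ A
  norm_ρ_le : ∀ y ∈ Icc (0 : ℝ) 1, ‖ρ y‖ ≤ A
  norm_ρ'_le : ∀ᵐ y ∂unitVol, ‖ρ' y‖ ≤ A

/-- `p` solves `(g ∂_y)² p - κ² p = s`, written with `h = 1/g` as the first order system
`p' = h ξ`, `ξ' = h (s + κ² p)` for `p` and its flux `ξ = g p'`. -/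
structure IsElliptic (h : ℝ → ℝ) (κ : ℝ) (p ξ s : ℝ → ℂ) : Prop where
  prim_p : IsPrimitive p (fun y => h y * ξ y)
  prim_ξ : IsPrimitive ξ (fun y => h y * (s y + κ ^ 2 * p y))

variable {A κ : ℝ} {h : ℝ → ℝ} {β ρ ρ' : ℝ → ℂ}

namespace Background

theorem pos (hB : Background A h β ρ ρ') : 0 < A := zero_lt_one.trans_le hB.one_le

theorem h_pos (hB : Background A h β ρ ρ') {y : ℝ} (hy : y ∈ Icc (0 : ℝ) 1) : 0 < h y :=
  (inv_pos.2 hB.pos).trans_le (hB.le_h y hy)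

theorem norm_h_le (hB : Background A h β ρ ρ') {y : ℝ} (hy : y ∈ Icc (0 : ℝ) 1) :
    ‖(h y : ℂ)‖ ≤ A := by
  rw [Complex.norm_real, Real.norm_eq_abs, abs_of_pos (hB.h_pos hy)]; exact hB.h_le y hy

theorem continuousOn_h (hB : Background A h β ρ ρ') : ContinuousOn h (Icc 0 1) := by
  exact Complex.continuous_re.comp_continuousOn hB.prim_h.continuousOn

theorem memLp_h_mul (hB : Background A h β ρ ρ') {u : ℝ → ℂ} (hu : MemLp u 2 unitVol) :
    MemLp (fun y => h y * u y) 2 unitVol :=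
  memLp_mul_continuousOn hu hB.prim_h.continuousOn

theorem l2_h_mul_le (hB : Background A h β ρ ρ') {u : ℝ → ℂ} (hu : MemLp u 2 unitVol) :
    l2 (fun y => h y * u y) ≤ A * l2 u :=
  l2_le_mul hu hB.pos.le (ae_unitVol_of_forall fun y hy => by
    rw [norm_mul]; gcongr; exact hB.norm_h_le hy)

end Background

namespace IsElliptic

variable {p ξ s q η t : ℝ → ℂ}

theorem memLp_ξ (hp : IsElliptic h κ p ξ s) : MemLp ξ 2 unitVol := hp.prim_ξ.memLp 2

theorem sub (hp : IsElliptic h κ p ξ s) (hq : IsElliptic h κ q η t) :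
    IsElliptic h κ (fun y => p y - q y) (fun y => ξ y - η y) (fun y => s y - t y) where
  prim_p := (hp.prim_p.sub hq.prim_p).congr (fun _ _ => rfl)
    (Filter.Eventually.of_forall fun y => by ring)
  prim_ξ := (hp.prim_ξ.sub hq.prim_ξ).congr (fun _ _ => rfl)
    (Filter.Eventually.of_forall fun y => by ring)

theorem const_mul (hp : IsElliptic h κ p ξ s) (a : ℂ) :
    IsElliptic h κ (fun y => a * p y) (fun y => a * ξ y) (fun y => a * s y) where
  prim_p := (hp.prim_p.const_mul a).congr (fun _ _ => rfl)
    (Filter.Eventually.of_forall fun y => by ring)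
  prim_ξ := (hp.prim_ξ.const_mul a).congr (fun _ _ => rfl)
    (Filter.Eventually.of_forall fun y => by ring)

/-- The energy norm of a solution, in terms of its flux. -/
theorem energy_le (hB : Background A h β ρ ρ') (hp : IsElliptic h κ p ξ s)
    (hs : Integrable s unitVol) (h0 : p 0 = 0) (h1 : p 1 = 0) :
    (max κ 1 * l2 p + l2 ξ) ^ 2
      ≤ 2 * (A ^ 2 + 1) * A * |(∫ y, s y * starRingEnd ℂ (h y * p y) ∂unitVol).re| := by
  have hA := hB.pos
  have hpL := hp.prim_p.memLp 2
  have hξL := hp.memLp_ξ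
  have hhξ := hB.memLp_h_mul hξL
  have hhp := hB.memLp_h_mul hpL
  have key := hp.prim_ξ.integral_mul_eq hp.prim_p.conj
  simp only [h0, h1, map_zero, mul_zero, sub_zero] at key
  have iS : Integrable (fun y => s y * starRingEnd ℂ (h y * p y)) unitVol := by
    obtain ⟨C, hC⟩ := isCompact_Icc.exists_bound_of_continuousOn
      (hB.prim_h.continuousOn.mul hp.prim_p.continuousOn)
    exact hs.mul_bdd (c := C) (memLp_conj hhp).1 (ae_unitVol_of_forall fun y hy => by
      simpa using hC y hy)
  have i1 := integrable_mul_of_memLp hhξ (memLp_conj hξL)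
  have i2 := (integrable_mul_of_memLp hhp (memLp_conj hpL)).const_mul ((κ : ℂ) ^ 2)
  have e1 : ∫ y, ((h y * (s y + κ ^ 2 * p y)) * starRingEnd ℂ (p y)
      + ξ y * starRingEnd ℂ (h y * ξ y)) ∂unitVol
      = (∫ y, s y * starRingEnd ℂ (h y * p y) ∂unitVol)
        + ((∫ y, h y * ξ y * starRingEnd ℂ (ξ y) ∂unitVol)
        + ∫ y, κ ^ 2 * (h y * p y * starRingEnd ℂ (p y)) ∂unitVol) := by
    rw [← integral_add i1 i2]
    refine Eq.trans ?_ (integral_add iS (i1.add i2))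
    refine integral_congr_ae (Filter.Eventually.of_forall fun y => ?_)
    simp only [map_mul, Complex.conj_ofReal]
    ring
  rw [e1] at key
  have low : ∀ w : ℝ → ℂ, MemLp w 2 unitVol →
      A⁻¹ * l2 w ^ 2 ≤ (∫ y, h y * w y * starRingEnd ℂ (w y) ∂unitVol).re := by
    intro w hw
    have iw := integrable_mul_of_memLp (hB.memLp_h_mul hw) (memLp_conj hw)
    rw [← RCLike.re_eq_complex_re, ← integral_re iw, l2_sq hw, ← integral_const_mul]
    refine integral_mono_ae ((integrable_norm_sq hw).const_mul _) iw.re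
      (ae_unitVol_of_forall fun y hy => ?_)
    have e : (h y : ℂ) * w y * starRingEnd ℂ (w y) = ((h y * ‖w y‖ ^ 2 : ℝ) : ℂ) := by
      rw [mul_assoc, Complex.mul_conj, Complex.normSq_eq_norm_sq]; push_cast; ring
    simp only [e, RCLike.re_eq_complex_re, Complex.ofReal_re]
    gcongr
    exact hB.le_h y hy
  have lξ := low ξ hξL
  have lp := low p hpL
  rw [integral_const_mul] at key
  have kre := congrArg Complex.re key
  rw [Complex.add_re, Complex.add_re] at kre
  have e3 : ((κ : ℂ) ^ 2 * ∫ y, h y * p y * starRingEnd ℂ (p y) ∂unitVol).re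
      = κ ^ 2 * (∫ y, h y * p y * starRingEnd ℂ (p y) ∂unitVol).re := by
    rw [← Complex.ofReal_pow, Complex.re_ofReal_mul]
  rw [e3, Complex.zero_re] at kre
  set R := (∫ y, s y * starRingEnd ℂ (h y * p y) ∂unitVol).re with hR
  have main : A⁻¹ * l2 ξ ^ 2 + κ ^ 2 * (A⁻¹ * l2 p ^ 2) ≤ |R| := by
    have := mul_le_mul_of_nonneg_left lp (sq_nonneg κ)
    linarith [neg_abs_le R]
  have main' : l2 ξ ^ 2 + κ ^ 2 * l2 p ^ 2 ≤ A * |R| := by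
    have := mul_le_mul_of_nonneg_left main hA.le
    calc l2 ξ ^ 2 + κ ^ 2 * l2 p ^ 2 = A * (A⁻¹ * l2 ξ ^ 2 + κ ^ 2 * (A⁻¹ * l2 p ^ 2)) := by
          field_simp
      _ ≤ _ := this
  have hpo : l2 p ≤ A * l2 ξ :=
    (hp.prim_p.l2_le_of_zero hhξ h0).trans (hB.l2_h_mul_le hξL)
  have hp2 : l2 p ^ 2 ≤ A ^ 2 * l2 ξ ^ 2 := by
    rw [← mul_pow]; exact pow_le_pow_left₀ (l2_nonneg _) hpo 2
  have hK : (max κ 1) ^ 2 ≤ κ ^ 2 + 1 := by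
    rcases max_cases κ 1 with h | h <;> rw [h.1] <;> nlinarith
  have hK' := mul_le_mul_of_nonneg_right hK (sq_nonneg (l2 p))
  have h6 : (max κ 1 * l2 p + l2 ξ) ^ 2 ≤ 2 * (max κ 1 ^ 2 * l2 p ^ 2 + l2 ξ ^ 2) := by
    nlinarith [sq_nonneg (max κ 1 * l2 p - l2 ξ)]
  have h7 : max κ 1 ^ 2 * l2 p ^ 2 + l2 ξ ^ 2 ≤ (A ^ 2 + 1) * (l2 ξ ^ 2 + κ ^ 2 * l2 p ^ 2) := by
    nlinarith [sq_nonneg A, mul_nonneg (sq_nonneg A) (mul_nonneg (sq_nonneg κ) (sq_nonneg (l2 p)))]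
  have h8 := mul_le_mul_of_nonneg_left main' (by positivity : (0 : ℝ) ≤ A ^ 2 + 1)
  linarith

/-- A solution of the elliptic problem with a source that is bounded by `D` as a functional on
`H¹₀` is bounded by `D` in the energy norm. -/
theorem energy_le_of_pairing (hB : Background A h β ρ ρ')
    (hp : IsElliptic h κ p ξ s) (hs : Integrable s unitVol) (h0 : p 0 = 0) (h1 : p 1 = 0)
    {D : ℝ} (hD0 : 0 ≤ D) (hD : |(∫ y, s y * starRingEnd ℂ (h y * p y) ∂unitVol).re|
      ≤ D * (max κ 1 * l2 p + l2 ξ)) :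
    max κ 1 * l2 p + l2 ξ ≤ 2 * (A ^ 2 + 1) * A * D := by
  have hA := hB.pos
  have hE : 0 ≤ max κ 1 * l2 p + l2 ξ := by
    have := l2_nonneg p; have := l2_nonneg ξ; positivity
  rcases hE.eq_or_lt with h2 | h2
  · rw [← h2]; positivity
  · have h3 := (energy_le hB hp hs h0 h1).trans (mul_le_mul_of_nonneg_left hD (by positivity))
    rw [sq, ← mul_assoc] at h3
    exact le_of_mul_le_mul_right h3 h2

end IsElliptic

/-! ### Solutions of the homogeneous elliptic problem -/

/-- A solution of the homogeneous problem that decays away from an end point of `[0,1]`, where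
`r` is the distance to that end point. -/
structure IsBoundaryLayer (C A κ : ℝ) (h r : ℝ → ℝ) (u ξ : ℝ → ℂ) : Prop where
  elliptic : IsElliptic h κ u ξ 0
  norm_u_le : ∀ y ∈ Icc (0 : ℝ) 1, ‖u y‖ ≤ C * Real.exp (-(max κ 1 * r y / A))
  norm_ξ_le : ∀ y ∈ Icc (0 : ℝ) 1, ‖ξ y‖ ≤ C * max κ 1 * Real.exp (-(max κ 1 * r y / A))

theorem sinh_div_sinh_le {x a : ℝ} (hxa : x ≤ a) (ha : 0 < a) :
    Real.sinh x / Real.sinh a ≤ Real.exp (-(a - x)) := by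
  rw [div_le_iff₀ (Real.sinh_pos_iff.2 ha), Real.sinh_eq, Real.sinh_eq, mul_div_assoc', mul_sub,
    ← Real.exp_add, ← Real.exp_add]
  have : Real.exp (-(a - x) + -a) ≤ Real.exp (-x) := Real.exp_le_exp.2 (by linarith)
  have e : -(a - x) + a = x := by ring
  rw [e]; linarith

theorem cosh_div_sinh_le {x a : ℝ} (hx : 0 ≤ x) (ha : 0 < a) :
    Real.cosh x / Real.sinh a ≤ (2 + a⁻¹) * Real.exp (-(a - x)) := by
  have h1 : Real.cosh x ≤ Real.exp (-(a - x)) * Real.exp a := by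
    rw [← Real.exp_add, Real.cosh_eq]
    have : Real.exp (-x) ≤ Real.exp x := Real.exp_le_exp.2 (by linarith)
    have e : -(a - x) + a = x := by ring
    rw [e]; linarith
  have h2 : Real.exp a ≤ (2 + a⁻¹) * Real.sinh a := by
    have h3 : a ≤ Real.sinh a := Real.self_le_sinh_iff.2 ha.le
    have h4 : Real.exp a = 2 * Real.sinh a + Real.exp (-a) := by rw [Real.sinh_eq]; ring
    have h5 : Real.exp (-a) ≤ 1 := Real.exp_le_one_iff.2 (by linarith)
    have h6 : 1 ≤ a⁻¹ * Real.sinh a := by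
      rw [← inv_mul_cancel₀ ha.ne']; gcongr
    linarith
  rw [div_le_iff₀ (Real.sinh_pos_iff.2 ha)]
  calc Real.cosh x ≤ Real.exp (-(a - x)) * Real.exp a := h1
    _ ≤ Real.exp (-(a - x)) * ((2 + a⁻¹) * Real.sinh a) := by gcongr
    _ = _ := by ring

/-- The two solutions of the homogeneous problem with boundary values `1, 0` and `0, 1`. In the
variable `z = ∫ h` they are `sinh (κ (Z - z)) / sinh (κ Z)` and `sinh (κ z) / sinh (κ Z)`. -/
theorem exists_boundaryLayers (A : ℝ) : ∃ C : ℝ, 0 < C ∧ ∀ (h : ℝ → ℝ) (β ρ ρ' : ℝ → ℂ) (κ : ℝ),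
    Background A h β ρ ρ' → 0 < κ → ∃ u₀ ξ₀ u₁ ξ₁ : ℝ → ℂ,
      IsBoundaryLayer C A κ h (fun y => y) u₀ ξ₀ ∧ IsBoundaryLayer C A κ h (fun y => 1 - y) u₁ ξ₁ ∧
      u₀ 0 = 1 ∧ u₀ 1 = 0 ∧ u₁ 0 = 0 ∧ u₁ 1 = 1 := by
  refine ⟨(2 + |A|) * Real.exp 1, by positivity, fun h β ρ ρ' κ hB hκ => ?_⟩
  have hA := hB.pos
  rw [abs_of_pos hA]
  set K := max κ 1 with hK
  set H : ℝ → ℝ := IccExtend zero_le_one ((Icc (0 : ℝ) 1).domRestrict h) with hH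
  have cH : Continuous H := hB.continuousOn_h.domRestrict.Icc_extend'
  have eH : ∀ y ∈ Icc (0 : ℝ) 1, H y = h y := fun y hy => by rw [hH, IccExtend_of_mem _ _ hy]; rfl
  set z : ℝ → ℝ := fun y => ∫ s in (0 : ℝ)..y, H s with hz
  have dz : ∀ y ∈ Icc (0 : ℝ) 1, HasDerivAt z (h y) y := fun y hy => by
    rw [← eH y hy]
    exact intervalIntegral.integral_hasDerivAt_right (cH.intervalIntegrable _ _)
      (cH.stronglyMeasurableAtFilter _ _) cH.continuousAt
  have z0 : z 0 = 0 := by simp [hz]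
  -- `z` increases with slope at least `1/A`
  have zmono : ∀ x ∈ Icc (0 : ℝ) 1, ∀ y ∈ Icc (0 : ℝ) 1, x ≤ y → (y - x) / A ≤ z y - z x := by
    intro x hx y hy hxy
    have e : z y - z x = ∫ s in x..y, H s :=
      intervalIntegral.integral_interval_sub_left (cH.intervalIntegrable _ _)
        (cH.intervalIntegrable _ _)
    have e2 : (y - x) / A = ∫ s in x..y, A⁻¹ := by
      rw [intervalIntegral.integral_const, smul_eq_mul, div_eq_mul_inv]
    rw [e, e2]
    refine intervalIntegral.integral_mono_on hxy (by simp) (cH.intervalIntegrable _ _)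
      fun s hs => ?_
    have hs' : s ∈ Icc (0 : ℝ) 1 := ⟨hx.1.trans hs.1, hs.2.trans hy.2⟩
    rw [eH s hs']; exact hB.le_h s hs'
  set Z := z 1 with hZ
  have Z1 : A⁻¹ ≤ Z := by
    have := zmono 0 (by simp) 1 (by simp) zero_le_one
    rw [z0] at this; simpa using this
  have Zpos : 0 < Z := (inv_pos.2 hA).trans_le Z1
  have zl : ∀ y ∈ Icc (0 : ℝ) 1, y / A ≤ z y := fun y hy => by
    have := zmono 0 (by simp) y hy hy.1
    rwa [z0, sub_zero, sub_zero] at this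
  have zu : ∀ y ∈ Icc (0 : ℝ) 1, (1 - y) / A ≤ Z - z y := fun y hy => zmono y hy 1 (by simp) hy.2
  have hs : Real.sinh (κ * Z) ≠ 0 := (Real.sinh_pos_iff.2 (by positivity)).ne'
  have cz : ContinuousOn z (Icc 0 1) := fun y hy => (dz y hy).continuousAt.continuousWithinAt
  -- passing from the decay rate `κ` to the rate `max κ 1`
  have decay : ∀ r w : ℝ, r ≤ 1 → 0 ≤ r → r / A ≤ w →
      Real.exp (-(κ * w)) ≤ Real.exp 1 * Real.exp (-(K * r / A)) := by
    intro r w hr hr0 hw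
    rw [← Real.exp_add, Real.exp_le_exp]
    have h1 : K ≤ κ + 1 := max_le (by linarith) (by linarith)
    have h2 : K * (r / A) ≤ (κ + 1) * (r / A) := by gcongr
    have h3 : κ * (r / A) ≤ κ * w := by gcongr
    have h4 : r / A ≤ 1 := (div_le_one hA).2 (hr.trans hB.one_le)
    rw [mul_div_assoc]; linarith
  have usinh : ∀ r w x : ℝ, r ≤ 1 → 0 ≤ r → r / A ≤ w → x = Z - w → 0 ≤ x →
      |Real.sinh (κ * x) / Real.sinh (κ * Z)|
        ≤ (2 + A) * Real.exp 1 * Real.exp (-(K * r / A)) := by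
    intro r w x hr hr0 hw hx hx0
    have hw0 : 0 ≤ w := (div_nonneg hr0 hA.le).trans hw
    have h1 := sinh_div_sinh_le (x := κ * x) (a := κ * Z)
      (by gcongr; linarith) (by positivity)
    rw [abs_of_nonneg (div_nonneg (Real.sinh_nonneg_iff.2 (by positivity))
      (Real.sinh_nonneg_iff.2 (by positivity)))]
    have h2 := decay r w hr hr0 hw
    have e : κ * Z - κ * x = κ * w := by rw [hx]; ring
    rw [e] at h1
    have : 0 < Real.exp 1 * Real.exp (-(K * r / A)) := by positivity
    nlinarith
  have ucosh : ∀ r w x : ℝ, r ≤ 1 → 0 ≤ r → r / A ≤ w → x = Z - w → 0 ≤ x →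
      |κ * Real.cosh (κ * x) / Real.sinh (κ * Z)|
        ≤ (2 + A) * Real.exp 1 * K * Real.exp (-(K * r / A)) := by
    intro r w x hr hr0 hw hx hx0
    have hw0 : 0 ≤ w := (div_nonneg hr0 hA.le).trans hw
    have h1 := cosh_div_sinh_le (x := κ * x) (a := κ * Z) (by positivity)
      (by positivity)
    rw [mul_div_assoc, abs_of_nonneg (mul_nonneg hκ.le (div_nonneg (Real.cosh_pos _).le
      (Real.sinh_nonneg_iff.2 (by positivity))))]
    have h2 := decay r w hr hr0 hw
    have e : κ * Z - κ * x = κ * w := by rw [hx]; ring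
    rw [e] at h1
    have h3 : κ * (2 + (κ * Z)⁻¹) ≤ (2 + A) * K := by
      have e3 : κ * (2 + (κ * Z)⁻¹) = 2 * κ + Z⁻¹ := by field_simp
      have h4 : Z⁻¹ ≤ A := inv_le_of_inv_le₀ hA Z1
      have h5 : κ ≤ K := le_max_left _ _
      have h6 : 1 ≤ K := le_max_right _ _
      rw [e3]; nlinarith
    calc κ * (Real.cosh (κ * x) / Real.sinh (κ * Z))
        ≤ κ * ((2 + (κ * Z)⁻¹) * Real.exp (-(κ * w))) := by gcongr
      _ = (κ * (2 + (κ * Z)⁻¹)) * Real.exp (-(κ * w)) := by ring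
      _ ≤ ((2 + A) * K) * (Real.exp 1 * Real.exp (-(K * r / A))) := by gcongr
      _ = _ := by ring
  have d1 : ∀ y ∈ Icc (0 : ℝ) 1, HasDerivAt (fun y => κ * z y) (κ * h y) y := fun y hy =>
    (dz y hy).const_mul κ
  have d0 : ∀ y ∈ Icc (0 : ℝ) 1, HasDerivAt (fun y => κ * (Z - z y)) (-(κ * h y)) y :=
    fun y hy => by simpa using ((dz y hy).const_sub Z).const_mul κ
  have ch := hB.continuousOn_h
  have real_prim : ∀ a b : ℝ → ℝ, (∀ y ∈ Icc (0 : ℝ) 1, HasDerivAt a (b y) y) →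
      ContinuousOn b (Icc 0 1) → IsPrimitive (fun y => (a y : ℂ)) (fun y => (b y : ℂ)) :=
    fun a b hab hb => .of_hasDerivAt (fun y hy => (hab y hy).ofReal_comp)
      (Complex.continuous_ofReal.comp_continuousOn hb)
  refine ⟨fun y => ((Real.sinh (κ * (Z - z y)) / Real.sinh (κ * Z) : ℝ) : ℂ),
    fun y => ((-(κ * Real.cosh (κ * (Z - z y)) / Real.sinh (κ * Z)) : ℝ) : ℂ),
    fun y => ((Real.sinh (κ * z y) / Real.sinh (κ * Z) : ℝ) : ℂ),
    fun y => ((κ * Real.cosh (κ * z y) / Real.sinh (κ * Z) : ℝ) : ℂ),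
    ⟨⟨?_, ?_⟩, ?_, ?_⟩, ⟨⟨?_, ?_⟩, ?_, ?_⟩, ?_, ?_, ?_, ?_⟩
  · refine (real_prim _ (fun y => h y * (-(κ * Real.cosh (κ * (Z - z y)) / Real.sinh (κ * Z))))
      (fun y hy => ?_) (by fun_prop)).congr (fun _ _ => rfl)
      (Filter.Eventually.of_forall fun y => by push_cast; ring)
    exact ((d0 y hy).sinh.div_const (Real.sinh (κ * Z))).congr_deriv (by ring)
  · refine (real_prim _ (fun y => h y * (κ ^ 2 * (Real.sinh (κ * (Z - z y)) / Real.sinh (κ * Z))))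
      (fun y hy => ?_) (by fun_prop)).congr (fun _ _ => rfl)
      (Filter.Eventually.of_forall fun y => by simp)
    exact ((((d0 y hy).cosh.const_mul κ).div_const (Real.sinh (κ * Z))).neg).congr_deriv (by ring)
  · intro y hy
    rw [Complex.norm_real, Real.norm_eq_abs]
    exact usinh y (z y) _ hy.2 hy.1 (zl y hy) rfl (by
      have := zu y hy; have := div_nonneg (sub_nonneg.2 hy.2) hA.le; linarith)
  · intro y hy
    rw [Complex.norm_real, norm_neg, Real.norm_eq_abs]
    exact ucosh y (z y) _ hy.2 hy.1 (zl y hy) rfl (by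
      have := zu y hy; have := div_nonneg (sub_nonneg.2 hy.2) hA.le; linarith)
  · refine (real_prim _ (fun y => h y * (κ * Real.cosh (κ * z y) / Real.sinh (κ * Z)))
      (fun y hy => ?_) (by fun_prop)).congr (fun _ _ => rfl)
      (Filter.Eventually.of_forall fun y => by push_cast; ring)
    exact ((d1 y hy).sinh.div_const (Real.sinh (κ * Z))).congr_deriv (by ring)
  · refine (real_prim _ (fun y => h y * (κ ^ 2 * (Real.sinh (κ * z y) / Real.sinh (κ * Z))))
      (fun y hy => ?_) (by fun_prop)).congr (fun _ _ => rfl)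
      (Filter.Eventually.of_forall fun y => by simp)
    exact (((d1 y hy).cosh.const_mul κ).div_const (Real.sinh (κ * Z))).congr_deriv (by ring)
  · intro y hy
    rw [Complex.norm_real, Real.norm_eq_abs]
    exact usinh (1 - y) (Z - z y) _ (by linarith [hy.1]) (by linarith [hy.2]) (zu y hy) (by ring)
      ((div_nonneg hy.1 hA.le).trans (zl y hy))
  · intro y hy
    rw [Complex.norm_real, Real.norm_eq_abs]
    exact ucosh (1 - y) (Z - z y) _ (by linarith [hy.1]) (by linarith [hy.2]) (zu y hy) (by ring)
      ((div_nonneg hy.1 hA.le).trans (zl y hy))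
  · simp [z0, hs]
  · simp [hZ]
  · simp [z0]
  · simp [← hZ, hs]

end FiniteChannel

namespace FiniteChannel

variable {A κ : ℝ} {h : ℝ → ℝ} {β ρ ρ' : ℝ → ℂ}

/-! ### Commuting the elliptic operator with `∂_y + iτ` -/

/-- The commutator of the elliptic operator with `∂_y + iτ`: if `p` solves the elliptic problem with
source `s`, then `(∂_y + iτ) p = h ξ + iτ p` solves it with source
`(∂_y + iτ) s + 2 β (s + κ² p) + ρ ξ`. Here `s₁` is `(∂_y + iτ) s`. -/
theorem IsElliptic.twist {p ξ s s₁ : ℝ → ℂ} (hp : IsElliptic h κ p ξ s)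
    (hB : Background A h β ρ ρ') (τ : ℝ)
    (hs : IsPrimitive s (fun y => s₁ y - Complex.I * τ * s y)) :
    IsElliptic h κ (fun y => h y * ξ y + Complex.I * τ * p y)
      (fun y => h y * (s y + κ ^ 2 * p y) + Complex.I * τ * ξ y + β y * ξ y)
      (fun y => s₁ y + 2 * β y * (s y + κ ^ 2 * p y) + ρ y * ξ y) where
  prim_p := ((hB.prim_h.mul hp.prim_ξ).add (hp.prim_p.const_mul (Complex.I * τ))).congr
    (fun _ _ => rfl) (Filter.Eventually.of_forall fun y => by ring)
  prim_ξ := (((hB.prim_h.mul (hs.add (hp.prim_p.const_mul ((κ : ℂ) ^ 2)))).add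
    (hp.prim_ξ.const_mul (Complex.I * τ))).add (hB.prim_β.mul hp.prim_ξ)).congr
    (fun _ _ => rfl) (Filter.Eventually.of_forall fun y => by ring)

/-- The commutator formula applied twice; here `s₁ = (∂_y + iτ) s`, `s₂ = (∂_y + iτ)² s`,
`q = (∂_y + iτ) p` and `η` is the flux of `q`. -/
theorem IsElliptic.twist_twist {p ξ s s₁ s₂ q η : ℝ → ℂ} (hp : IsElliptic h κ p ξ s)
    (hB : Background A h β ρ ρ') (τ : ℝ)
    (hs : IsPrimitive s (fun y => s₁ y - Complex.I * τ * s y))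
    (hs₁ : IsPrimitive s₁ (fun y => s₂ y - Complex.I * τ * s₁ y))
    (hq : ∀ y, q y = h y * ξ y + Complex.I * τ * p y)
    (hη : ∀ y, η y = h y * (s y + κ ^ 2 * p y) + Complex.I * τ * ξ y + β y * ξ y) :
    IsElliptic h κ (fun y => h y * η y + Complex.I * τ * q y)
      (fun y => h y * ((s₁ y + 2 * β y * (s y + κ ^ 2 * p y) + ρ y * ξ y) + κ ^ 2 * q y)
        + Complex.I * τ * η y + β y * η y)
      (fun y => s₂ y + 4 * (β y * s₁ y) + (2 * h y * ρ y + 4 * β y ^ 2) * s y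
        + (κ ^ 2 * ((2 * h y * ρ y + 4 * β y ^ 2) * p y + 4 * β y * q y)
        + ((ρ' y + β y * ρ y) * ξ y + 2 * ρ y * η y))) := by
  obtain rfl : q = _ := funext hq
  obtain rfl : η = _ := funext hη
  have hX := hs.add (hp.prim_p.const_mul ((κ : ℂ) ^ 2))
  have ht := (hs₁.add ((hB.prim_β.const_mul 2).mul hX)).add (hB.prim_ρ.mul hp.prim_ξ)
  have h2 := (hp.twist hB τ hs).twist hB τ (ht.congr (fun _ _ => rfl) (v' := fun y =>
    (s₂ y + 2 * h y * ρ y * (s y + κ ^ 2 * p y)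
      + 2 * β y * (s₁ y + κ ^ 2 * (h y * ξ y + Complex.I * τ * p y)) + ρ' y * ξ y
      + ρ y * (h y * (s y + κ ^ 2 * p y) + Complex.I * τ * ξ y))
      - Complex.I * τ * (s₁ y + 2 * β y * (s y + κ ^ 2 * p y) + ρ y * ξ y))
    (Filter.Eventually.of_forall fun y => by ring))
  convert h2 using 2
  ring

/-! ### Functionals on `H¹₀` -/

/-- The functional `X ↦ Re ∫ s X̄` on `H¹₀((0,1))` is bounded by `D` times the norm
`K ‖X‖ + ‖X'‖`. -/
def DualLe (K D : ℝ) (s : ℝ → ℂ) : Prop :=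
  ∀ X X' : ℝ → ℂ, IsPrimitive X X' → MemLp X' 2 unitVol → X 0 = 0 → X 1 = 0 →
    |(∫ y, s y * starRingEnd ℂ (X y) ∂unitVol).re| ≤ D * (K * l2 X + l2 X')

theorem DualLe.add {K D D' : ℝ} {s t : ℝ → ℂ} (hs : DualLe K D s) (ht : DualLe K D' t)
    (ms : MemLp s 2 unitVol) (mt : MemLp t 2 unitVol) :
    DualLe K (D + D') (fun y => s y + t y) := by
  intro X X' hX hX' h0 h1
  have e : ∫ y, (s y + t y) * starRingEnd ℂ (X y) ∂unitVol
      = (∫ y, s y * starRingEnd ℂ (X y) ∂unitVol) + ∫ y, t y * starRingEnd ℂ (X y) ∂unitVol := by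
    rw [← integral_add (integrable_mul_of_memLp ms (memLp_conj (hX.memLp 2)))
      (integrable_mul_of_memLp mt (memLp_conj (hX.memLp 2)))]
    simp only [add_mul]
  rw [e, Complex.add_re, add_mul]
  exact (abs_add_le _ _).trans (add_le_add (hs X X' hX hX' h0 h1) (ht X X' hX hX' h0 h1))

theorem DualLe.mono {K D D' : ℝ} {s : ℝ → ℂ} (hs : DualLe K D s) (hK : 0 ≤ K) (hD : D ≤ D') :
    DualLe K D' s := fun X X' hX hX' h0 h1 => (hs X X' hX hX' h0 h1).trans (by
  have := l2_nonneg X; have := l2_nonneg X'; gcongr)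

theorem dualLe_of_l2 {K D : ℝ} (hK : 0 < K) {s : ℝ → ℂ} (ms : MemLp s 2 unitVol)
    (hD : l2 s ≤ K * D) : DualLe K D s := by
  intro X X' hX hX' h0 h1
  have h2 := norm_integral_mul_le ms (memLp_conj (hX.memLp 2))
  rw [l2_conj] at h2
  have h3 := l2_nonneg X
  have h4 := l2_nonneg X'
  have h5 : 0 ≤ D := nonneg_of_mul_nonneg_right ((l2_nonneg s).trans hD) hK
  calc _ ≤ l2 s * l2 X := (Complex.abs_re_le_norm _).trans h2
    _ ≤ K * D * l2 X := by gcongr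
    _ ≤ D * (K * l2 X + l2 X') := by nlinarith [mul_nonneg h5 h4]

/-- Oscillation gains a power of `K + |τ|` in the norm of `H⁻¹` for a source of class `H¹`; this is
the inviscid damping of the stream function. -/
theorem dualLe_phase_mul {K : ℝ} (hK : 1 ≤ K) (τ : ℝ) {U U' : ℝ → ℂ} (hU : IsPrimitive U U')
    (hU' : MemLp U' 2 unitVol) :
    DualLe K ((l2 U + l2 U') / (K + |τ|)) (fun y => phase (-τ) y * U y) := by
  intro X X' hX hX' h0 h1
  have mU := hU.memLp 2
  have mX := memLp_conj (hX.memLp 2)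
  have mX' := memLp_conj hX'
  have key := (isPrimitive_phase (-τ)).integral_mul_eq (hU.mul hX.conj)
  simp only [h0, h1, map_zero, mul_zero, sub_zero] at key
  have pU := memLp_phase_mul mU (-τ)
  have pU' := memLp_phase_mul hU' (-τ)
  have i0 := integrable_mul_of_memLp pU mX
  have i1 := integrable_mul_of_memLp pU' mX
  have i2 := integrable_mul_of_memLp pU mX'
  have e : ∫ y, (Complex.I * ((-τ : ℝ) : ℂ) * phase (-τ) y * (U y * starRingEnd ℂ (X y))
      + phase (-τ) y * (U' y * starRingEnd ℂ (X y) + U y * starRingEnd ℂ (X' y))) ∂unitVol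
      = Complex.I * ((-τ : ℝ) : ℂ) * (∫ y, phase (-τ) y * U y * starRingEnd ℂ (X y) ∂unitVol)
        + ((∫ y, phase (-τ) y * U' y * starRingEnd ℂ (X y) ∂unitVol)
        + ∫ y, phase (-τ) y * U y * starRingEnd ℂ (X' y) ∂unitVol) := by
    rw [← integral_add i1 i2, ← integral_const_mul]
    refine Eq.trans ?_ (integral_add (i0.const_mul _) (i1.add i2))
    refine integral_congr_ae (Filter.Eventually.of_forall fun y => ?_)
    ring
  rw [e] at key
  set I0 := ∫ y, phase (-τ) y * U y * starRingEnd ℂ (X y) ∂unitVol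
  have b0 := norm_integral_mul_le pU mX
  have b1 := norm_integral_mul_le pU' mX
  have b2 := norm_integral_mul_le pU mX'
  rw [l2_phase_mul, l2_conj] at b0 b1 b2
  have b3 : |τ| * ‖I0‖ ≤ l2 U' * l2 X + l2 U * l2 X' := by
    have h3 := congrArg norm (eq_neg_of_add_eq_zero_left key)
    rw [norm_mul, norm_mul, Complex.norm_I, Complex.norm_real, Real.norm_eq_abs, abs_neg, one_mul,
      norm_neg] at h3
    rw [h3]
    exact (norm_add_le _ _).trans (add_le_add b1 b2)
  rw [div_mul_eq_mul_div, le_div_iff₀ (by positivity)]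
  refine (mul_le_mul_of_nonneg_right (Complex.abs_re_le_norm I0) (by positivity)).trans ?_
  have h4 := l2_nonneg X
  have h5 := l2_nonneg X'
  have h6 := l2_nonneg U
  have h7 := l2_nonneg U'
  have h8 : K * ‖I0‖ ≤ K * (l2 U * l2 X) := by gcongr
  nlinarith [mul_nonneg h6 h4, mul_nonneg h7 h4, mul_nonneg h7 h5, mul_nonneg h6 h5]

/-- The energy of `p` is at most the norm of the source as a functional on `H¹₀`. -/
theorem IsElliptic.energy_le_of_dualLe {p ξ s : ℝ → ℂ} (hp : IsElliptic h κ p ξ s)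
    (hB : Background A h β ρ ρ') (hs : MemLp s 2 unitVol) (h0 : p 0 = 0) (h1 : p 1 = 0)
    {D : ℝ} (hD0 : 0 ≤ D) (hD : DualLe (max κ 1) D s) :
    max κ 1 * l2 p + l2 ξ ≤ 8 * A ^ 5 * D := by
  have hA := hB.pos
  have hA1 := hB.one_le
  have hK : 1 ≤ max κ 1 := le_max_right _ _
  have mp := hp.prim_p.memLp 2
  have mξ := hp.memLp_ξ
  have mβ : MemLp (fun y => β y * (h y * p y)) 2 unitVol :=
    memLp_mul_continuousOn (hB.memLp_h_mul mp) hB.prim_β.continuousOn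
  have mhh := hB.memLp_h_mul (hB.memLp_h_mul mξ)
  have hX := (hB.prim_h.mul hp.prim_p).congr (fun _ _ => rfl)
    (v' := fun y => β y * (h y * p y) + h y * (h y * ξ y))
    (Filter.Eventually.of_forall fun y => by ring)
  have h2 := hD _ _ hX (mβ.add mhh) (by simp [h0]) (by simp [h1])
  have b1 := hB.l2_h_mul_le mp
  have b2 : l2 (fun y => β y * (h y * p y)) ≤ A * (A * l2 p) :=
    (l2_le_mul (hB.memLp_h_mul mp) hA.le (ae_unitVol_of_forall fun y hy => by
      rw [norm_mul]; gcongr; exact hB.norm_β_le y hy)).trans (by gcongr)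
  have b3 : l2 (fun y => h y * (h y * ξ y)) ≤ A * (A * l2 ξ) :=
    (hB.l2_h_mul_le (hB.memLp_h_mul mξ)).trans (by gcongr; exact hB.l2_h_mul_le mξ)
  have b4 := l2_add_le mβ mhh
  have hp0 := l2_nonneg p
  have hξ0 := l2_nonneg ξ
  have h3 : max κ 1 * l2 (fun y => h y * p y) + l2 (fun y => β y * (h y * p y) + h y * (h y * ξ y))
      ≤ 2 * A ^ 2 * (max κ 1 * l2 p + l2 ξ) := by
    have h4 : max κ 1 * l2 (fun y => h y * p y) ≤ max κ 1 * (A * l2 p) := by gcongr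
    have h5 : A * (max κ 1 * l2 p) ≤ A ^ 2 * (max κ 1 * l2 p) := by
      gcongr; nlinarith
    have h6 : A ^ 2 * (1 * l2 p) ≤ A ^ 2 * (max κ 1 * l2 p) := by gcongr
    nlinarith [mul_nonneg (sq_nonneg A) hξ0]
  have h4 := hp.energy_le_of_pairing hB (hs.integrable (by norm_num)) h0 h1
    (D := 2 * A ^ 2 * D) (by positivity) (h2.trans (by
      calc _ ≤ D * (2 * A ^ 2 * (max κ 1 * l2 p + l2 ξ)) := by gcongr
        _ = _ := by ring))
  refine h4.trans ?_
  have : A ^ 2 + 1 ≤ 2 * A ^ 2 := by nlinarith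
  calc 2 * (A ^ 2 + 1) * A * (2 * A ^ 2 * D) ≤ 2 * (2 * A ^ 2) * A * (2 * A ^ 2 * D) := by gcongr
    _ = 8 * A ^ 5 * D := by ring

/-! ### The flux at the walls -/

/-- Green's formula against a solution of the homogeneous problem. -/
theorem IsElliptic.green {p ξ s u η : ℝ → ℂ} (hp : IsElliptic h κ p ξ s)
    (hu : IsElliptic h κ u η 0)
    (h0 : p 0 = 0) (h1 : p 1 = 0) :
    ∫ y, h y * s y * u y ∂unitVol = ξ 1 * u 1 - ξ 0 * u 0 := by
  have a := (hp.prim_ξ.mul hu.prim_p).sub (hp.prim_p.mul hu.prim_ξ)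
  have e := a.integral_eq_sub
  simp only [h0, h1, zero_mul, sub_zero] at e
  rw [← e]
  refine integral_congr_ae (Filter.Eventually.of_forall fun y => ?_)
  simp only [Pi.zero_apply]
  ring

/-- `r` is the distance to one of the end points of `[0,1]`. -/
def IsEndDistance (r : ℝ → ℝ) : Prop := (r = fun y => y) ∨ r = fun y => 1 - y

namespace IsEndDistance

variable {r : ℝ → ℝ}

theorem continuous (hr : IsEndDistance r) : Continuous r := by
  rcases hr with rfl | rfl <;> fun_prop

theorem nonneg (hr : IsEndDistance r) {y : ℝ} (hy : y ∈ Icc (0 : ℝ) 1) : 0 ≤ r y := by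
  rcases hr with rfl | rfl <;> simp [hy.1, hy.2]

theorem integral_exp_le (hr : IsEndDistance r) {b : ℝ} (hb : 0 < b) :
    ∫ y, Real.exp (-(b * r y)) ∂unitVol ≤ 1 / b := by
  have h1 : ∫ y in (0 : ℝ)..1, Real.exp (-(b * y)) ≤ 1 / b := by
    have h2 : ∫ y in (0 : ℝ)..1, Real.exp (-(b * y)) = (1 - Real.exp (-b)) / b := by
      have := intervalIntegral.integral_eq_sub_of_hasDerivAt (a := 0) (b := 1)
        (f := fun y => -(Real.exp (-(b * y)) / b)) (f' := fun y => Real.exp (-(b * y)))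
        (fun y _ => by
          have h3 : HasDerivAt (fun y : ℝ => -(b * y)) (-b) y := by
            simpa using (hasDerivAt_id y).const_mul (-b)
          exact ((h3.exp.div_const b).neg).congr_deriv (by field_simp))
        (Continuous.intervalIntegrable (by fun_prop) _ _)
      rw [this]; simp; ring
    rw [h2]; gcongr; linarith [Real.exp_pos (-b)]
  rw [unitVol_eq_restrict_Ioc, ← intervalIntegral.integral_of_le zero_le_one]
  rcases hr with rfl | rfl
  · exact h1
  · rw [intervalIntegral.integral_comp_sub_left (fun y => Real.exp (-(b * y))) 1]
    simpa using h1

theorem l2_exp_le (hr : IsEndDistance r) {b : ℝ} (hb : 0 < b) :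
    l2 (fun y => (Real.exp (-(b * r y)) : ℂ)) ≤ √(1 / (2 * b)) := by
  have hc := hr.continuous
  have hm : MemLp (fun y => (Real.exp (-(b * r y)) : ℂ)) 2 unitVol :=
    memLp_of_continuousOn (by fun_prop) 2
  refine Real.le_sqrt_of_sq_le ?_
  rw [l2_sq hm]
  refine le_trans (le_of_eq ?_) (hr.integral_exp_le (b := 2 * b) (by positivity))
  congr 1; ext y
  rw [Complex.norm_real, Real.norm_eq_abs, abs_of_pos (Real.exp_pos _), sq,
    ← Real.exp_add]
  congr 1; ring

end IsEndDistance

/-- A vorticity profile of class `H²` that vanishes on the walls, with its two derivatives. -/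
structure IsProfile (W W₁ v : ℝ → ℂ) : Prop where
  prim : IsPrimitive W W₁
  prim₁ : IsPrimitive W₁ v
  memLp : MemLp v 2 unitVol
  zero : W 0 = 0
  one : W 1 = 0

namespace IsProfile

variable {W W₁ v : ℝ → ℂ}

theorem memLp₁ (hW : IsProfile W W₁ v) : MemLp W₁ 2 unitVol := hW.prim₁.memLp 2

theorem norm_deriv_le (hW : IsProfile W W₁ v) {y : ℝ} (hy : y ∈ Icc (0 : ℝ) 1) :
    ‖W₁ y‖ ≤ l2 v := by
  have h1 : ∫ x, W₁ x ∂unitVol = 0 := by rw [hW.prim.integral_eq_sub, hW.one, hW.zero, sub_zero]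
  have h2 : W₁ y = ∫ x, (W₁ y - W₁ x) ∂unitVol := by
    rw [integral_sub (integrable_const _) hW.prim.integrable, h1]; simp
  rw [h2]
  have h3 : ∀ x ∈ Icc (0 : ℝ) 1, ‖W₁ y - W₁ x‖ ≤ l2 v := by
    intro x hx
    rcases le_total x y with hxy | hxy
    · refine (hW.prim₁.norm_sub_le hW.memLp hx hy hxy).trans
        (mul_le_of_le_one_left (l2_nonneg _) (Real.sqrt_le_one.2 ?_))
      linarith [hx.1, hy.2]
    · rw [norm_sub_rev]
      refine (hW.prim₁.norm_sub_le hW.memLp hy hx hxy).trans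
        (mul_le_of_le_one_left (l2_nonneg _) (Real.sqrt_le_one.2 ?_))
      linarith [hy.1, hx.2]
  simpa using norm_integral_le_of_norm_le_const (μ := unitVol) (ae_unitVol_of_forall h3)

theorem l2_deriv_le (hW : IsProfile W W₁ v) : l2 W₁ ≤ l2 v :=
  l2_le_of_bound (l2_nonneg _) (ae_unitVol_of_forall fun _ hy => hW.norm_deriv_le hy)

theorem l2_le (hW : IsProfile W W₁ v) : l2 W ≤ l2 v :=
  (hW.prim.l2_le_of_zero hW.memLp₁ hW.zero).trans hW.l2_deriv_le

theorem norm_deriv_le_of_endDistance (hW : IsProfile W W₁ v) {r : ℝ → ℝ} (hr : IsEndDistance r)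
    {y : ℝ} (hy : y ∈ Icc (0 : ℝ) 1) :
    ‖W₁ y‖ ≤ ‖W₁ 0‖ + ‖W₁ 1‖ + √(r y) * l2 v := by
  have n0 := norm_nonneg (W₁ 0)
  have n1 := norm_nonneg (W₁ 1)
  rcases hr with rfl | rfl
  · have h1 := hW.prim₁.norm_sub_le hW.memLp (by simp) hy hy.1
    rw [sub_zero] at h1
    have := norm_sub_norm_le (W₁ y) (W₁ 0)
    linarith
  · have h1 := hW.prim₁.norm_sub_le hW.memLp hy (by simp) hy.2
    rw [norm_sub_rev] at h1
    have := norm_sub_norm_le (W₁ y) (W₁ 1)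
    linarith

theorem norm_le_of_endDistance (hW : IsProfile W W₁ v) {r : ℝ → ℝ} (hr : IsEndDistance r)
    {y : ℝ} (hy : y ∈ Icc (0 : ℝ) 1) :
    ‖W y‖ ≤ r y * (‖W₁ 0‖ + ‖W₁ 1‖ + √(r y) * l2 v) := by
  have hV := l2_nonneg v
  have hr' := hr
  rcases hr with rfl | rfl
  · have h1 := intervalIntegral.norm_integral_le_of_norm_le_const (a := 0) (b := y) (f := W₁)
      (C := ‖W₁ 0‖ + ‖W₁ 1‖ + √y * l2 v) fun x hx => by
        rw [uIoc_of_le hy.1] at hx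
        refine (hW.norm_deriv_le_of_endDistance hr' ⟨hx.1.le, hx.2.trans hy.2⟩).trans ?_
        gcongr; exact hx.2
    rw [hW.prim.eq y hy, hW.zero, zero_add]
    refine h1.trans (le_of_eq ?_)
    rw [sub_zero, abs_of_nonneg hy.1, mul_comm]
  · have h1 := intervalIntegral.norm_integral_le_of_norm_le_const (a := y) (b := 1) (f := W₁)
      (C := ‖W₁ 0‖ + ‖W₁ 1‖ + √(1 - y) * l2 v) fun x hx => by
        rw [uIoc_of_le hy.2] at hx
        refine (hW.norm_deriv_le_of_endDistance hr' ⟨hy.1.trans hx.1.le, hx.2⟩).trans ?_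
        gcongr; exact hx.1.le
    have h2 := hW.prim.eq_add hy (by simp : (1 : ℝ) ∈ Icc (0 : ℝ) 1)
    rw [hW.one] at h2
    rw [← norm_neg, neg_eq_of_add_eq_zero_right h2.symm]
    refine h1.trans (le_of_eq ?_)
    rw [abs_of_nonneg (sub_nonneg.2 hy.2), mul_comm]

end IsProfile

theorem mul_exp_neg_le {b r : ℝ} (hb : 0 < b) : r * Real.exp (-(b * r)) ≤ 1 / b := by
  have h1 := Real.add_one_le_exp (b * r)
  rw [Real.exp_neg, ← div_eq_mul_inv, div_le_div_iff₀ (Real.exp_pos _) hb]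
  linarith

/-- The pairing of the oscillating vorticity with a boundary layer. Two integrations by parts bound the pairing for large `τ`; for small `τ` the bound comes
from the vanishing of `W` at the walls and the width `1/K` of the boundary layer. -/
theorem IsBoundaryLayer.norm_pairing_le {C τ : ℝ} {r : ℝ → ℝ} {u ξ W W₁ v : ℝ → ℂ}
    (hu : IsBoundaryLayer C A κ h r u ξ) (hC : 0 ≤ C) (hB : Background A h β ρ ρ') (hκ : 0 < κ)
    (hr : IsEndDistance r) (hW : IsProfile W W₁ v) :
    (max κ 1 ^ 2 + τ ^ 2) * ‖∫ y, h y * (phase (-τ) y * W y) * u y ∂unitVol‖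
      ≤ 131 * A ^ 6 * C * (‖W₁ 0‖ + ‖W₁ 1‖ + l2 v / √(max κ 1)) := by
  have hA := hB.pos
  have hA1 := hB.one_le
  set K := max κ 1 with hK
  have hK1 : 1 ≤ K := le_max_right _ _
  have hKκ : κ ≤ K := le_max_left _ _
  have hK0 : 0 < K := zero_lt_one.trans_le hK1
  set V := l2 v with hV
  have hV0 : 0 ≤ V := l2_nonneg v
  set σ := ‖W₁ 0‖ + ‖W₁ 1‖ with hσ
  have hσ0 : 0 ≤ σ := by positivity
  have hsK : 0 < √K := Real.sqrt_pos.2 hK0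
  set S := σ + V / √K with hS
  have hS0 : 0 ≤ S := by positivity
  set b := K / (4 * A) with hb
  have hb0 : 0 < b := by positivity
  set w : ℝ → ℝ := fun y => Real.exp (-(b * r y)) with hw
  have w0 : ∀ y, 0 < w y := fun y => Real.exp_pos _
  have w1 : ∀ y ∈ Icc (0 : ℝ) 1, w y ≤ 1 := fun y hy => by
    rw [hw]; simp only [Real.exp_le_one_iff, Left.neg_nonpos_iff]
    exact mul_nonneg hb0.le (hr.nonneg hy)
  have w4 : ∀ y, Real.exp (-(K * r y / A)) = w y ^ 4 := fun y => by
    rw [hw]; simp only; rw [← Real.exp_nat_mul]; congr 1; rw [hb]; push_cast; field_simp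
  have w2 : ∀ y, w y ^ 2 = Real.exp (-(2 * b * r y)) := fun y => by
    rw [hw]; simp only; rw [← Real.exp_nat_mul]; congr 1; push_cast; ring
  have hsqA : √(1 / b) ≤ 2 * A / √K := by
    have e : 1 / b = (2 * A / √K) ^ 2 / A := by
      rw [hb, div_pow, Real.sq_sqrt hK0.le]; field_simp; norm_num
    refine Real.sqrt_le_iff.2 ⟨by positivity, ?_⟩
    rw [e]; exact div_le_self (by positivity) hA1
  have hrw : ∀ y ∈ Icc (0 : ℝ) 1, r y * w y ≤ 1 / b := fun y _ => mul_exp_neg_le hb0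
  -- the weight `w` turns the `√r` growth of `W₁` into a factor `K^{-1/2}`
  have hG : ∀ y ∈ Icc (0 : ℝ) 1, (σ + √(r y) * V) * w y ≤ 2 * A * S := by
    intro y hy
    have h1 : √(r y) * w y ≤ √(1 / b) := by
      refine Real.le_sqrt_of_sq_le ?_
      rw [mul_pow, Real.sq_sqrt (hr.nonneg hy)]
      calc r y * w y ^ 2 = (r y * w y) * w y := by ring
        _ ≤ (r y * w y) * 1 := by
            have := hr.nonneg hy; have := w0 y; gcongr; exact w1 y hy
        _ ≤ 1 / b := by rw [mul_one]; exact hrw y hy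
    have h2 : σ * w y ≤ σ * 1 := by gcongr; exact w1 y hy
    have h3 : √(r y) * w y * V ≤ 2 * A / √K * V := by
      gcongr; exact h1.trans hsqA
    have h4 : 2 * A / √K * V = 2 * A * (V / √K) := by ring
    rw [hS]; nlinarith
  have hW1 : ∀ y ∈ Icc (0 : ℝ) 1, ‖W₁ y‖ * w y ≤ 2 * A * S := fun y hy =>
    (mul_le_mul_of_nonneg_right (hW.norm_deriv_le_of_endDistance hr hy) (w0 y).le).trans (hG y hy)
  have hW0 : ∀ y ∈ Icc (0 : ℝ) 1, ‖W y‖ * w y ^ 2 ≤ 8 * A ^ 2 * S / K := by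
    intro y hy
    calc ‖W y‖ * w y ^ 2 ≤ (r y * (σ + √(r y) * V)) * w y ^ 2 := by
          gcongr; exact hW.norm_le_of_endDistance hr hy
      _ = (r y * w y) * ((σ + √(r y) * V) * w y) := by ring
      _ ≤ 1 / b * (2 * A * S) := by
          have := w0 y; have := hr.nonneg hy
          exact mul_le_mul (hrw y hy) (hG y hy) (by positivity) (by positivity)
      _ = 8 * A ^ 2 * S / K := by rw [hb]; field_simp; ring
  -- the boundary layer `p = h u` with its two derivatives
  set p : ℝ → ℂ := fun y => h y * u y with hp
  set p₁ : ℝ → ℂ := fun y => h y * (β y * u y + h y * ξ y) with hp₁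
  set p₂ : ℝ → ℂ := fun y => h y * ((h y * ρ y + β y ^ 2 + h y ^ 2 * κ ^ 2) * u y
    + 3 * β y * h y * ξ y) with hp₂
  have prim_p : IsPrimitive p p₁ := (hB.prim_h.mul hu.elliptic.prim_p).congr (fun _ _ => rfl)
    (Filter.Eventually.of_forall fun y => by simp only [hp₁]; ring)
  have prim_p₁ : IsPrimitive p₁ p₂ := (hB.prim_h.mul ((hB.prim_β.mul hu.elliptic.prim_p).add
    (hB.prim_h.mul hu.elliptic.prim_ξ))).congr (fun _ _ => rfl)
    (Filter.Eventually.of_forall fun y => by simp only [hp₂, Pi.zero_apply]; ring)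
  have nu : ∀ y ∈ Icc (0 : ℝ) 1, ‖u y‖ ≤ C * w y ^ 4 := fun y hy => by
    rw [← w4]; exact hu.norm_u_le y hy
  have nξ : ∀ y ∈ Icc (0 : ℝ) 1, ‖ξ y‖ ≤ C * K * w y ^ 4 := fun y hy => by
    rw [← w4]; exact hu.norm_ξ_le y hy
  have np : ∀ y ∈ Icc (0 : ℝ) 1, ‖p y‖ ≤ A * (C * w y ^ 4) := fun y hy => by
    rw [hp]; simp only [norm_mul]; gcongr; exacts [hB.norm_h_le hy, nu y hy]
  have np₁ : ∀ y ∈ Icc (0 : ℝ) 1, ‖p₁ y‖ ≤ 2 * A ^ 2 * C * K * w y ^ 4 := fun y hy => by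
    have hh := hB.norm_h_le hy
    have hβ := hB.norm_β_le y hy
    have hu' := nu y hy
    have hξ' := nξ y hy
    have h1 : ‖p₁ y‖ ≤ A * (A * (C * w y ^ 4) + A * (C * K * w y ^ 4)) := by
      rw [hp₁]; simp only [norm_mul]
      gcongr
      refine (norm_add_le _ _).trans ?_
      rw [norm_mul, norm_mul]; gcongr
    have h2 : A * (A * (C * w y ^ 4)) ≤ A * (A * (C * w y ^ 4)) * K :=
      le_mul_of_one_le_right (by have := w0 y; positivity) hK1
    linarith
  have np₂ : ∀ y ∈ Icc (0 : ℝ) 1, ‖p₂ y‖ ≤ 6 * A ^ 3 * C * K ^ 2 * w y ^ 4 := fun y hy => by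
    have hh := hB.norm_h_le hy
    have hβ := hB.norm_β_le y hy
    have hρ := hB.norm_ρ_le y hy
    have hu' := nu y hy
    have hξ' := nξ y hy
    have hw := w0 y
    have e1 : ‖(κ : ℂ)‖ ≤ K := by rwa [Complex.norm_real, Real.norm_eq_abs, abs_of_pos hκ]
    have h1 : ‖p₂ y‖ ≤ A * ((A * A + A ^ 2 + A ^ 2 * K ^ 2) * (C * w y ^ 4)
        + 3 * A * A * (C * K * w y ^ 4)) := by
      rw [hp₂]; simp only [norm_mul]
      gcongr
      refine (norm_add_le _ _).trans ?_
      simp only [norm_mul, Complex.norm_ofNat]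
      gcongr
      refine (norm_add₃_le).trans ?_
      simp only [norm_mul, norm_pow]
      gcongr
    have h2 : A ^ 3 * C * w y ^ 4 * 1 ≤ A ^ 3 * C * w y ^ 4 * K ^ 2 := by
      gcongr; exact one_le_pow₀ hK1
    have h3 : A ^ 3 * C * w y ^ 4 * K ≤ A ^ 3 * C * w y ^ 4 * K ^ 2 := by
      gcongr; exact le_self_pow₀ hK1 (by norm_num)
    linarith
  -- the product `X = W p` with its two derivatives
  set X : ℝ → ℂ := fun y => W y * p y with hX
  set X₁ : ℝ → ℂ := fun y => W₁ y * p y + W y * p₁ y with hX₁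
  set X₂ : ℝ → ℂ := fun y => v y * p y + 2 * (W₁ y * p₁ y) + W y * p₂ y with hX₂
  have prim_X : IsPrimitive X X₁ := hW.prim.mul prim_p
  have prim_X₁ : IsPrimitive X₁ X₂ :=
    ((hW.prim₁.mul prim_p).add (hW.prim.mul prim_p₁)).congr (fun _ _ => rfl)
    (Filter.Eventually.of_forall fun y => by simp only [hX₂]; ring)
  have cw : Continuous w := by
    have := hr.continuous
    fun_prop
  have iw : ∫ y, w y ^ 2 ∂unitVol ≤ 2 * A / K := by
    simp_rw [w2]
    refine (hr.integral_exp_le (by positivity)).trans (le_of_eq ?_)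
    rw [hb]; field_simp; norm_num
  have iiw : Integrable (fun y => w y ^ 2) unitVol :=
    ((cw.pow 2).integrableOn_Icc (a := 0) (b := 1)).mono_set Ioo_subset_Icc_self
  have ivw : ∫ y, ‖v y‖ * w y ^ 2 ∂unitVol ≤ 2 * A * S := by
    have hm : MemLp (fun y => (Real.exp (-(2 * b * r y)) : ℂ)) 2 unitVol :=
      memLp_of_continuousOn (by have := hr.continuous; fun_prop) 2
    have h1 := integral_norm_mul_le hW.memLp hm
    have e : ∀ y, ‖((Real.exp (-(2 * b * r y)) : ℝ) : ℂ)‖ = w y ^ 2 := fun y => by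
      rw [Complex.norm_real, Real.norm_eq_abs, abs_of_pos (Real.exp_pos _), w2]
    simp_rw [e] at h1
    have h2 := hr.l2_exp_le (b := 2 * b) (by positivity)
    have h3 : √(1 / (2 * (2 * b))) ≤ √(1 / b) := by
      apply Real.sqrt_le_sqrt
      gcongr; linarith
    calc _ ≤ V * (2 * A / √K) := h1.trans (by gcongr; exact h2.trans (h3.trans hsqA))
      _ = 2 * A * (V / √K) := by ring
      _ ≤ 2 * A * S := by gcongr; rw [hS]; linarith
  have ivwi : Integrable (fun y => ‖v y‖ * w y ^ 2) unitVol := by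
    have h1 : Integrable (fun y => ‖v y‖) unitVol := (hW.memLp.integrable (by norm_num)).norm
    refine h1.mul_bdd (c := 1) (cw.pow 2).aestronglyMeasurable (ae_unitVol_of_forall fun y hy => ?_)
    rw [Real.norm_eq_abs, abs_of_nonneg (by positivity)]
    exact pow_le_one₀ (w0 y).le (w1 y hy)
  have bX : ∫ y, ‖X y‖ ∂unitVol ≤ 16 * A ^ 4 * C * S / K ^ 2 := by
    have h1 : ∫ y, ‖X y‖ ∂unitVol ≤ ∫ y, 8 * A ^ 3 * C * S / K * w y ^ 2 ∂unitVol := by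
      refine integral_mono_ae (integrable_of_continuousOn prim_X.continuousOn).norm
        (iiw.const_mul _) (ae_unitVol_of_forall fun y hy => ?_)
      have hw := w0 y
      simp only [hX, norm_mul]
      calc ‖W y‖ * ‖p y‖ ≤ ‖W y‖ * (A * (C * w y ^ 4)) := by gcongr; exact np y hy
        _ = (‖W y‖ * w y ^ 2) * (A * C * w y ^ 2) := by ring
        _ ≤ (8 * A ^ 2 * S / K) * (A * C * w y ^ 2) := by gcongr; exact hW0 y hy
        _ = _ := by ring
    rw [integral_const_mul] at h1
    calc _ ≤ 8 * A ^ 3 * C * S / K * (2 * A / K) := h1.trans (by gcongr)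
      _ = _ := by field_simp; ring
  have bX₂ : ∫ y, ‖X₂ y‖ ∂unitVol ≤ 114 * A ^ 6 * C * S := by
    have h1 : ∫ y, ‖X₂ y‖ ∂unitVol ≤ ∫ y, (A * C * (‖v y‖ * w y ^ 2)
        + (8 * A ^ 3 + 48 * A ^ 5) * C * K * S * w y ^ 2) ∂unitVol := by
      refine integral_mono_ae prim_X₁.integrable.norm
        ((ivwi.const_mul _).add (iiw.const_mul _)) (ae_unitVol_of_forall fun y hy => ?_)
      have hw := w0 y
      have hw1 := w1 y hy
      have a1 : ‖v y‖ * ‖p y‖ ≤ A * C * (‖v y‖ * w y ^ 2) := by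
        calc ‖v y‖ * ‖p y‖ ≤ ‖v y‖ * (A * (C * w y ^ 4)) := by gcongr; exact np y hy
          _ ≤ ‖v y‖ * (A * (C * w y ^ 2)) := by
            gcongr ?_ * (?_ * (?_ * ?_)); exact pow_le_pow_of_le_one hw.le hw1 (by norm_num)
          _ = _ := by ring
      have a2 : ‖W₁ y‖ * ‖p₁ y‖ ≤ 4 * A ^ 3 * C * K * S * w y ^ 2 := by
        calc ‖W₁ y‖ * ‖p₁ y‖ ≤ ‖W₁ y‖ * (2 * A ^ 2 * C * K * w y ^ 4) := by
              gcongr; exact np₁ y hy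
          _ = (‖W₁ y‖ * w y) * (2 * A ^ 2 * C * K) * w y ^ 3 := by ring
          _ ≤ (2 * A * S) * (2 * A ^ 2 * C * K) * w y ^ 2 := by
            gcongr ?_ * _ * ?_
            · exact hW1 y hy
            · exact pow_le_pow_of_le_one hw.le hw1 (by norm_num)
          _ = _ := by ring
      have a3 : ‖W y‖ * ‖p₂ y‖ ≤ 48 * A ^ 5 * C * K * S * w y ^ 2 := by
        calc ‖W y‖ * ‖p₂ y‖ ≤ ‖W y‖ * (6 * A ^ 3 * C * K ^ 2 * w y ^ 4) := by
              gcongr; exact np₂ y hy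
          _ = (‖W y‖ * w y ^ 2) * (6 * A ^ 3 * C * K ^ 2 * w y ^ 2) := by ring
          _ ≤ (8 * A ^ 2 * S / K) * (6 * A ^ 3 * C * K ^ 2 * w y ^ 2) := by
            gcongr; exact hW0 y hy
          _ = _ := by field_simp; ring
      have a4 : ‖X₂ y‖ ≤ ‖v y‖ * ‖p y‖ + 2 * (‖W₁ y‖ * ‖p₁ y‖) + ‖W y‖ * ‖p₂ y‖ := by
        refine (norm_add₃_le).trans (le_of_eq ?_)
        simp only [norm_mul, Complex.norm_ofNat]
      simp only
      linarith
    have h2 := h1.trans_eq (integral_add (ivwi.const_mul _) (iiw.const_mul _))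
    rw [integral_const_mul, integral_const_mul] at h2
    have h3 : A * C * (∫ y, ‖v y‖ * w y ^ 2 ∂unitVol) ≤ A * C * (2 * A * S) := by gcongr
    have h4 : (8 * A ^ 3 + 48 * A ^ 5) * C * K * S * (∫ y, w y ^ 2 ∂unitVol)
        ≤ (8 * A ^ 3 + 48 * A ^ 5) * C * K * S * (2 * A / K) := by gcongr
    have h5 : (8 * A ^ 3 + 48 * A ^ 5) * C * K * S * (2 * A / K)
        = (16 * A ^ 4 + 96 * A ^ 6) * (C * S) := by field_simp; ring
    have h6 : A ^ 2 * (C * S) ≤ A ^ 6 * (C * S) :=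
      mul_le_mul_of_nonneg_right (pow_le_pow_right₀ hA1 (by norm_num)) (by positivity)
    have h7 : A ^ 4 * (C * S) ≤ A ^ 6 * (C * S) :=
      mul_le_mul_of_nonneg_right (pow_le_pow_right₀ hA1 (by norm_num)) (by positivity)
    have h8 : 0 ≤ A ^ 6 * (C * S) := by positivity
    linarith
  -- two integrations by parts
  have X0 : X 0 = 0 := by simp [hX, hW.zero]
  have X1 : X 1 = 0 := by simp [hX, hW.one]
  have nb : ∀ y ∈ Icc (0 : ℝ) 1, ‖p y‖ ≤ A * C := fun y hy =>
    (np y hy).trans (by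
      gcongr; exact mul_le_of_le_one_right hC (pow_le_one₀ (w0 y).le (w1 y hy)))
  have bdry : ‖X₁ 0‖ + ‖X₁ 1‖ ≤ A * C * S := by
    have n0 : ‖X₁ 0‖ ≤ ‖W₁ 0‖ * (A * C) := by
      simp only [hX₁, hW.zero, zero_mul, add_zero, norm_mul]; gcongr; exact nb 0 (by simp)
    have n1 : ‖X₁ 1‖ ≤ ‖W₁ 1‖ * (A * C) := by
      simp only [hX₁, hW.one, zero_mul, add_zero, norm_mul]; gcongr; exact nb 1 (by simp)
    have n2 : σ * (A * C) ≤ S * (A * C) := by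
      gcongr; rw [hS]; exact le_add_of_nonneg_right (by positivity)
    rw [hσ] at n2; linarith
  have ibp := fun (Y Y' : ℝ → ℂ) (hY : IsPrimitive Y Y') => by
    have key := (isPrimitive_phase (-τ)).integral_mul_eq hY
    have i0 : Integrable (fun y => phase (-τ) y * Y y) unitVol :=
      integrable_of_continuousOn ((continuous_phase _).continuousOn.mul hY.continuousOn)
    have i1 : Integrable (fun y => phase (-τ) y * Y' y) unitVol :=
      hY.integrable.bdd_mul (c := 1) (continuous_phase _).aestronglyMeasurable
        (Filter.Eventually.of_forall fun y => (norm_phase _ y).le)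
    simp only [mul_assoc] at key
    have e := integral_add ((i0.const_mul ((-τ : ℝ) : ℂ)).const_mul Complex.I) i1
    rw [e, integral_const_mul, integral_const_mul] at key
    exact key
  have nph : ∀ Y : ℝ → ℂ, ‖∫ y, phase (-τ) y * Y y ∂unitVol‖ ≤ ∫ y, ‖Y y‖ ∂unitVol := fun Y =>
    (norm_integral_le_integral_norm _).trans (by simp [norm_phase])
  have k1 := ibp X X₁ prim_X
  have k2 := ibp X₁ X₂ prim_X₁
  rw [X0, X1, mul_zero, mul_zero, sub_zero] at k1
  have e0 : ∫ y, h y * (phase (-τ) y * W y) * u y ∂unitVol = ∫ y, phase (-τ) y * X y ∂unitVol := by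
    congr 1; ext y; simp only [hX, hp]; ring
  rw [e0]
  set I0 := ∫ y, phase (-τ) y * X y ∂unitVol
  set I1 := ∫ y, phase (-τ) y * X₁ y ∂unitVol
  set I2 := ∫ y, phase (-τ) y * X₂ y ∂unitVol
  have m1 : |τ| * ‖I0‖ = ‖I1‖ := by
    have := congrArg norm (eq_neg_of_add_eq_zero_left k1)
    rwa [norm_mul, norm_mul, Complex.norm_I, Complex.norm_real, Real.norm_eq_abs, abs_neg, one_mul,
      norm_neg] at this
  have m2 : |τ| * ‖I1‖ ≤ ‖I2‖ + (‖X₁ 0‖ + ‖X₁ 1‖) := by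
    have e := congrArg norm (eq_sub_of_add_eq k2)
    rw [norm_mul, norm_mul, Complex.norm_I, Complex.norm_real, Real.norm_eq_abs, abs_neg,
      one_mul] at e
    rw [e]
    refine (norm_sub_le _ _).trans ?_
    have := norm_sub_le (phase (-τ) 1 * X₁ 1) (phase (-τ) 0 * X₁ 0)
    rw [norm_mul, norm_mul, norm_phase, norm_phase] at this
    linarith
  have m3 : τ ^ 2 * ‖I0‖ ≤ 114 * A ^ 6 * C * S + A * C * S := by
    calc τ ^ 2 * ‖I0‖ = |τ| * (|τ| * ‖I0‖) := by rw [← sq_abs]; ring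
      _ ≤ _ := by rw [m1]; linarith [nph X₂]
  have m4 : K ^ 2 * ‖I0‖ ≤ 16 * A ^ 4 * C * S := by
    calc K ^ 2 * ‖I0‖ ≤ K ^ 2 * (16 * A ^ 4 * C * S / K ^ 2) := by
          gcongr; exact (nph X).trans bX
      _ = _ := by field_simp
  have h7 : A ^ 4 * (C * S) ≤ A ^ 6 * (C * S) :=
    mul_le_mul_of_nonneg_right (pow_le_pow_right₀ hA1 (by norm_num)) (by positivity)
  have h8 : A * (C * S) ≤ A ^ 6 * (C * S) :=
    mul_le_mul_of_nonneg_right (le_self_pow₀ hA1 (by norm_num)) (by positivity)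
  linarith

end FiniteChannel

namespace FiniteChannel

variable {A C κ τ : ℝ} {h : ℝ → ℝ} {β ρ ρ' : ℝ → ℂ}

/-! ### Estimates of the stream function at a fixed time -/

/-- The two boundary layers of the elliptic problem, with boundary values `1, 0` and `0, 1`. -/
structure IsBoundaryLayerPair (C A κ : ℝ) (h : ℝ → ℝ) (u₀ ξ₀ u₁ ξ₁ : ℝ → ℂ) : Prop where
  layer₀ : IsBoundaryLayer C A κ h (fun y => y) u₀ ξ₀
  layer₁ : IsBoundaryLayer C A κ h (fun y => 1 - y) u₁ ξ₁
  zero₀ : u₀ 0 = 1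
  one₀ : u₀ 1 = 0
  zero₁ : u₁ 0 = 0
  one₁ : u₁ 1 = 1

section layers

variable {u₀ ξ₀ u₁ ξ₁ : ℝ → ℂ}

theorem IsBoundaryLayer.l2_le {r : ℝ → ℝ} {u ξ : ℝ → ℂ} (hu : IsBoundaryLayer C A κ h r u ξ)
    (hC : 0 ≤ C) (hA : 1 ≤ A) (hr : IsEndDistance r) :
    l2 u ≤ C * A / √(max κ 1) ∧ l2 ξ ≤ C * A * √(max κ 1) := by
  have hA0 : 0 < A := zero_lt_one.trans_le hA
  set K := max κ 1 with hK
  have hK1 : 1 ≤ K := le_max_right _ _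
  have hK0 : 0 < K := zero_lt_one.trans_le hK1
  have hm : MemLp (fun y => (Real.exp (-(K / A * r y)) : ℂ)) 2 unitVol :=
    memLp_of_continuousOn (by have := hr.continuous; fun_prop) 2
  have h1 := hr.l2_exp_le (b := K / A) (by positivity)
  have h2 : √(1 / (2 * (K / A))) ≤ A / √K := by
    refine Real.sqrt_le_iff.2 ⟨by positivity, ?_⟩
    rw [div_pow, Real.sq_sqrt hK0.le]
    have e : 1 / (2 * (K / A)) = (A / 2) / K := by field_simp
    rw [e]; gcongr; nlinarith
  have e : ∀ y, ‖((Real.exp (-(K / A * r y)) : ℝ) : ℂ)‖ = Real.exp (-(K * r y / A)) := fun y => by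
    rw [Complex.norm_real, Real.norm_eq_abs, abs_of_pos (Real.exp_pos _)]; congr 1; ring
  have b1 : l2 u ≤ C * (A / √K) :=
    (l2_le_mul hm hC (ae_unitVol_of_forall fun y hy => by
      rw [e]; exact hu.norm_u_le y hy)).trans (mul_le_mul_of_nonneg_left (h1.trans h2) hC)
  have b2 : l2 ξ ≤ C * K * (A / √K) :=
    (l2_le_mul (C := C * K) hm (by positivity) (ae_unitVol_of_forall fun y hy => by
      rw [e]; exact hu.norm_ξ_le y hy)).trans
      (mul_le_mul_of_nonneg_left (h1.trans h2) (by positivity))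
  refine ⟨b1.trans (le_of_eq (by ring)), b2.trans (le_of_eq ?_)⟩
  have := Real.mul_self_sqrt hK0.le
  have hs : 0 < √K := Real.sqrt_pos.2 hK0
  field_simp
  nlinarith

theorem IsBoundaryLayer.norm_fc_le {r : ℝ → ℝ} {u ξ f f' : ℝ → ℂ} {m : ℝ}
    (hu : IsBoundaryLayer C A κ h r u ξ) (hB : Background A h β ρ ρ')
    (hC : 0 ≤ C) (hr : IsEndDistance r) (h01 : ‖u 0‖ + ‖u 1‖ = 1) (hf : IsPrimitive f f')
    (nf : ∀ y ∈ Icc (0 : ℝ) 1, ‖f y‖ ≤ m) (nf' : ∀ᵐ y ∂unitVol, ‖f' y‖ ≤ m) (n : ℤ) :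
    ‖fc (fun y => phase τ y * (f y * u y)) n‖
      ≤ m * (1 + 3 * A ^ 2 * C) / (max κ 1 + |2 * Real.pi * n - τ|) := by
  have hA := hB.one_le
  have hA0 := hB.pos
  have hm : 0 ≤ m := (norm_nonneg _).trans (nf 0 (by simp))
  set K := max κ 1 with hK
  have hK1 : 1 ≤ K := le_max_right _ _
  have hK0 : 0 < K := zero_lt_one.trans_le hK1
  have hp := hf.mul hu.elliptic.prim_p
  have h1 := norm_fc_phase_mul_le hp hK0.le τ n
  rw [le_div_iff₀ (by positivity), mul_comm]
  refine h1.trans ?_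
  have cr := hr.continuous
  have iexp : Integrable (fun y => Real.exp (-(K / A * r y))) unitVol :=
    (Continuous.integrableOn_Icc (a := 0) (b := 1) (by fun_prop)).mono_set Ioo_subset_Icc_self
  have I0 : ∫ y, Real.exp (-(K / A * r y)) ∂unitVol ≤ A / K :=
    (hr.integral_exp_le (by positivity)).trans (le_of_eq (by field_simp))
  have ew : ∀ y, Real.exp (-(K * r y / A)) = Real.exp (-(K / A * r y)) := fun y => by
    congr 1; ring
  have b1 : ∫ y, ‖f y * u y‖ ∂unitVol ≤ m * C * (A / K) := by
    calc ∫ y, ‖f y * u y‖ ∂unitVol ≤ ∫ y, m * C * Real.exp (-(K / A * r y)) ∂unitVol := by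
          refine integral_mono_ae (integrable_of_continuousOn hp.continuousOn).norm
            (iexp.const_mul _) (ae_unitVol_of_forall fun y hy => ?_)
          have := hu.norm_u_le y hy
          rw [ew] at this
          simp only [norm_mul, mul_assoc]
          gcongr
          exact nf y hy
      _ ≤ _ := by rw [integral_const_mul]; gcongr
  have b2 : ∫ y, ‖f' y * u y + f y * (h y * ξ y)‖ ∂unitVol ≤ (m * C + m * A * (C * K)) * (A / K) := by
    calc _ ≤ ∫ y, (m * C + m * A * (C * K)) * Real.exp (-(K / A * r y)) ∂unitVol := by
          refine integral_mono_ae hp.integrable.norm (iexp.const_mul _) ?_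
          filter_upwards [nf', ae_unitVol_of_forall (p := fun y => y ∈ Icc (0 : ℝ) 1)
            fun y hy => hy] with y hy' hy
          have h1 := hu.norm_u_le y hy
          have h2 := hu.norm_ξ_le y hy
          rw [ew] at h1 h2
          have h3 := nf y hy
          have h4 := hB.norm_h_le hy
          refine (norm_add_le _ _).trans ?_
          simp only [norm_mul]
          calc ‖f' y‖ * ‖u y‖ + ‖f y‖ * (‖(h y : ℂ)‖ * ‖ξ y‖)
              ≤ m * (C * Real.exp (-(K / A * r y)))
                + m * (A * (C * K * Real.exp (-(K / A * r y)))) := by gcongr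
            _ = _ := by ring
      _ ≤ _ := by rw [integral_const_mul]; gcongr
  have b3 : ‖f 0 * u 0‖ + ‖f 1 * u 1‖ ≤ m := by
    calc ‖f 0 * u 0‖ + ‖f 1 * u 1‖ ≤ m * ‖u 0‖ + m * ‖u 1‖ := by
          rw [norm_mul, norm_mul]
          gcongr
          exacts [nf 0 (by simp), nf 1 (by simp)]
      _ = m := by rw [← mul_add, h01, mul_one]
  have b4 : K * ∫ y, ‖f y * u y‖ ∂unitVol ≤ m * C * A := by
    calc _ ≤ K * (m * C * (A / K)) := by gcongr
      _ = _ := by field_simp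
  have b5 : (m * C + m * A * (C * K)) * (A / K) ≤ m * C * A + m * A ^ 2 * C := by
    have : m * C * A / K ≤ m * C * A := div_le_self (by positivity) hK1
    calc _ = m * C * A / K + m * A ^ 2 * C := by field_simp
      _ ≤ _ := by gcongr
  have b6 : m * C * A ≤ m * C * A ^ 2 := by gcongr; nlinarith
  linarith

namespace IsBoundaryLayerPair

theorem isElliptic_sub {q η t : ℝ → ℂ} (hL : IsBoundaryLayerPair C A κ h u₀ ξ₀ u₁ ξ₁)
    (hq : IsElliptic h κ q η t) (a b : ℂ) :
    IsElliptic h κ (fun y => q y - a * u₀ y - b * u₁ y) (fun y => η y - a * ξ₀ y - b * ξ₁ y) t := by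
  have := (hq.sub (hL.layer₀.elliptic.const_mul a)).sub (hL.layer₁.elliptic.const_mul b)
  simpa using this

/-- Subtracting the boundary layers with the boundary values of `q` leaves a function of `H¹₀`
that is controlled by the source. -/
theorem energy_sub_le {q η t : ℝ → ℂ} (hL : IsBoundaryLayerPair C A κ h u₀ ξ₀ u₁ ξ₁)
    (hB : Background A h β ρ ρ') (hq : IsElliptic h κ q η t) (mt : MemLp t 2 unitVol) {D : ℝ}
    (hD0 : 0 ≤ D) (hD : DualLe (max κ 1) D t) :
    max κ 1 * l2 (fun y => q y - q 0 * u₀ y - q 1 * u₁ y)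
      + l2 (fun y => η y - q 0 * ξ₀ y - q 1 * ξ₁ y) ≤ 8 * A ^ 5 * D :=
  (hL.isElliptic_sub hq (q 0) (q 1)).energy_le_of_dualLe hB mt
    (by simp [hL.zero₀, hL.zero₁]) (by simp [hL.one₀, hL.one₁]) hD0 hD

theorem energy_le {q η : ℝ → ℂ} (hL : IsBoundaryLayerPair C A κ h u₀ ξ₀ u₁ ξ₁)
    (hC : 0 ≤ C) (hA : 1 ≤ A) (a b : ℂ)
    (mq : MemLp (fun y => q y - a * u₀ y - b * u₁ y) 2 unitVol)
    (mη : MemLp (fun y => η y - a * ξ₀ y - b * ξ₁ y) 2 unitVol) :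
    max κ 1 * l2 q + l2 η ≤ max κ 1 * l2 (fun y => q y - a * u₀ y - b * u₁ y)
      + l2 (fun y => η y - a * ξ₀ y - b * ξ₁ y) + (‖a‖ + ‖b‖) * (2 * C * A * √(max κ 1)) := by
  set K := max κ 1 with hK
  have hK0 : 0 < K := zero_lt_one.trans_le (le_max_right _ _)
  obtain ⟨b1, b2⟩ := hL.layer₀.l2_le hC hA (Or.inl rfl)
  obtain ⟨b3, b4⟩ := hL.layer₁.l2_le hC hA (Or.inr rfl)
  have key : ∀ q u w : ℝ → ℂ, MemLp u 2 unitVol → MemLp w 2 unitVol →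
      MemLp (fun y => q y - a * u y - b * w y) 2 unitVol →
      l2 q ≤ l2 (fun y => q y - a * u y - b * w y) + (‖a‖ * l2 u + ‖b‖ * l2 w) := by
    intro q u w mu mw mq
    have e : q = fun y => (q y - a * u y - b * w y) + (a * u y + b * w y) := by
      ext y; ring
    have h1 := l2_add_le mq ((mu.const_mul a).add (mw.const_mul b))
    have h2 := l2_add_le (mu.const_mul a) (mw.const_mul b)
    have h3 : l2 (fun y => a * u y) ≤ ‖a‖ * l2 u :=
      l2_le_mul mu (norm_nonneg _) (Filter.Eventually.of_forall fun y => by simp)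
    have h4 : l2 (fun y => b * w y) ≤ ‖b‖ * l2 w :=
      l2_le_mul mw (norm_nonneg _) (Filter.Eventually.of_forall fun y => by simp)
    exact (le_of_eq (congrArg l2 e)).trans (h1.trans (add_le_add le_rfl
      (h2.trans (add_le_add h3 h4))))
  have h1 := key q u₀ u₁ (hL.layer₀.elliptic.prim_p.memLp 2) (hL.layer₁.elliptic.prim_p.memLp 2) mq
  have h2 := key η ξ₀ ξ₁ hL.layer₀.elliptic.memLp_ξ hL.layer₁.elliptic.memLp_ξ mη
  have h3 : K * (C * A / √K) = C * A * √K := by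
    have := Real.mul_self_sqrt hK0.le
    have hs : 0 < √K := Real.sqrt_pos.2 hK0
    field_simp; nlinarith
  have h5 : K * l2 u₀ ≤ C * A * √K := by rw [← h3]; gcongr
  have h6 : K * l2 u₁ ≤ C * A * √K := by rw [← h3]; gcongr
  have na := norm_nonneg a
  have nb := norm_nonneg b
  have h7 := mul_le_mul_of_nonneg_left h1 hK0.le
  have h8 := mul_le_mul_of_nonneg_left h5 na
  have h9 := mul_le_mul_of_nonneg_left h6 nb
  have h10 := mul_le_mul_of_nonneg_left b2 na
  have h11 := mul_le_mul_of_nonneg_left b4 nb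
  nlinarith

end IsBoundaryLayerPair

end layers

section stream

variable {p ξ W W₁ v : ℝ → ℂ}

/-- The energy of the stream function of a vorticity of class `H¹` decays like `1/(K + |τ|)`. -/
theorem stream_energy_le (hB : Background A h β ρ ρ') (hW : IsProfile W W₁ v)
    (hp : IsElliptic h κ p ξ (fun y => phase (-τ) y * W y)) (h0 : p 0 = 0) (h1 : p 1 = 0) :
    max κ 1 * l2 p + l2 ξ ≤ 16 * A ^ 5 * (l2 v / (max κ 1 + |τ|)) := by
  have hK1 : 1 ≤ max κ 1 := le_max_right _ _
  have hA := hB.pos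
  have hd := dualLe_phase_mul hK1 τ hW.prim hW.memLp₁
  have h2 := hp.energy_le_of_dualLe hB (memLp_phase_mul (hW.prim.memLp 2) _) h0 h1
    (by have := l2_nonneg W; have := l2_nonneg W₁; positivity) hd
  refine h2.trans ?_
  have : (l2 W + l2 W₁) / (max κ 1 + |τ|) ≤ 2 * l2 v / (max κ 1 + |τ|) := by
    gcongr; linarith [hW.l2_le, hW.l2_deriv_le]
  calc _ ≤ 8 * A ^ 5 * (2 * l2 v / (max κ 1 + |τ|)) := by gcongr
    _ = _ := by ring

/-- The flux of the stream function at the walls decays like `1/(K² + τ²)`. -/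
theorem stream_flux_le {u₀ ξ₀ u₁ ξ₁ : ℝ → ℂ} (hL : IsBoundaryLayerPair C A κ h u₀ ξ₀ u₁ ξ₁)
    (hC : 0 ≤ C) (hB : Background A h β ρ ρ') (hκ : 0 < κ) (hW : IsProfile W W₁ v)
    (hp : IsElliptic h κ p ξ (fun y => phase (-τ) y * W y)) (h0 : p 0 = 0) (h1 : p 1 = 0) :
    (max κ 1 ^ 2 + τ ^ 2) * ‖ξ 0‖
        ≤ 131 * A ^ 6 * C * (‖W₁ 0‖ + ‖W₁ 1‖ + l2 v / √(max κ 1)) ∧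
      (max κ 1 ^ 2 + τ ^ 2) * ‖ξ 1‖
        ≤ 131 * A ^ 6 * C * (‖W₁ 0‖ + ‖W₁ 1‖ + l2 v / √(max κ 1)) := by
  constructor
  · have h2 := hL.layer₀.norm_pairing_le (τ := τ) hC hB hκ (Or.inl rfl) hW
    rwa [hp.green hL.layer₀.elliptic h0 h1, hL.zero₀, hL.one₀, mul_zero, mul_one, zero_sub,
      norm_neg] at h2
  · have h2 := hL.layer₁.norm_pairing_le (τ := τ) hC hB hκ (Or.inr rfl) hW
    rwa [hp.green hL.layer₁.elliptic h0 h1, hL.zero₁, hL.one₁, mul_zero, mul_one, sub_zero] at h2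

theorem l2_mul_le {m u : ℝ → ℂ} {a : ℝ} (mu : MemLp u 2 unitVol) (ha : 0 ≤ a)
    (hm : ∀ᵐ y ∂unitVol, ‖m y‖ ≤ a) : l2 (fun y => m y * u y) ≤ a * l2 u :=
  l2_le_mul mu ha (hm.mono fun y hy => by rw [norm_mul]; gcongr)

/-- The oscillation gain for the product of a function of class `H¹` with a Lipschitz
coefficient. -/
theorem dualLe_phase_mul_coeff {K a a' V : ℝ} (hK : 1 ≤ K) {m m' U U' : ℝ → ℂ}
    (hm : IsPrimitive m m') (nm : ∀ y ∈ Icc (0 : ℝ) 1, ‖m y‖ ≤ a)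
    (nm' : ∀ᵐ y ∂unitVol, ‖m' y‖ ≤ a') (ha' : 0 ≤ a') (hU : IsPrimitive U U')
    (hU' : MemLp U' 2 unitVol) (h1 : l2 U ≤ V) (h2 : l2 U' ≤ V) :
    DualLe K ((2 * a + a') * (V / (K + |τ|))) (fun y => m y * (phase (-τ) y * U y)) := by
  have ha : 0 ≤ a := (norm_nonneg _).trans (nm 0 (by simp))
  have mU := hU.memLp 2
  have mm' : MemLp (fun y => m' y * U y) 2 unitVol := memLp_mul_bound mU hm.integrable.1 nm'
  have mm : MemLp (fun y => m y * U' y) 2 unitVol := memLp_mul_continuousOn hU' hm.continuousOn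
  have hd := dualLe_phase_mul hK τ (hm.mul hU) (mm'.add mm)
  have e : (fun y => phase (-τ) y * (m y * U y)) = fun y => m y * (phase (-τ) y * U y) := by
    ext y; ring
  rw [e] at hd
  refine hd.mono (by positivity) ?_
  rw [mul_div_assoc']
  gcongr
  have b1 := l2_mul_le mU ha (ae_unitVol_of_forall nm)
  have b2 := l2_mul_le hU' ha (ae_unitVol_of_forall nm)
  have b3 := l2_mul_le mU ha' nm'
  have b4 := l2_add_le mm' mm
  have b5 := mul_le_mul_of_nonneg_left h1 ha
  have b6 := mul_le_mul_of_nonneg_left h2 ha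
  have b7 := mul_le_mul_of_nonneg_left h1 ha'
  linarith

end stream

end FiniteChannel

namespace FiniteChannel

variable {A C κ τ : ℝ} {h : ℝ → ℝ} {β ρ ρ' : ℝ → ℂ} {u₀ ξ₀ u₁ ξ₁ p ξ W W₁ v : ℝ → ℂ}

/-- The derivative `(∂_y + iτ) p` of a solution `p` of the elliptic problem with flux `ξ`. -/
noncomputable def twist (h : ℝ → ℝ) (τ : ℝ) (p ξ : ℝ → ℂ) (y : ℝ) : ℂ :=
  h y * ξ y + Complex.I * τ * p y

/-- The flux of `(∂_y + iτ) p` for a solution `p` of the elliptic problem with source `s`. -/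
noncomputable def twistFlux (h : ℝ → ℝ) (β : ℝ → ℂ) (κ τ : ℝ) (p ξ s : ℝ → ℂ) (y : ℝ) : ℂ :=
  h y * (s y + κ ^ 2 * p y) + Complex.I * τ * ξ y + β y * ξ y

theorem IsPrimitive.phase_mul {U U' : ℝ → ℂ} (hU : IsPrimitive U U') (τ : ℝ) :
    IsPrimitive (fun y => phase (-τ) y * U y)
      (fun y => phase (-τ) y * U' y - Complex.I * τ * (phase (-τ) y * U y)) :=
  ((isPrimitive_phase (-τ)).mul hU).congr (fun _ _ => rfl)
    (Filter.Eventually.of_forall fun y => by push_cast; ring)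

theorem memLp_twist (hB : Background A h β ρ ρ') (mp : MemLp p 2 unitVol) (mξ : MemLp ξ 2 unitVol) :
    MemLp (twist h τ p ξ) 2 unitVol :=
  (hB.memLp_h_mul mξ).add (mp.const_mul _)

theorem memLp_twistFlux (hB : Background A h β ρ ρ') (mp : MemLp p 2 unitVol)
    (mξ : MemLp ξ 2 unitVol) {s : ℝ → ℂ} (ms : MemLp s 2 unitVol) :
    MemLp (twistFlux h β κ τ p ξ s) 2 unitVol :=
  ((hB.memLp_h_mul (ms.add (mp.const_mul _))).add (mξ.const_mul _)).add
    (memLp_mul_continuousOn mξ hB.prim_β.continuousOn)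

/-- The energy of `∂_y Φ`, up to its boundary layers. -/
theorem stream_deriv_energy_le (hL : IsBoundaryLayerPair C A κ h u₀ ξ₀ u₁ ξ₁) (hκ : 0 < κ)
    (hB : Background A h β ρ ρ') (hW : IsProfile W W₁ v)
    (hp : IsElliptic h κ p ξ (fun y => phase (-τ) y * W y)) (h0 : p 0 = 0) (h1 : p 1 = 0)
    {q η : ℝ → ℂ} (hq : q = twist h τ p ξ)
    (hη : η = twistFlux h β κ τ p ξ fun y => phase (-τ) y * W y) :
    max κ 1 * l2 (fun y => q y - q 0 * u₀ y - q 1 * u₁ y)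
      + l2 (fun y => η y - q 0 * ξ₀ y - q 1 * ξ₁ y)
      ≤ 448 * A ^ 11 * (l2 v / (max κ 1 + |τ|)) := by
  have hA := hB.one_le
  have hA0 := hB.pos
  set K := max κ 1 with hK
  have hK1 : 1 ≤ K := le_max_right _ _
  have hK0 : 0 < K := zero_lt_one.trans_le hK1
  have hκK : κ ≤ K := le_max_left _ _
  have mp := hp.prim_p.memLp 2
  have mξ := hp.memLp_ξ
  have mW := hW.prim.memLp 2
  have hV := l2_nonneg v
  have hp0 := l2_nonneg p
  have hξ0 := l2_nonneg ξ
  have hE := stream_energy_le hB hW hp h0 h1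
  rw [← hK] at hE
  set R := l2 v / (K + |τ|) with hR
  have hR0 : 0 ≤ R := by positivity
  have ell := hp.twist hB τ (hW.prim.phase_mul τ)
  set t : ℝ → ℂ := fun y => phase (-τ) y * W₁ y + 2 * β y * (phase (-τ) y * W y)
    + (2 * κ ^ 2 * (β y * p y) + ρ y * ξ y) with ht
  have ell' : IsElliptic h κ q η t := by
    have e : t = fun y => phase (-τ) y * W₁ y + 2 * β y * (phase (-τ) y * W y + κ ^ 2 * p y)
        + ρ y * ξ y := by ext y; rw [ht]; ring
    rw [hq, hη, e]
    exact ell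
  have mβp : MemLp (fun y => β y * p y) 2 unitVol :=
    memLp_mul_continuousOn mp hB.prim_β.continuousOn
  have mρξ : MemLp (fun y => ρ y * ξ y) 2 unitVol :=
    memLp_mul_continuousOn mξ hB.prim_ρ.continuousOn
  have d1 := dualLe_phase_mul (τ := τ) hK1 hW.prim₁ hW.memLp
  have d2 := dualLe_phase_mul_coeff (τ := τ) hK1 (hB.prim_β.const_mul 2) (a := 2 * A)
    (a' := 2 * A ^ 2) (V := l2 v)
    (fun y hy => by rw [norm_mul, Complex.norm_ofNat]; gcongr; exact hB.norm_β_le y hy)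
    (ae_unitVol_of_forall fun y hy => by
      rw [norm_mul, norm_mul, Complex.norm_ofNat, sq]
      gcongr
      exacts [hB.norm_h_le hy, hB.norm_ρ_le y hy]) (by positivity) hW.prim hW.memLp₁
    hW.l2_le hW.l2_deriv_le
  have mc : MemLp (fun y => 2 * κ ^ 2 * (β y * p y) + ρ y * ξ y) 2 unitVol :=
    (mβp.const_mul _).add mρξ
  have d3 : DualLe K (48 * A ^ 6 * R) (fun y => 2 * κ ^ 2 * (β y * p y) + ρ y * ξ y) := by
    refine dualLe_of_l2 hK0 mc ?_
    have b1 : l2 (fun y => 2 * κ ^ 2 * (β y * p y)) ≤ (2 * K ^ 2) * (A * l2 p) := by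
      refine (l2_le_mul (C := 2 * K ^ 2) mβp (by positivity)
        (Filter.Eventually.of_forall fun y => ?_)).trans
        (mul_le_mul_of_nonneg_left (l2_mul_le mp hA0.le (ae_unitVol_of_forall hB.norm_β_le))
          (by positivity))
      rw [norm_mul, norm_mul, norm_pow, Complex.norm_ofNat, Complex.norm_real, Real.norm_eq_abs,
        abs_of_pos hκ]
      gcongr
    have b2 : l2 (fun y => ρ y * ξ y) ≤ A * l2 ξ :=
      l2_mul_le mξ hA0.le (ae_unitVol_of_forall hB.norm_ρ_le)
    have b3 : A * l2 ξ ≤ K * (A * l2 ξ) := le_mul_of_one_le_left (by positivity) hK1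
    have b4 : 2 * A * (K * l2 p + l2 ξ) ≤ 2 * A * (16 * A ^ 5 * R) := by gcongr
    have b5 := mul_le_mul_of_nonneg_left b4 hK0.le
    have b6 : 0 ≤ K * A ^ 6 * R := by positivity
    refine (l2_add_le (mβp.const_mul _) mρξ).trans ?_
    have b7 : 0 ≤ K * (A * l2 ξ) := by positivity
    nlinarith
  have m1 := memLp_phase_mul hW.memLp₁ (-τ)
  have m2 : MemLp (fun y => 2 * β y * (phase (-τ) y * W y)) 2 unitVol :=
    memLp_mul_continuousOn (memLp_phase_mul mW _) (continuousOn_const.mul hB.prim_β.continuousOn)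
  have dt := (d1.add d2 m1 m2).add d3 (m1.add m2) mc
  have b1 : (l2 W₁ + l2 v) / (K + |τ|) ≤ 2 * R := by
    rw [hR, mul_div_assoc']; gcongr; linarith [hW.l2_deriv_le]
  have hA2 : (1 : ℝ) ≤ A ^ 6 := one_le_pow₀ hA
  have hA3 : A ≤ A ^ 6 := le_self_pow₀ hA (by norm_num)
  have hA4 : A ^ 2 ≤ A ^ 6 := pow_le_pow_right₀ hA (by norm_num)
  have bt : (l2 W₁ + l2 v) / (K + |τ|) + (2 * (2 * A) + 2 * A ^ 2) * (l2 v / (K + |τ|))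
      + 48 * A ^ 6 * R ≤ 56 * A ^ 6 * R := by
    rw [← hR]; nlinarith
  have fin := hL.energy_sub_le hB ell' ((m1.add m2).add mc) (by positivity)
    (dt.mono hK0.le bt)
  refine fin.trans (le_of_eq ?_)
  ring

/-- The energy of `∂_y² Φ`, up to its boundary layers, in terms of the norm `G` of `∂_y² W` in
`H⁻¹` and of a bound `E` for the energies of lower order. -/
theorem stream_deriv_deriv_energy_le (hL : IsBoundaryLayerPair C A κ h u₀ ξ₀ u₁ ξ₁) (hκ : 0 < κ)
    (hB : Background A h β ρ ρ') (hW : IsProfile W W₁ v)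
    (hp : IsElliptic h κ p ξ (fun y => phase (-τ) y * W y))
    {q η q₂ η₂ : ℝ → ℂ} (hq : q = twist h τ p ξ)
    (hη : η = twistFlux h β κ τ p ξ fun y => phase (-τ) y * W y) (hq₂ : q₂ = twist h τ q η)
    (hη₂ : η₂ = twistFlux h β κ τ q η fun y => phase (-τ) y * W₁ y
      + 2 * β y * (phase (-τ) y * W y + κ ^ 2 * p y) + ρ y * ξ y) {G E : ℝ} (hG : 0 ≤ G)
    (hv : DualLe (max κ 1) G fun y => phase (-τ) y * v y)
    (hV : l2 v / (max κ 1 + |τ|) ≤ E) (hEp : max κ 1 * l2 p + l2 ξ ≤ E)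
    (hEq : max κ 1 * l2 q + l2 η ≤ E) :
    max κ 1 * l2 (fun y => q₂ y - q₂ 0 * u₀ y - q₂ 1 * u₁ y)
      + l2 (fun y => η₂ y - q₂ 0 * ξ₀ y - q₂ 1 * ξ₁ y)
      ≤ 8 * A ^ 5 * (G + 50 * A ^ 3 * E) := by
  have hA := hB.one_le
  have hA0 := hB.pos
  set K := max κ 1 with hK
  have hK1 : 1 ≤ K := le_max_right _ _
  have hK0 : 0 < K := zero_lt_one.trans_le hK1
  have hκK : κ ≤ K := le_max_left _ _
  have mp := hp.prim_p.memLp 2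
  have mξ := hp.memLp_ξ
  have mW := hW.prim.memLp 2
  have mq : MemLp q 2 unitVol := hq ▸ memLp_twist hB mp mξ
  have mη : MemLp η 2 unitVol := hη ▸ memLp_twistFlux hB mp mξ (memLp_phase_mul mW _)
  have hp0 := l2_nonneg p
  have hξ0 := l2_nonneg ξ
  have hq0 := l2_nonneg q
  have hη0 := l2_nonneg η
  have hE0 : 0 ≤ E := by
    refine le_trans ?_ hEp; positivity
  have ell := hp.twist_twist hB τ (hW.prim.phase_mul τ) (hW.prim₁.phase_mul τ)
    (q := q) (η := η) (congrFun hq) (congrFun hη)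
  have ell' : IsElliptic h κ q₂ η₂ (fun y => phase (-τ) y * v y + 4 * (β y * (phase (-τ) y * W₁ y))
      + (2 * h y * ρ y + 4 * β y ^ 2) * (phase (-τ) y * W y)
      + (κ ^ 2 * ((2 * h y * ρ y + 4 * β y ^ 2) * p y + 4 * β y * q y)
      + ((ρ' y + β y * ρ y) * ξ y + 2 * ρ y * η y))) := by
    rw [hq₂, hη₂]; exact ell
  have nm : ∀ y ∈ Icc (0 : ℝ) 1, ‖2 * h y * ρ y + 4 * β y ^ 2‖ ≤ 6 * A ^ 2 := fun y hy => by
    have n1 := hB.norm_h_le hy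
    have n2 := hB.norm_ρ_le y hy
    have n3 := hB.norm_β_le y hy
    refine (norm_add_le _ _).trans ?_
    simp only [norm_mul, norm_pow, Complex.norm_ofNat]
    calc 2 * ‖(h y : ℂ)‖ * ‖ρ y‖ + 4 * ‖β y‖ ^ 2 ≤ 2 * A * A + 4 * A ^ 2 := by gcongr
      _ = _ := by ring
  have pm : IsPrimitive (fun y => 2 * h y * ρ y + 4 * β y ^ 2)
      (fun y => 2 * (β y * h y * ρ y + h y * ρ' y) + 8 * (β y * (h y * ρ y))) :=
    (((hB.prim_h.mul hB.prim_ρ).const_mul 2).add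
      ((hB.prim_β.mul hB.prim_β).const_mul 4)).congr (fun y _ => by ring)
      (Filter.Eventually.of_forall fun y => by ring)
  have nm' : ∀ᵐ y ∂unitVol, ‖2 * (β y * h y * ρ y + h y * ρ' y) + 8 * (β y * (h y * ρ y))‖
      ≤ 12 * A ^ 3 := by
    filter_upwards [hB.norm_ρ'_le, ae_unitVol_of_forall (p := fun y => y ∈ Icc (0 : ℝ) 1)
      fun y hy => hy] with y n4 hy
    have n1 := hB.norm_h_le hy
    have n2 := hB.norm_ρ_le y hy
    have n3 := hB.norm_β_le y hy
    calc _ ≤ 2 * (‖β y‖ * ‖(h y : ℂ)‖ * ‖ρ y‖ + ‖(h y : ℂ)‖ * ‖ρ' y‖)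
          + 8 * (‖β y‖ * (‖(h y : ℂ)‖ * ‖ρ y‖)) := by
          refine (norm_add_le _ _).trans ?_
          simp only [norm_mul, Complex.norm_ofNat]
          gcongr
          refine (norm_add_le _ _).trans ?_
          simp only [norm_mul]; rfl
      _ ≤ 2 * (A * A * A + A * A) + 8 * (A * (A * A)) := by gcongr
      _ ≤ 12 * A ^ 3 := by nlinarith [pow_pos hA0 2]
  have d2 : DualLe K (12 * A ^ 2 * E) (fun y => 4 * (β y * (phase (-τ) y * W₁ y))) := by
    have := dualLe_phase_mul_coeff (τ := τ) hK1 (hB.prim_β.const_mul 4) (a := 4 * A)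
      (a' := 4 * A ^ 2) (V := l2 v)
      (fun y hy => by rw [norm_mul, Complex.norm_ofNat]; gcongr; exact hB.norm_β_le y hy)
      (ae_unitVol_of_forall fun y hy => by
        rw [norm_mul, norm_mul, Complex.norm_ofNat, sq]
        gcongr
        exacts [hB.norm_h_le hy, hB.norm_ρ_le y hy]) (by positivity) hW.prim₁ hW.memLp
      hW.l2_deriv_le le_rfl
    simp only [mul_assoc] at this ⊢
    refine this.mono hK0.le ?_
    calc (2 * (4 * A) + 4 * A ^ 2) * (l2 v / (K + |τ|)) ≤ (2 * (4 * A) + 4 * A ^ 2) * E := by gcongr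
      _ ≤ 12 * (A ^ 2 * E) := by nlinarith [mul_nonneg hE0 (mul_nonneg hA0.le (sub_nonneg.2 hA))]
  have d3 : DualLe K (24 * A ^ 3 * E)
      (fun y => (2 * h y * ρ y + 4 * β y ^ 2) * (phase (-τ) y * W y)) := by
    refine (dualLe_phase_mul_coeff hK1 pm nm nm' (by positivity) hW.prim hW.memLp₁ hW.l2_le
      hW.l2_deriv_le).mono hK0.le ?_
    calc (2 * (6 * A ^ 2) + 12 * A ^ 3) * (l2 v / (K + |τ|))
        ≤ (2 * (6 * A ^ 2) + 12 * A ^ 3) * E := by gcongr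
      _ ≤ 24 * A ^ 3 * E := by
        nlinarith [mul_nonneg hE0 (mul_nonneg (sq_nonneg A) (sub_nonneg.2 hA))]
  have cm := pm.continuousOn
  have mmp : MemLp (fun y => (2 * h y * ρ y + 4 * β y ^ 2) * p y) 2 unitVol :=
    memLp_mul_continuousOn mp cm
  have mβq : MemLp (fun y => 4 * β y * q y) 2 unitVol :=
    memLp_mul_continuousOn mq (continuousOn_const.mul hB.prim_β.continuousOn)
  have mpq : MemLp (fun y => (2 * h y * ρ y + 4 * β y ^ 2) * p y + 4 * β y * q y) 2 unitVol :=
    mmp.add mβq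
  have nρ' : ∀ᵐ y ∂unitVol, ‖ρ' y + β y * ρ y‖ ≤ 2 * A ^ 2 := by
    filter_upwards [hB.norm_ρ'_le, ae_unitVol_of_forall (p := fun y => y ∈ Icc (0 : ℝ) 1)
      fun y hy => hy] with y n4 hy
    have n2 := hB.norm_ρ_le y hy
    have n3 := hB.norm_β_le y hy
    calc _ ≤ ‖ρ' y‖ + ‖β y‖ * ‖ρ y‖ := by rw [← norm_mul]; exact norm_add_le _ _
      _ ≤ A + A * A := by gcongr
      _ ≤ _ := by nlinarith
  have mρξ : MemLp (fun y => (ρ' y + β y * ρ y) * ξ y) 2 unitVol :=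
    memLp_mul_bound mξ (hB.prim_ρ.integrable.1.add
      ((hB.prim_β.mul hB.prim_ρ).memLp 2).1) nρ'
  have mρη : MemLp (fun y => 2 * ρ y * η y) 2 unitVol :=
    memLp_mul_continuousOn mη (continuousOn_const.mul hB.prim_ρ.continuousOn)
  have mξη : MemLp (fun y => (ρ' y + β y * ρ y) * ξ y + 2 * ρ y * η y) 2 unitVol := mρξ.add mρη
  have mc : MemLp (fun y => κ ^ 2 * ((2 * h y * ρ y + 4 * β y ^ 2) * p y + 4 * β y * q y)
      + ((ρ' y + β y * ρ y) * ξ y + 2 * ρ y * η y)) 2 unitVol := (mpq.const_mul _).add mξη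
  have hA2 : A ≤ A ^ 2 := le_self_pow₀ hA (by norm_num)
  have d4 : DualLe K (14 * A ^ 2 * E)
      (fun y => κ ^ 2 * ((2 * h y * ρ y + 4 * β y ^ 2) * p y + 4 * β y * q y)
      + ((ρ' y + β y * ρ y) * ξ y + 2 * ρ y * η y)) := by
    refine dualLe_of_l2 hK0 mc ?_
    have b1 := l2_mul_le mp (by positivity) (ae_unitVol_of_forall nm)
    have b2 : l2 (fun y => 4 * β y * q y) ≤ 4 * A * l2 q :=
      l2_mul_le mq (by positivity) (ae_unitVol_of_forall fun y hy => by
        rw [norm_mul, Complex.norm_ofNat]; gcongr; exact hB.norm_β_le y hy)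
    have b3 := l2_mul_le mξ (by positivity) nρ'
    have b4 : l2 (fun y => 2 * ρ y * η y) ≤ 2 * A * l2 η :=
      l2_mul_le mη (by positivity) (ae_unitVol_of_forall fun y hy => by
        rw [norm_mul, Complex.norm_ofNat]; gcongr; exact hB.norm_ρ_le y hy)
    have b5 : l2 (fun y => κ ^ 2 * ((2 * h y * ρ y + 4 * β y ^ 2) * p y + 4 * β y * q y))
        ≤ K ^ 2 * (6 * A ^ 2 * l2 p + 4 * A * l2 q) := by
      refine (l2_le_mul (C := K ^ 2) mpq (by positivity)
        (Filter.Eventually.of_forall fun y => ?_)).trans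
        (mul_le_mul_of_nonneg_left ((l2_add_le mmp mβq).trans (add_le_add b1 b2)) (by positivity))
      rw [norm_mul, norm_pow, Complex.norm_real, Real.norm_eq_abs, abs_of_pos hκ]
      gcongr
    have b6 := (l2_add_le (mpq.const_mul ((κ : ℂ) ^ 2)) mξη).trans
      (add_le_add b5 ((l2_add_le mρξ mρη).trans (add_le_add b3 b4)))
    refine b6.trans ?_
    have c1 : K * l2 p ≤ E := by linarith
    have c2 : K * l2 q ≤ E := by linarith
    have c3 : l2 ξ ≤ E := by have := mul_nonneg hK0.le hp0; linarith
    have c4 : l2 η ≤ E := by have := mul_nonneg hK0.le hq0; linarith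
    calc _ = K * (6 * A ^ 2 * (K * l2 p) + 4 * A * (K * l2 q))
          + 1 * (2 * A ^ 2 * l2 ξ + 2 * A * l2 η) := by ring
      _ ≤ K * (6 * A ^ 2 * E + 4 * A ^ 2 * E) + K * (2 * A ^ 2 * E + 2 * A ^ 2 * E) := by gcongr
      _ = _ := by ring
  have m1 := memLp_phase_mul hW.memLp (-τ)
  have m2 : MemLp (fun y => 4 * (β y * (phase (-τ) y * W₁ y))) 2 unitVol :=
    (memLp_mul_continuousOn (memLp_phase_mul hW.memLp₁ _) hB.prim_β.continuousOn).const_mul _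
  have m3 : MemLp (fun y => (2 * h y * ρ y + 4 * β y ^ 2) * (phase (-τ) y * W y)) 2 unitVol :=
    memLp_mul_continuousOn (memLp_phase_mul mW _) cm
  have dt := ((hv.add d2 m1 m2).add d3 (m1.add m2) m3).add d4 ((m1.add m2).add m3) mc
  refine hL.energy_sub_le hB ell' (((m1.add m2).add m3).add mc) (by positivity)
    (dt.mono hK0.le ?_)
  have : A ^ 2 * E ≤ A ^ 3 * E :=
    mul_le_mul_of_nonneg_right (pow_le_pow_right₀ hA (by norm_num)) hE0
  linarith

end FiniteChannel

namespace FiniteChannel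

variable {A C κ τ m : ℝ} {h : ℝ → ℝ} {β ρ ρ' f f₁ f₂ f₃ : ℝ → ℂ}
  {u₀ ξ₀ u₁ ξ₁ p ξ s q η q₂ W W₁ v : ℝ → ℂ}

/-! ### The second derivative of the forcing -/

/-- `f` has three derivatives, all bounded by `m`. -/
structure IsCoeff (m : ℝ) (f f₁ f₂ f₃ : ℝ → ℂ) : Prop where
  prim : IsPrimitive f f₁
  prim₁ : IsPrimitive f₁ f₂
  prim₂ : IsPrimitive f₂ f₃
  norm_le : ∀ y ∈ Icc (0 : ℝ) 1, ‖f y‖ ≤ m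
  norm₁_le : ∀ y ∈ Icc (0 : ℝ) 1, ‖f₁ y‖ ≤ m
  norm₂_le : ∀ y ∈ Icc (0 : ℝ) 1, ‖f₂ y‖ ≤ m
  norm₃_le : ∀ᵐ y ∂unitVol, ‖f₃ y‖ ≤ m

theorem IsCoeff.nonneg (hf : IsCoeff m f f₁ f₂ f₃) : 0 ≤ m :=
  (norm_nonneg _).trans (hf.norm_le 0 (by simp))

/-- The second derivative of `e^{iτy} f p`, in terms of `p` and its first two derivatives `q`,
`q₂` in the moving frame. -/
noncomputable def forcingDeriv (τ : ℝ) (f f₁ f₂ p q q₂ : ℝ → ℂ) (y : ℝ) : ℂ :=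
  phase τ y * (f₂ y * p y + 2 * (f₁ y * q y) + f y * q₂ y)

theorem isPrimitive_forcing (hf : IsCoeff m f f₁ f₂ f₃) (hp : IsElliptic h κ p ξ s)
    (hq : q = twist h τ p ξ) :
    IsPrimitive (fun y => phase τ y * (f y * p y))
      (fun y => phase τ y * (f₁ y * p y + f y * q y)) :=
  ((isPrimitive_phase τ).mul (hf.prim.mul hp.prim_p)).congr (fun _ _ => rfl)
    (Filter.Eventually.of_forall fun y => by simp only [hq, twist]; ring)

theorem isPrimitive_twist (hB : Background A h β ρ ρ') (hp : IsElliptic h κ p ξ s)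
    (hq : q = twist h τ p ξ) (hη : η = twistFlux h β κ τ p ξ s) :
    IsPrimitive q (fun y => h y * η y) :=
  ((hB.prim_h.mul hp.prim_ξ).add (hp.prim_p.const_mul (Complex.I * τ))).congr
    (fun y _ => by simp only [hq, twist])
    (Filter.Eventually.of_forall fun y => by simp only [hη, twistFlux]; ring)

theorem isPrimitive_forcing_deriv (hB : Background A h β ρ ρ') (hf : IsCoeff m f f₁ f₂ f₃)
    (hp : IsElliptic h κ p ξ s) (hq : q = twist h τ p ξ) (hη : η = twistFlux h β κ τ p ξ s)
    (hq₂ : q₂ = twist h τ q η) :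
    IsPrimitive (fun y => phase τ y * (f₁ y * p y + f y * q y))
      (forcingDeriv τ f f₁ f₂ p q q₂) :=
  ((isPrimitive_phase τ).mul ((hf.prim₁.mul hp.prim_p).add
    (hf.prim.mul (isPrimitive_twist hB hp hq hη)))).congr (fun _ _ => rfl)
    (Filter.Eventually.of_forall fun y => by
      simp only [forcingDeriv, hq₂, twist, hq]; ring)

theorem memLp_forcingDeriv (hf : IsCoeff m f f₁ f₂ f₃) (mp : MemLp p 2 unitVol)
    (mq : MemLp q 2 unitVol) (mq₂ : MemLp q₂ 2 unitVol) :
    MemLp (forcingDeriv τ f f₁ f₂ p q q₂) 2 unitVol :=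
  memLp_phase_mul (((memLp_mul_continuousOn mp hf.prim₂.continuousOn).add
    ((memLp_mul_continuousOn mq hf.prim₁.continuousOn).const_mul 2)).add
    (memLp_mul_continuousOn mq₂ hf.prim.continuousOn)) τ

theorem l2_forcingDeriv_le (hf : IsCoeff m f f₁ f₂ f₃) (mp : MemLp p 2 unitVol)
    (mq : MemLp q 2 unitVol) (mq₂ : MemLp q₂ 2 unitVol) :
    l2 (forcingDeriv τ f f₁ f₂ p q q₂) ≤ m * (l2 p + 2 * l2 q + l2 q₂) := by
  have hm := hf.nonneg
  have m1 := memLp_mul_continuousOn mp hf.prim₂.continuousOn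
  have m2 := memLp_mul_continuousOn mq hf.prim₁.continuousOn
  have m3 := memLp_mul_continuousOn mq₂ hf.prim.continuousOn
  have b1 := l2_mul_le mp hm (ae_unitVol_of_forall hf.norm₂_le)
  have b2 := l2_mul_le mq hm (ae_unitVol_of_forall hf.norm₁_le)
  have b3 := l2_mul_le mq₂ hm (ae_unitVol_of_forall hf.norm_le)
  have b4 : l2 (fun y => 2 * (f₁ y * q y)) ≤ 2 * l2 (fun y => f₁ y * q y) :=
    l2_le_mul m2 (by norm_num) (Filter.Eventually.of_forall fun y => by simp)
  have b5 := l2_add_le m1 (m2.const_mul 2)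
  have b6 := l2_add_le (m1.add (m2.const_mul 2)) m3
  have e : l2 (forcingDeriv τ f f₁ f₂ p q q₂)
      = l2 (fun y => f₂ y * p y + 2 * (f₁ y * q y) + f y * q₂ y) := l2_phase_mul _ τ
  rw [e]
  have b7 : l2 (fun y => f₂ y * p y + 2 * (f₁ y * q y) + f y * q₂ y)
      ≤ l2 (fun y => f₂ y * p y) + l2 (fun y => 2 * (f₁ y * q y)) + l2 (fun y => f y * q₂ y) :=
    b6.trans (add_le_add b5 le_rfl)
  linarith

/-- The forcing is of class `H²` even for a vorticity that is merely square integrable. -/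
theorem exists_l2_forcingDeriv_le (A κ m T : ℝ) (hκ : 0 < κ) : ∃ D : ℝ, 0 ≤ D ∧
    ∀ (h : ℝ → ℝ) (β ρ ρ' f f₁ f₂ f₃ p ξ s q η q₂ : ℝ → ℂ) (τ : ℝ), |τ| ≤ T →
      Background A h β ρ ρ' → IsCoeff m f f₁ f₂ f₃ → IsElliptic h κ p ξ s → MemLp s 2 unitVol →
      p 0 = 0 → p 1 = 0 → q = twist h τ p ξ → η = twistFlux h β κ τ p ξ s →
      q₂ = twist h τ q η → l2 (forcingDeriv τ f f₁ f₂ p q q₂) ≤ D * l2 s := by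
  set E : ℝ := 8 * A ^ 5 with hE
  set Eq : ℝ := A * E + T * E with hEq
  set Eη : ℝ := A * (1 + κ ^ 2 * E) + T * E + A * E with hEη
  refine ⟨|m * (E + 2 * Eq + (A * Eη + T * Eq))|, abs_nonneg _, ?_⟩
  intro h β ρ ρ' f f₁ f₂ f₃ p ξ s q η q₂ τ hτ hB hf hp ms h0 h1 hq hη hq₂
  have hA := hB.one_le
  have hA0 := hB.pos
  have hm := hf.nonneg
  have hT : 0 ≤ T := (abs_nonneg _).trans hτ
  set K := max κ 1 with hK
  have hK1 : 1 ≤ K := le_max_right _ _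
  have hK0 : 0 < K := zero_lt_one.trans_le hK1
  have hs := l2_nonneg s
  have mp := hp.prim_p.memLp 2
  have mξ := hp.memLp_ξ
  have mq : MemLp q 2 unitVol := hq ▸ memLp_twist hB mp mξ
  have mη : MemLp η 2 unitVol := hη ▸ memLp_twistFlux hB mp mξ ms
  have mq₂ : MemLp q₂ 2 unitVol := hq₂ ▸ memLp_twist hB mq mη
  have hd : DualLe K (l2 s) s := dualLe_of_l2 hK0 ms (le_mul_of_one_le_left hs hK1)
  have e0 := hp.energy_le_of_dualLe hB ms h0 h1 hs hd
  rw [← hK, ← hE] at e0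
  have hp0 := l2_nonneg p
  have hξ0 := l2_nonneg ξ
  have bp : l2 p ≤ E * l2 s := by
    have : l2 p ≤ K * l2 p := le_mul_of_one_le_left hp0 hK1
    linarith
  have bξ : l2 ξ ≤ E * l2 s := by
    have : 0 ≤ K * l2 p := by positivity
    linarith
  have nI : ∀ w : ℝ → ℂ, MemLp w 2 unitVol → l2 (fun y => Complex.I * τ * w y) ≤ T * l2 w :=
    fun w mw => l2_mul_le mw hT (Filter.Eventually.of_forall fun y => by
      simpa using hτ)
  have bq : l2 q ≤ Eq * l2 s := by
    have c1 := l2_add_le (hB.memLp_h_mul mξ) (mp.const_mul (Complex.I * τ))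
    have c2 := hB.l2_h_mul_le mξ
    have c3 := nI p mp
    have c4 : A * l2 ξ ≤ A * (E * l2 s) := by gcongr
    have c5 : T * l2 p ≤ T * (E * l2 s) := by gcongr
    rw [hq]
    refine c1.trans ?_
    rw [hEq]; linarith
  have bη : l2 η ≤ Eη * l2 s := by
    have ma : MemLp (fun y => s y + κ ^ 2 * p y) 2 unitVol := ms.add (mp.const_mul _)
    have mb := memLp_mul_continuousOn mξ hB.prim_β.continuousOn
    have c1 := l2_add_le ((hB.memLp_h_mul ma).add (mξ.const_mul (Complex.I * τ))) mb
    have c2 := l2_add_le (hB.memLp_h_mul ma) (mξ.const_mul (Complex.I * τ))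
    have c3 := hB.l2_h_mul_le ma
    have c4 := l2_add_le ms (mp.const_mul ((κ : ℂ) ^ 2))
    have c5 : l2 (fun y => (κ : ℂ) ^ 2 * p y) ≤ κ ^ 2 * l2 p :=
      l2_mul_le mp (by positivity) (Filter.Eventually.of_forall fun y => by
        simp)
    have c6 := nI ξ mξ
    have c7 := l2_mul_le mξ hA0.le (ae_unitVol_of_forall hB.norm_β_le)
    have c8 : κ ^ 2 * l2 p ≤ κ ^ 2 * (E * l2 s) := by gcongr
    have c9 : A * l2 (fun y => s y + κ ^ 2 * p y) ≤ A * (l2 s + κ ^ 2 * (E * l2 s)) := by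
      gcongr; exact c4.trans (add_le_add le_rfl (c5.trans c8))
    have c10 : A * l2 ξ ≤ A * (E * l2 s) := by gcongr
    have c11 : T * l2 ξ ≤ T * (E * l2 s) := by gcongr
    rw [hη]
    refine c1.trans ?_
    refine (add_le_add c2 le_rfl).trans ?_
    rw [hEη]; linarith
  have bq₂ : l2 q₂ ≤ (A * Eη + T * Eq) * l2 s := by
    have c1 := l2_add_le (hB.memLp_h_mul mη) (mq.const_mul (Complex.I * τ))
    have c2 := hB.l2_h_mul_le mη
    have c3 := nI q mq
    have c4 : A * l2 η ≤ A * (Eη * l2 s) := by gcongr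
    have c5 : T * l2 q ≤ T * (Eq * l2 s) := by gcongr
    rw [hq₂]
    refine c1.trans ?_
    linarith
  calc _ ≤ m * (l2 p + 2 * l2 q + l2 q₂) := l2_forcingDeriv_le hf mp mq mq₂
    _ ≤ m * (E * l2 s + 2 * (Eq * l2 s) + (A * Eη + T * Eq) * l2 s) := by gcongr
    _ = (m * (E + 2 * Eq + (A * Eη + T * Eq))) * l2 s := by ring
    _ ≤ _ := by gcongr; exact le_abs_self _

theorem inv_sq_add_sq_le {K τ : ℝ} (hK : 1 ≤ K) :
    (K + |τ|) / (K ^ 2 + τ ^ 2) ≤ 2 / (K + |τ|) := by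
  have h0 := abs_nonneg τ
  rw [div_le_div_iff₀ (by positivity) (by positivity), ← sq_abs τ]
  nlinarith [sq_nonneg (K - |τ|)]

end FiniteChannel

namespace FiniteChannel

variable {A C κ τ m : ℝ} {h : ℝ → ℝ} {β ρ ρ' f f₁ f₂ f₃ : ℝ → ℂ}
  {u₀ ξ₀ u₁ ξ₁ p ξ s q η q₂ W W₁ v : ℝ → ℂ}

/-! ### Splitting off the boundary layers of the forcing -/

/-- Where both the stream function and the vorticity vanish, its derivatives are controlled by
its flux. -/
theorem norm_twist_wall_le (hB : Background A h β ρ ρ') {y X : ℝ} (hy : y ∈ Icc (0 : ℝ) 1)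
    (py : p y = 0) (sy : s y = 0) (hX : ‖ξ y‖ ≤ X) (hq : q = twist h τ p ξ)
    (hη : η = twistFlux h β κ τ p ξ s) (hq₂ : q₂ = twist h τ q η) :
    ‖q y‖ ≤ A * X ∧ ‖q₂ y‖ ≤ 2 * A ^ 2 * ((1 + |τ|) * X) := by
  have hA := hB.one_le
  have hA0 := hB.pos
  have hX0 : 0 ≤ X := (norm_nonneg _).trans hX
  have ht : 0 ≤ |τ| := abs_nonneg τ
  have nh := hB.norm_h_le hy
  have nβ := hB.norm_β_le y hy
  have e1 : q y = h y * ξ y := by rw [hq, twist, py]; ring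
  have e2 : η y = (Complex.I * τ + β y) * ξ y := by rw [hη, twistFlux, py, sy]; ring
  have n1 : ‖q y‖ ≤ A * X := by rw [e1, norm_mul]; gcongr
  have n0 : ‖Complex.I * (τ : ℂ)‖ = |τ| := by simp
  have n2 : ‖η y‖ ≤ (|τ| + A) * X := by
    rw [e2, norm_mul]
    gcongr
    refine (norm_add_le _ _).trans ?_
    rw [n0]; gcongr
  have n3 : ‖q₂ y‖ ≤ A * ((|τ| + A) * X) + |τ| * (A * X) := by
    rw [hq₂, twist]
    refine (norm_add_le _ _).trans ?_
    rw [norm_mul, norm_mul (Complex.I * (τ : ℂ)), n0]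
    gcongr
  refine ⟨n1, n3.trans ?_⟩
  have c0 : A ≤ A ^ 2 := by nlinarith
  have c1 : A * (|τ| * X) ≤ A ^ 2 * (|τ| * X) := by gcongr
  have c2 : 0 ≤ A ^ 2 * X := by positivity
  linarith

theorem fc_sub_layers {e e' a b c d : ℝ → ℂ} (he' : MemLp e' 2 unitVol)
    (ha : MemLp a 2 unitVol) (hb : MemLp b 2 unitVol) (hc : MemLp c 2 unitVol)
    (hd : MemLp d 2 unitVol) (x₁ x₂ x₃ x₄ : ℂ)
    (h : ∀ y, e y = e' y + x₁ * a y + x₂ * b y + x₃ * c y + x₄ * d y) (n : ℤ) :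
    ‖fc e n‖ ≤ ‖fc e' n‖ + ‖x₁‖ * ‖fc a n‖ + ‖x₂‖ * ‖fc b n‖ + ‖x₃‖ * ‖fc c n‖
      + ‖x₄‖ * ‖fc d n‖ := by
  have h1 := ha.const_mul x₁
  have h2 := hb.const_mul x₂
  have h3 := hc.const_mul x₃
  have h4 := hd.const_mul x₄
  have e0 : e = fun y => e' y + x₁ * a y + x₂ * b y + x₃ * c y + x₄ * d y := funext h
  have e1 : fc e n = fc e' n + x₁ * fc a n + x₂ * fc b n + x₃ * fc c n + x₄ * fc d n := by
    rw [e0, ← fc_const_mul, ← fc_const_mul, ← fc_const_mul, ← fc_const_mul]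
    refine (fc_add (((he'.add h1).add h2).add h3) h4 n).trans (congrArg (· + _) ?_)
    refine (fc_add ((he'.add h1).add h2) h3 n).trans (congrArg (· + _) ?_)
    exact (fc_add (he'.add h1) h2 n).trans (congrArg (· + _) (fc_add he' h1 n))
  rw [e1, ← norm_mul, ← norm_mul, ← norm_mul, ← norm_mul]
  exact (norm_add_le _ _).trans (add_le_add ((norm_add_le _ _).trans (add_le_add
    ((norm_add_le _ _).trans (add_le_add (norm_add_le _ _) le_rfl)) le_rfl)) le_rfl)

/-- Removing the boundary layers from the forcing costs little in each Fourier coefficient. -/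
theorem norm_fc_forcingDeriv_le (hL : IsBoundaryLayerPair C A κ h u₀ ξ₀ u₁ ξ₁)
    (hC : 0 ≤ C) (hB : Background A h β ρ ρ') (hf : IsCoeff m f f₁ f₂ f₃)
    (mp : MemLp p 2 unitVol) (mq : MemLp q 2 unitVol) (mq₂ : MemLp q₂ 2 unitVol) {b : ℝ}
    (a0 : ‖q 0‖ ≤ b) (a1 : ‖q 1‖ ≤ b) (b0 : ‖q₂ 0‖ ≤ b) (b1 : ‖q₂ 1‖ ≤ b) (n : ℤ) :
    ‖fc (forcingDeriv τ f f₁ f₂ p q q₂) n‖ ≤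
      ‖fc (forcingDeriv τ f f₁ f₂ p (fun y => q y - q 0 * u₀ y - q 1 * u₁ y)
        (fun y => q₂ y - q₂ 0 * u₀ y - q₂ 1 * u₁ y)) n‖
        + 6 * b * (m * (1 + 3 * A ^ 2 * C) / (max κ 1 + |2 * Real.pi * n - τ|)) := by
  have hb : 0 ≤ b := (norm_nonneg _).trans a0
  have mu₀ := hL.layer₀.elliptic.prim_p.memLp 2
  have mu₁ := hL.layer₁.elliptic.prim_p.memLp 2
  have r0 := hL.layer₀.norm_fc_le (τ := τ) hB hC (Or.inl rfl) (by simp [hL.zero₀, hL.one₀])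
    hf.prim hf.norm_le (ae_unitVol_of_forall hf.norm₁_le) n
  have r1 := hL.layer₁.norm_fc_le (τ := τ) hB hC (Or.inr rfl) (by simp [hL.zero₁, hL.one₁])
    hf.prim hf.norm_le (ae_unitVol_of_forall hf.norm₁_le) n
  have r2 := hL.layer₀.norm_fc_le (τ := τ) hB hC (Or.inl rfl) (by simp [hL.zero₀, hL.one₀])
    hf.prim₁ hf.norm₁_le (ae_unitVol_of_forall hf.norm₂_le) n
  have r3 := hL.layer₁.norm_fc_le (τ := τ) hB hC (Or.inr rfl) (by simp [hL.zero₁, hL.one₁])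
    hf.prim₁ hf.norm₁_le (ae_unitVol_of_forall hf.norm₂_le) n
  have m1 := memLp_phase_mul (memLp_mul_continuousOn mu₀ hf.prim.continuousOn) τ
  have m2 := memLp_phase_mul (memLp_mul_continuousOn mu₁ hf.prim.continuousOn) τ
  have m3 := memLp_phase_mul (memLp_mul_continuousOn mu₀ hf.prim₁.continuousOn) τ
  have m4 := memLp_phase_mul (memLp_mul_continuousOn mu₁ hf.prim₁.continuousOn) τ
  have hm := fc_sub_layers (e := forcingDeriv τ f f₁ f₂ p q q₂)
    (memLp_forcingDeriv (τ := τ) hf mp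
      ((mq.sub (mu₀.const_mul (q 0))).sub (mu₁.const_mul (q 1)))
      ((mq₂.sub (mu₀.const_mul (q₂ 0))).sub (mu₁.const_mul (q₂ 1)))) m1 m2 m3 m4
    (q₂ 0) (q₂ 1) (2 * q 0) (2 * q 1)
    (fun y => by simp only [forcingDeriv, Pi.sub_apply]; ring) n
  set Y := m * (1 + 3 * A ^ 2 * C) / (max κ 1 + |2 * Real.pi * n - τ|) with hY
  have hY0 : 0 ≤ Y := (norm_nonneg _).trans r0
  have c1 : ‖q₂ 0‖ * ‖fc (fun y => phase τ y * (f y * u₀ y)) n‖ ≤ b * Y := by gcongr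
  have c2 : ‖q₂ 1‖ * ‖fc (fun y => phase τ y * (f y * u₁ y)) n‖ ≤ b * Y := by gcongr
  have c3 : ‖2 * q 0‖ * ‖fc (fun y => phase τ y * (f₁ y * u₀ y)) n‖ ≤ (2 * b) * Y := by
    rw [norm_mul, Complex.norm_ofNat]; gcongr
  have c4 : ‖2 * q 1‖ * ‖fc (fun y => phase τ y * (f₁ y * u₁ y)) n‖ ≤ (2 * b) * Y := by
    rw [norm_mul, Complex.norm_ofNat]; gcongr
  refine hm.trans ?_
  have e : (fun y => q y - q 0 * u₀ y - q 1 * u₁ y)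
      = (q - fun y => q 0 * u₀ y) - fun y => q 1 * u₁ y := rfl
  have e' : (fun y => q₂ y - q₂ 0 * u₀ y - q₂ 1 * u₁ y)
      = (q₂ - fun y => q₂ 0 * u₀ y) - fun y => q₂ 1 * u₁ y := rfl
  rw [e, e']
  linarith

/-- Energy of the part of the forcing that vanishes at the walls. -/
theorem exists_forcing_energy_le (hf : IsCoeff m f f₁ f₂ f₃) {K a₀ a₁ a₂ : ℝ} (hK : 1 ≤ K)
    {p' q' q₂' : ℝ → ℂ} (hp : IsPrimitive p p') (hq : IsPrimitive q q')
    (hq₂ : IsPrimitive q₂ q₂') (mp' : MemLp p' 2 unitVol) (mq' : MemLp q' 2 unitVol)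
    (mq₂' : MemLp q₂' 2 unitVol) (h₀ : K * l2 p + l2 p' ≤ a₀) (h₁ : K * l2 q + l2 q' ≤ a₁)
    (h₂ : K * l2 q₂ + l2 q₂' ≤ a₂) :
    ∃ P', IsPrimitive (fun y => f₂ y * p y + 2 * (f₁ y * q y) + f y * q₂ y) P' ∧
      MemLp P' 2 unitVol ∧
      K * l2 (fun y => f₂ y * p y + 2 * (f₁ y * q y) + f y * q₂ y) + l2 P'
        ≤ 2 * m * (a₀ + 2 * a₁ + a₂) := by
  have hm := hf.nonneg
  have mp := hp.memLp 2
  have mq := hq.memLp 2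
  have mq₂ := hq₂.memLp 2
  have key : ∀ {g g' u u' : ℝ → ℂ}, IsPrimitive g g' → (∀ y ∈ Icc (0 : ℝ) 1, ‖g y‖ ≤ m) →
      (∀ᵐ y ∂unitVol, ‖g' y‖ ≤ m) → MemLp u 2 unitVol → MemLp u' 2 unitVol →
      MemLp (fun y => g' y * u y + g y * u' y) 2 unitVol ∧
        l2 (fun y => g' y * u y + g y * u' y) ≤ m * (l2 u + l2 u') := by
    intro g g' u u' hg ng ng' mu mu'
    have x1 : MemLp (fun y => g' y * u y) 2 unitVol := memLp_mul_bound mu hg.integrable.1 ng'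
    have x2 : MemLp (fun y => g y * u' y) 2 unitVol := memLp_mul_continuousOn mu' hg.continuousOn
    refine ⟨x1.add x2, (l2_add_le x1 x2).trans ?_⟩
    have y1 := l2_mul_le mu hm ng'
    have y2 := l2_mul_le mu' hm (ae_unitVol_of_forall ng)
    linarith
  obtain ⟨n0, b0⟩ := key hf.prim₂ hf.norm₂_le hf.norm₃_le mp mp'
  obtain ⟨n1, b1⟩ := key hf.prim₁ hf.norm₁_le (ae_unitVol_of_forall hf.norm₂_le) mq mq'
  obtain ⟨n2, b2⟩ := key hf.prim hf.norm_le (ae_unitVol_of_forall hf.norm₁_le) mq₂ mq₂'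
  refine ⟨_, ((hf.prim₂.mul hp).add ((hf.prim₁.mul hq).const_mul 2)).add (hf.prim.mul hq₂),
    (n0.add (n1.const_mul 2)).add n2, ?_⟩
  have d1 : l2 (fun y => 2 * (f₂ y * q y + f₁ y * q' y)) ≤ 2 * (m * (l2 q + l2 q')) :=
    (l2_le_mul n1 (by norm_num) (Filter.Eventually.of_forall fun y => by simp)).trans
      (mul_le_mul_of_nonneg_left b1 (by norm_num))
  have d2 := l2_add_le (n0.add (n1.const_mul 2)) n2
  have d3 := l2_add_le n0 (n1.const_mul 2)
  have d4 : l2 (fun y => f₂ y * p y + 2 * (f₁ y * q y) + f y * q₂ y)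
      ≤ m * (l2 p + 2 * l2 q + l2 q₂) := by
    have := l2_forcingDeriv_le (τ := 0) hf mp mq mq₂
    rwa [show l2 (forcingDeriv 0 f f₁ f₂ p q q₂) = _ from l2_phase_mul _ 0] at this
  have hp0 := l2_nonneg p
  have hq0 := l2_nonneg q
  have hr0 := l2_nonneg q₂
  have d5 : K * l2 (fun y => f₂ y * p y + 2 * (f₁ y * q y) + f y * q₂ y)
      ≤ K * (m * (l2 p + 2 * l2 q + l2 q₂)) := by gcongr
  have d6 : ∀ {x y a : ℝ}, 0 ≤ x → 0 ≤ y → K * x + y ≤ a → K * x + (x + y) ≤ 2 * a := by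
    intro x y a hx hy hxy
    have : 1 * x ≤ K * x := by gcongr
    linarith
  have d7 : m * (K * (l2 p + 2 * l2 q + l2 q₂) + ((l2 p + l2 p') + 2 * (l2 q + l2 q')
      + (l2 q₂ + l2 q₂'))) ≤ m * (2 * (a₀ + 2 * a₁ + a₂)) := by
    gcongr
    have := d6 hp0 (l2_nonneg p') h₀
    have := d6 hq0 (l2_nonneg q') h₁
    have := d6 hr0 (l2_nonneg q₂') h₂
    linarith
  have d8 := d2.trans (add_le_add (d3.trans (add_le_add b0 d1)) b2)
  calc _ ≤ K * (m * (l2 p + 2 * l2 q + l2 q₂)) + (m * (l2 p + l2 p')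
        + 2 * (m * (l2 q + l2 q')) + m * (l2 q₂ + l2 q₂')) := add_le_add d5 d8
    _ = _ := by ring
    _ ≤ _ := d7
    _ = _ := by ring

end FiniteChannel

namespace FiniteChannel

variable {A C κ τ m : ℝ} {h : ℝ → ℝ} {β ρ ρ' f f₁ f₂ f₃ : ℝ → ℂ}
  {u₀ ξ₀ u₁ ξ₁ p ξ s q η q₂ W W₁ v : ℝ → ℂ}

/-- The part of the forcing that vanishes at the walls is controlled by the `H⁻¹` norm of the
second derivative of the vorticity, up to a remainder. -/
theorem exists_forcing_interior_le (hL : IsBoundaryLayerPair C A κ h u₀ ξ₀ u₁ ξ₁)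
    (hC : 0 ≤ C) (hκ : 0 < κ) (hB : Background A h β ρ ρ') (hf : IsCoeff m f f₁ f₂ f₃)
    (hW : IsProfile W W₁ v)
    (hp : IsElliptic h κ p ξ (fun y => phase (-τ) y * W y)) (h0 : p 0 = 0) (h1 : p 1 = 0)
    (hq : q = twist h τ p ξ) (hη : η = twistFlux h β κ τ p ξ fun y => phase (-τ) y * W y)
    (hq₂ : q₂ = twist h τ q η) {b G R : ℝ} (a0 : ‖q 0‖ ≤ b) (a1 : ‖q 1‖ ≤ b) (hG : 0 ≤ G)
    (hv : DualLe (max κ 1) G fun y => phase (-τ) y * v y) (hR : l2 v / (max κ 1 + |τ|) ≤ R) :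
    ∃ P P' : ℝ → ℂ, IsPrimitive P P' ∧ MemLp P' 2 unitVol ∧ P 0 = 0 ∧ P 1 = 0 ∧
      (∀ y, phase τ y * P y = forcingDeriv τ f f₁ f₂ p (fun y => q y - q 0 * u₀ y - q 1 * u₁ y)
        (fun y => q₂ y - q₂ 0 * u₀ y - q₂ 1 * u₁ y) y) ∧
      max κ 1 * l2 P + l2 P' ≤ 2 * m * A * (912 * A ^ 11 * R
        + 8 * A ^ 5 * (G + 50 * A ^ 3 * (465 * A ^ 11 * R + 4 * b * C * A * √(max κ 1)))) := by
  have hA := hB.one_le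
  have hA0 := hB.pos
  have hm := hf.nonneg
  have hb : 0 ≤ b := (norm_nonneg _).trans a0
  have hK1 : 1 ≤ max κ 1 := le_max_right _ _
  have hR0 : 0 ≤ R := le_trans (div_nonneg (l2_nonneg v) (by positivity)) hR
  have mp := hp.prim_p.memLp 2
  have mξ := hp.memLp_ξ
  have ms := memLp_phase_mul (hW.prim.memLp 2) (-τ)
  have mq : MemLp q 2 unitVol := hq ▸ memLp_twist hB mp mξ
  have mη : MemLp η 2 unitVol := hη ▸ memLp_twistFlux hB mp mξ ms
  have mq₂ : MemLp q₂ 2 unitVol := hq₂ ▸ memLp_twist hB mq mη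
  have pq := isPrimitive_twist hB hp hq hη
  obtain ⟨η₂, hη₂⟩ : ∃ η₂, η₂ = twistFlux h β κ τ q η fun y => phase (-τ) y * W₁ y
      + 2 * β y * (phase (-τ) y * W y + κ ^ 2 * p y) + ρ y * ξ y := ⟨_, rfl⟩
  have mη₂ : MemLp η₂ 2 unitVol := hη₂ ▸ memLp_twistFlux hB mq mη
    (((memLp_phase_mul hW.memLp₁ _).add (memLp_mul_continuousOn (ms.add (mp.const_mul _))
      (continuousOn_const.mul hB.prim_β.continuousOn))).add
      (memLp_mul_continuousOn mξ hB.prim_ρ.continuousOn))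
  have pq₂ : IsPrimitive q₂ (fun y => h y * η₂ y) := by
    have := (hp.twist_twist hB τ (hW.prim.phase_mul τ) (hW.prim₁.phase_mul τ)
      (q := q) (η := η) (congrFun hq) (congrFun hη)).prim_p
    rw [hq₂, hη₂]; exact this
  have mu₀ := hL.layer₀.elliptic.prim_p.memLp 2
  have mu₁ := hL.layer₁.elliptic.prim_p.memLp 2
  have mξ₀ := hL.layer₀.elliptic.memLp_ξ
  have mξ₁ := hL.layer₁.elliptic.memLp_ξ
  have pu₀ := hL.layer₀.elliptic.prim_p
  have pu₁ := hL.layer₁.elliptic.prim_p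
  have mθ₁ : MemLp (fun y => q y - q 0 * u₀ y - q 1 * u₁ y) 2 unitVol :=
    (mq.sub (mu₀.const_mul _)).sub (mu₁.const_mul _)
  have mη₁ : MemLp (fun y => η y - q 0 * ξ₀ y - q 1 * ξ₁ y) 2 unitVol :=
    (mη.sub (mξ₀.const_mul _)).sub (mξ₁.const_mul _)
  have mζ₂ : MemLp (fun y => η₂ y - q₂ 0 * ξ₀ y - q₂ 1 * ξ₁ y) 2 unitVol :=
    (mη₂.sub (mξ₀.const_mul _)).sub (mξ₁.const_mul _)
  have pθ : ∀ {q η : ℝ → ℂ}, IsPrimitive q (fun y => h y * η y) →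
      IsPrimitive (fun y => q y - q 0 * u₀ y - q 1 * u₁ y)
        (fun y => h y * (η y - q 0 * ξ₀ y - q 1 * ξ₁ y)) := fun {q η} pq =>
    ((pq.sub (pu₀.const_mul (q 0))).sub (pu₁.const_mul (q 1))).congr (fun _ _ => rfl)
      (Filter.Eventually.of_forall fun y => by simp only []; ring)
  have pow1 : 1 ≤ A ^ 11 := one_le_pow₀ hA
  have pow5 : A ^ 5 ≤ A ^ 11 := pow_le_pow_right₀ hA (by norm_num)
  have R5 : A ^ 5 * R ≤ A ^ 11 * R := by gcongr
  have R1 : 1 * R ≤ A ^ 11 * R := by gcongr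
  have E0 := (stream_energy_le hB hW hp h0 h1).trans
    (mul_le_mul_of_nonneg_left hR (by positivity))
  have E1 := (stream_deriv_energy_le hL hκ hB hW hp h0 h1 hq hη).trans
    (mul_le_mul_of_nonneg_left hR (by positivity))
  have hlay : 0 ≤ 4 * b * C * A * √(max κ 1) := by positivity
  have Eq' : max κ 1 * l2 q + l2 η ≤ 448 * A ^ 11 * R + 4 * b * C * A * √(max κ 1) := by
    have e := hL.energy_le hC hA (q 0) (q 1) mθ₁ mη₁
    have e2 : (‖q 0‖ + ‖q 1‖) * (2 * C * A * √(max κ 1)) ≤ (b + b) * (2 * C * A * √(max κ 1)) := by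
      gcongr
    linarith
  have E2 := stream_deriv_deriv_energy_le hL hκ hB hW hp hq hη hq₂ hη₂ hG hv
    (E := 465 * A ^ 11 * R + 4 * b * C * A * √(max κ 1)) (by linarith) (by linarith) (by linarith)
  have lift : ∀ {u w : ℝ → ℂ} {a : ℝ}, MemLp w 2 unitVol → max κ 1 * l2 u + l2 w ≤ a →
      max κ 1 * l2 u + l2 (fun y => h y * w y) ≤ A * a := by
    intro u w a mw ha
    have c1 := hB.l2_h_mul_le mw
    have c2 : 1 * (max κ 1 * l2 u) ≤ A * (max κ 1 * l2 u) := by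
      gcongr; exact mul_nonneg (by positivity) (l2_nonneg u)
    have c3 : A * (max κ 1 * l2 u + l2 w) ≤ A * a := by gcongr
    linarith
  obtain ⟨P', hP, mP', bP⟩ := exists_forcing_energy_le hf hK1 hp.prim_p (pθ pq) (pθ pq₂)
    (hB.memLp_h_mul mξ) (hB.memLp_h_mul mη₁) (hB.memLp_h_mul mζ₂) (lift mξ E0) (lift mη₁ E1)
    (lift mζ₂ E2)
  refine ⟨_, P', hP, mP', ?_, ?_, fun y => rfl, bP.trans ?_⟩
  · simp [h0, hL.zero₀, hL.zero₁]
  · simp [h1, hL.one₀, hL.one₁]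
  · have : 16 * A ^ 5 * R + 2 * (448 * A ^ 11 * R) ≤ 912 * A ^ 11 * R := by linarith
    calc _ = 2 * m * A * (16 * A ^ 5 * R + 2 * (448 * A ^ 11 * R) + 8 * A ^ 5 * (G + 50 * A ^ 3
          * (465 * A ^ 11 * R + 4 * b * C * A * √(max κ 1)))) := by ring
      _ ≤ _ := by gcongr

/-- The second derivative of the forcing is the sum of a function `e^{iτy} P` with `P ∈ H¹₀`
controlled by the energy, and of boundary layers. The energy bound involves the norm of `∂_y² W`
in `H⁻¹` and a remainder that is square integrable in time. -/
theorem exists_forcingDeriv_decomposition (A : ℝ) : ∃ D : ℝ, 0 < D ∧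
    ∀ (h : ℝ → ℝ) (β ρ ρ' f f₁ f₂ f₃ W W₁ v p ξ q η q₂ : ℝ → ℂ) (κ τ m K S : ℝ),
      Background A h β ρ ρ' → 0 < κ → IsCoeff m f f₁ f₂ f₃ → IsProfile W W₁ v →
      IsElliptic h κ p ξ (fun y => phase (-τ) y * W y) → p 0 = 0 → p 1 = 0 →
      q = twist h τ p ξ → η = twistFlux h β κ τ p ξ (fun y => phase (-τ) y * W y) →
      q₂ = twist h τ q η → K = max κ 1 → S = ‖W₁ 0‖ + ‖W₁ 1‖ + l2 v / √K →
      ∃ P P' : ℝ → ℂ, IsPrimitive P P' ∧ MemLp P' 2 unitVol ∧ P 0 = 0 ∧ P 1 = 0 ∧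
        K * l2 P + l2 P' ≤ D * m *
          (√(∑' n : ℤ, ‖fc v n‖ ^ 2 / (K ^ 2 + (2 * Real.pi * n - τ) ^ 2)) + √K * S / (K + |τ|)) ∧
        (∀ n : ℤ, ‖fc (forcingDeriv τ f f₁ f₂ p q q₂) n‖ ≤ ‖fc (fun y => phase τ y * P y) n‖
          + D * m * S / ((K + |τ|) * (K + |2 * Real.pi * n - τ|))) ∧
        ‖f 0 * q 0‖ ≤ D * m * S / (K ^ 2 + τ ^ 2) ∧ ‖f 1 * q 1‖ ≤ D * m * S / (K ^ 2 + τ ^ 2) := by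
  obtain ⟨C, hC0, hlayers⟩ := exists_boundaryLayers A
  obtain ⟨D₀, hD₀⟩ : ∃ D₀, D₀ = 131 * |A| ^ 6 * C := ⟨_, rfl⟩
  obtain ⟨b₀, hb₀⟩ : ∃ b₀, b₀ = 4 * |A| ^ 2 * D₀ := ⟨_, rfl⟩
  obtain ⟨D₁, hD₁⟩ : ∃ D₁, D₁ = 2 * |A| * (912 * |A| ^ 11 + 8 * |A| ^ 5 * (1 + 50 * |A| ^ 3 *
    (465 * |A| ^ 11 + 4 * b₀ * C * |A|))) := ⟨_, rfl⟩
  obtain ⟨D₂, hD₂⟩ : ∃ D₂, D₂ = 6 * b₀ * (1 + 3 * |A| ^ 2 * C) := ⟨_, rfl⟩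
  have hA0' : 0 ≤ |A| := abs_nonneg A
  have hD₀0 : 0 ≤ D₀ := by rw [hD₀]; positivity
  have hb₀0 : 0 ≤ b₀ := by rw [hb₀]; positivity
  have hD₁0 : 0 ≤ D₁ := by rw [hD₁]; positivity
  have hD₂0 : 0 ≤ D₂ := by rw [hD₂]; positivity
  refine ⟨D₁ + D₂ + |A| * D₀ + 1, by positivity, ?_⟩
  intro h β ρ ρ' f f₁ f₂ f₃ W W₁ v p ξ q η q₂ κ τ m K S hB hκ hf hW hp h0 h1 hq hη hq₂ hK hS
  have hA := hB.one_le
  have hA0 := hB.pos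
  rw [abs_of_pos hA0] at *
  have hm := hf.nonneg
  obtain ⟨u₀, ξ₀, u₁, ξ₁, l0, l1, z0, o0, z1, o1⟩ := hlayers h β ρ ρ' κ hB hκ
  have hL : IsBoundaryLayerPair C A κ h u₀ ξ₀ u₁ ξ₁ := ⟨l0, l1, z0, o0, z1, o1⟩
  have hK1 : 1 ≤ K := hK ▸ le_max_right _ _
  have hK0 : 0 < K := zero_lt_one.trans_le hK1
  have hsK : 0 < √K := Real.sqrt_pos.2 hK0
  have hV := l2_nonneg v
  have hS0 : 0 ≤ S := by rw [hS]; positivity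
  have ht : 0 ≤ |τ| := abs_nonneg τ
  have hKτ : 0 < K ^ 2 + τ ^ 2 := by positivity
  obtain ⟨X, hX⟩ : ∃ X, X = D₀ * S / (K ^ 2 + τ ^ 2) := ⟨_, rfl⟩
  have hX0 : 0 ≤ X := by rw [hX]; positivity
  obtain ⟨x0, x1⟩ := stream_flux_le (τ := τ) hL hC0.le hB hκ hW hp h0 h1
  rw [← hK, ← hS, ← hD₀] at x0 x1
  have y0 : ‖ξ 0‖ ≤ X := by rw [hX, le_div_iff₀ hKτ]; linarith
  have y1 : ‖ξ 1‖ ≤ X := by rw [hX, le_div_iff₀ hKτ]; linarith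
  obtain ⟨b, hb⟩ : ∃ b, b = b₀ * (S / (K + |τ|)) := ⟨_, rfl⟩
  have hXb : 2 * A ^ 2 * ((K + |τ|) * X) ≤ b := by
    calc _ = 2 * A ^ 2 * (D₀ * S * ((K + |τ|) / (K ^ 2 + τ ^ 2))) := by rw [hX]; ring
      _ ≤ 2 * A ^ 2 * (D₀ * S * (2 / (K + |τ|))) :=
        mul_le_mul_of_nonneg_left (mul_le_mul_of_nonneg_left (inv_sq_add_sq_le hK1)
          (by positivity)) (by positivity)
      _ = b := by rw [hb, hb₀]; ring
  have hXb₂ : 2 * A ^ 2 * ((1 + |τ|) * X) ≤ b := le_trans (by gcongr) hXb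
  have hXb₁ : A * X ≤ b := by
    refine le_trans ?_ hXb₂
    calc A * X = A * (1 * X) := by ring
      _ ≤ (2 * A ^ 2) * ((1 + |τ|) * X) := by
        gcongr
        · nlinarith
        · linarith
  have sy : ∀ {y}, W y = 0 → phase (-τ) y * W y = 0 := fun h => by rw [h, mul_zero]
  obtain ⟨a0, c0⟩ := norm_twist_wall_le hB (by simp) h0 (sy hW.zero) y0 hq hη hq₂
  obtain ⟨a1, c1⟩ := norm_twist_wall_le hB (by simp) h1 (sy hW.one) y1 hq hη hq₂
  have mp := hp.prim_p.memLp 2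
  have mξ := hp.memLp_ξ
  have ms := memLp_phase_mul (hW.prim.memLp 2) (-τ)
  have mq : MemLp q 2 unitVol := hq ▸ memLp_twist hB mp mξ
  have mη : MemLp η 2 unitVol := hη ▸ memLp_twistFlux hB mp mξ ms
  have mq₂ : MemLp q₂ 2 unitVol := hq₂ ▸ memLp_twist hB mq mη
  obtain ⟨G, hG⟩ : ∃ G, G = √(∑' n : ℤ, ‖fc v n‖ ^ 2 / (K ^ 2 + (2 * Real.pi * n - τ) ^ 2)) :=
    ⟨_, rfl⟩
  have hG0 : 0 ≤ G := hG ▸ Real.sqrt_nonneg _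
  have hv : DualLe (max κ 1) G fun y => phase (-τ) y * v y := fun X X' hX hX' X0 X1 => by
    rw [← hK, hG]
    exact re_integral_phase_mul_conj_le hW.memLp hX hX' X0 X1 hK0 τ
  obtain ⟨R, hR⟩ : ∃ R, R = √K * S / (K + |τ|) := ⟨_, rfl⟩
  have hR0 : 0 ≤ R := by rw [hR]; positivity
  have hVR : l2 v / (max κ 1 + |τ|) ≤ R := by
    rw [hR, ← hK]; gcongr
    have : √K * (l2 v / √K) = l2 v := by field_simp
    rw [hS, mul_add, this]; exact le_add_of_nonneg_left (by positivity)
  obtain ⟨P, P', hP, mP', P0, P1, eP, bP⟩ := exists_forcing_interior_le hL hC0.le hκ hB hf hW hp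
    h0 h1 hq hη hq₂ (a0.trans hXb₁) (a1.trans hXb₁) hG0 hv hVR
  have wallf : ∀ {y}, y ∈ Icc (0 : ℝ) 1 → ‖q y‖ ≤ A * X →
      ‖f y * q y‖ ≤ (D₁ + D₂ + A * D₀ + 1) * m * S / (K ^ 2 + τ ^ 2) := by
    intro y hy hqy
    rw [norm_mul]
    calc ‖f y‖ * ‖q y‖ ≤ m * (A * X) := by gcongr; exact hf.norm_le y hy
      _ = (A * D₀) * m * S / (K ^ 2 + τ ^ 2) := by rw [hX]; ring
      _ ≤ _ := by gcongr; linarith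
  refine ⟨P, P', hP, mP', P0, P1, ?_, ?_, wallf (by simp) a0, wallf (by simp) a1⟩
  · rw [← hK] at bP
    have e : b * √K = b₀ * R := by rw [hb, hR]; ring
    have e2 : 4 * b * C * A * √K = 4 * b₀ * C * A * R := by linear_combination (4 * C * A) * e
    rw [e2] at bP
    refine bP.trans ?_
    rw [← hG, ← hR]
    have g0 : 0 ≤ 8 * A ^ 5 * (50 * A ^ 3 * (465 * A ^ 11 + 4 * b₀ * C * A)) * G
        + 912 * A ^ 11 * G + 8 * A ^ 5 * R := by positivity
    calc _ ≤ 2 * m * A * (912 * A ^ 11 * R + 8 * A ^ 5 * (G + 50 * A ^ 3 * (465 * A ^ 11 * R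
          + 4 * b₀ * C * A * R)) + (8 * A ^ 5 * (50 * A ^ 3 * (465 * A ^ 11 + 4 * b₀ * C * A)) * G
        + 912 * A ^ 11 * G + 8 * A ^ 5 * R)) := by gcongr 2 * m * A * ?_; linarith
      _ = D₁ * m * (G + R) := by rw [hD₁]; ring
      _ ≤ _ := by gcongr; have : 0 ≤ A * D₀ := by positivity
                  linarith
  · intro n
    have := norm_fc_forcingDeriv_le (τ := τ) hL hC0.le hB hf mp mq mq₂ (a0.trans hXb₁)
      (a1.trans hXb₁) (c0.trans hXb₂) (c1.trans hXb₂) n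
    rw [← hK] at this
    rw [show (fun y => phase τ y * P y) = _ from funext eP]
    refine this.trans (add_le_add le_rfl ?_)
    have hn : 0 ≤ |2 * Real.pi * n - τ| := abs_nonneg _
    calc _ = D₂ * m * S / ((K + |τ|) * (K + |2 * Real.pi * n - τ|)) := by
          rw [hb, hD₂]; field_simp
      _ ≤ _ := by gcongr; have : 0 ≤ A * D₀ := by positivity
                  linarith

end FiniteChannel

namespace FiniteChannel

/-! ### Integrals and sums of resonance kernels -/

theorem lintegral_inv_sq_add_sq {K : ℝ} (hK : 0 < K) (x : ℝ) :
    ∫⁻ s, ENNReal.ofReal (1 / (K ^ 2 + (x - s) ^ 2)) = ENNReal.ofReal (Real.pi / K) := by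
  have e : ∀ s, 1 / (K ^ 2 + (x - s) ^ 2) = K⁻¹ ^ 2 * (1 + (K⁻¹ * s - K⁻¹ * x) ^ 2)⁻¹ := by
    intro s
    have : 0 < K ^ 2 + (x - s) ^ 2 := by positivity
    have h2 : 1 + (K⁻¹ * s - K⁻¹ * x) ^ 2 = K⁻¹ ^ 2 * (K ^ 2 + (x - s) ^ 2) := by
      field_simp; ring
    rw [h2, mul_inv]; field_simp
  have hi : Integrable fun s : ℝ => 1 / (K ^ 2 + (x - s) ^ 2) := by
    simp_rw [e]
    exact (((integrable_inv_one_add_sq.comp_sub_right (K⁻¹ * x)).comp_mul_left'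
      (inv_ne_zero hK.ne')).const_mul _)
  rw [← ofReal_integral_eq_lintegral_ofReal hi
    (Filter.Eventually.of_forall fun s => by positivity)]
  congr 1
  simp_rw [e]
  rw [integral_const_mul, Measure.integral_comp_mul_left
    (fun s => (1 + (s - K⁻¹ * x) ^ 2)⁻¹) K⁻¹, integral_sub_right_eq_self
    (fun s : ℝ => (1 + s ^ 2)⁻¹) (K⁻¹ * x), integral_univ_inv_one_add_sq, inv_inv,
    abs_of_pos hK, smul_eq_mul]
  field_simp

theorem lintegral_add_abs_rpow {K a : ℝ} (hK : 0 < K) (ha : 0 < a) :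
    ∫⁻ s, ENNReal.ofReal ((K + |s|) ^ (-1 - a)) = ENNReal.ofReal (2 / a * K ^ (-a)) := by
  have hint : ∫ s : ℝ, (K + |s|) ^ (-1 - a) = 2 / a * K ^ (-a) := by
    rw [integral_comp_abs (f := fun s => (K + s) ^ (-1 - a))]
    have : ∫ s in Ioi (0 : ℝ), (K + s) ^ (-1 - a) = ∫ s in Ioi K, s ^ (-1 - a) := by
      have := (measurePreserving_add_left volume K).setIntegral_preimage_emb
        (measurableEmbedding_addLeft K) (fun s : ℝ => s ^ (-1 - a)) (Ioi K)
      simpa using this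
    rw [this, integral_Ioi_rpow_of_lt (by linarith) hK]
    have e : -1 - a + 1 = -a := by ring
    rw [e]; field_simp
  have hpos : 0 < 2 / a * K ^ (-a) := by positivity
  have hi : Integrable fun s : ℝ => (K + |s|) ^ (-1 - a) :=
    Integrable.of_integral_ne_zero (by rw [hint]; exact hpos.ne')
  rw [← ofReal_integral_eq_lintegral_ofReal hi
    (Filter.Eventually.of_forall fun s => by positivity), hint]

/-- Each factor of the product is large where the other one is small. -/
theorem inv_mul_le_rpow {a b S : ℝ} (ha : 0 < a) (hb : 0 < b) (hS : 0 < S) (h : S ≤ a + b) :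
    1 / (a * b) ≤ 2 * S ^ (-(3 / 4) : ℝ)
      * (a ^ (-1 - 1 / 4 : ℝ) + b ^ (-1 - 1 / 4 : ℝ)) := by
  wlog hab : a ≤ b generalizing a b
  · have := this hb ha (by linarith) (by linarith)
    rwa [mul_comm b a, add_comm (b ^ _)] at this
  have hSb : S / 2 ≤ b := by linarith
  have e : 1 / (a * b) = b ^ (-(3 / 4) : ℝ) * (a ^ (-1 : ℝ) * b ^ (-(1 / 4) : ℝ)) := by
    rw [mul_left_comm, ← Real.rpow_add hb, one_div, mul_inv, Real.rpow_neg_one]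
    norm_num [Real.rpow_neg_one]
  have h1 : b ^ (-(3 / 4) : ℝ) ≤ 2 * S ^ (-(3 / 4) : ℝ) := by
    calc b ^ (-(3 / 4) : ℝ) ≤ (S / 2) ^ (-(3 / 4) : ℝ) :=
          Real.rpow_le_rpow_of_nonpos (by positivity) hSb (by norm_num)
      _ = 2 ^ (3 / 4 : ℝ) * S ^ (-(3 / 4) : ℝ) := by
          rw [Real.div_rpow hS.le (by norm_num), Real.rpow_neg (by norm_num : (0 : ℝ) ≤ 2),
            div_inv_eq_mul, mul_comm]
      _ ≤ 2 * S ^ (-(3 / 4) : ℝ) := by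
          gcongr
          calc (2 : ℝ) ^ (3 / 4 : ℝ) ≤ 2 ^ (1 : ℝ) :=
                Real.rpow_le_rpow_of_exponent_le (by norm_num) (by norm_num)
            _ = 2 := by simp
  have h2 : b ^ (-(1 / 4) : ℝ) ≤ a ^ (-(1 / 4) : ℝ) :=
    Real.rpow_le_rpow_of_nonpos ha hab (by norm_num)
  have h3 : a ^ (-1 : ℝ) * a ^ (-(1 / 4) : ℝ) = a ^ (-1 - 1 / 4 : ℝ) := by
    rw [← Real.rpow_add ha]; norm_num
  rw [e]
  calc _ ≤ 2 * S ^ (-(3 / 4) : ℝ) * (a ^ (-1 : ℝ) * a ^ (-(1 / 4) : ℝ)) := by gcongr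
    _ ≤ _ := by rw [h3]; gcongr; exact le_add_of_nonneg_right (by positivity)

theorem lintegral_resonance_le {K : ℝ} (hK : 0 < K) (x : ℝ) :
    ∫⁻ s, ENNReal.ofReal (1 / ((K + |s|) * (K + |x - s|)))
      ≤ ENNReal.ofReal (32 * K ^ (-(1 / 4) : ℝ) * (K + |x|) ^ (-(3 / 4) : ℝ)) := by
  have hx := abs_nonneg x
  have hS : 0 < K + |x| := by positivity
  have key : ∀ s, ENNReal.ofReal (1 / ((K + |s|) * (K + |x - s|)))
      ≤ ENNReal.ofReal (2 * (K + |x|) ^ (-(3 / 4) : ℝ)) *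
        (ENNReal.ofReal ((K + |s|) ^ (-1 - 1 / 4 : ℝ))
          + ENNReal.ofReal ((K + |x - s|) ^ (-1 - 1 / 4 : ℝ))) := by
    intro s
    rw [← ENNReal.ofReal_add (by positivity) (by positivity), ← ENNReal.ofReal_mul (by positivity)]
    refine ENNReal.ofReal_le_ofReal (inv_mul_le_rpow (by positivity) (by positivity) hS ?_)
    have : |x| ≤ |s| + |x - s| := by
      calc |x| = |s + (x - s)| := by ring_nf
        _ ≤ _ := abs_add_le _ _
    linarith
  refine (lintegral_mono key).trans ?_
  have h2 : ∫⁻ s, ENNReal.ofReal ((K + |x - s|) ^ (-1 - 1 / 4 : ℝ))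
      = ∫⁻ s, ENNReal.ofReal ((K + |s|) ^ (-1 - 1 / 4 : ℝ)) :=
    lintegral_sub_left_eq_self (fun s => ENNReal.ofReal ((K + |s|) ^ (-1 - 1 / 4 : ℝ))) x
  rw [lintegral_const_mul _ (by fun_prop), lintegral_add_left (by fun_prop), h2,
    lintegral_add_abs_rpow hK (by norm_num), ← ENNReal.ofReal_add (by positivity) (by positivity),
    ← ENNReal.ofReal_mul (by positivity)]
  refine ENNReal.ofReal_le_ofReal (le_of_eq ?_)
  ring

theorem tsum_add_abs_rpow_le {K : ℝ} (hK : 1 ≤ K) :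
    ∑' n : ℤ, ENNReal.ofReal ((K + |2 * Real.pi * n|) ^ (-1 - 1 / 2 : ℝ))
      ≤ ENNReal.ofReal (16 * K ^ (-(1 / 2) : ℝ)) := by
  have hK0 : 0 < K := zero_lt_one.trans_le hK
  have key : ∀ n : ℤ, ENNReal.ofReal ((K + |2 * Real.pi * n|) ^ (-1 - 1 / 2 : ℝ))
      ≤ ∫⁻ s in Ioc (n : ℝ) (n + 1), ENNReal.ofReal (4 * (K + |s|) ^ (-1 - 1 / 2 : ℝ)) := by
    intro n
    have : ∫⁻ s in Ioc (n : ℝ) (n + 1),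
        ENNReal.ofReal ((K + |2 * Real.pi * n|) ^ (-1 - 1 / 2 : ℝ))
        = ENNReal.ofReal ((K + |2 * Real.pi * n|) ^ (-1 - 1 / 2 : ℝ)) := by
      simp
    rw [← this]
    refine setLIntegral_mono' measurableSet_Ioc fun s hs => ENNReal.ofReal_le_ofReal ?_
    have h1 : |s| ≤ |(n : ℝ)| + 1 := by
      have : |s - n| ≤ 1 := abs_le.2 ⟨by linarith [hs.1], by linarith [hs.2]⟩
      calc |s| = |n + (s - n)| := by ring_nf
        _ ≤ |(n : ℝ)| + |s - n| := abs_add_le _ _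
        _ ≤ _ := by linarith
    have h2 : |(n : ℝ)| ≤ |2 * Real.pi * n| := by
      rw [abs_mul]
      refine le_mul_of_one_le_left (abs_nonneg _) ?_
      rw [abs_of_pos (by positivity)]; linarith [Real.pi_gt_three]
    have h3 : (K + |s|) / 2 ≤ K + |2 * Real.pi * n| := by
      have := abs_nonneg (n : ℝ)
      linarith
    have hs0 : 0 < K + |s| := by positivity
    calc (K + |2 * Real.pi * n|) ^ (-1 - 1 / 2 : ℝ) ≤ ((K + |s|) / 2) ^ (-1 - 1 / 2 : ℝ) :=
          Real.rpow_le_rpow_of_nonpos (by positivity) h3 (by norm_num)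
      _ = 2 ^ (3 / 2 : ℝ) * (K + |s|) ^ (-1 - 1 / 2 : ℝ) := by
          rw [Real.div_rpow hs0.le (by norm_num), div_eq_mul_inv, mul_comm,
            ← Real.rpow_neg (by norm_num)]
          norm_num
      _ ≤ 4 * (K + |s|) ^ (-1 - 1 / 2 : ℝ) := by
          gcongr
          calc (2 : ℝ) ^ (3 / 2 : ℝ) ≤ 2 ^ (2 : ℝ) :=
                Real.rpow_le_rpow_of_exponent_le (by norm_num) (by norm_num)
            _ = 4 := by norm_num
  refine (ENNReal.tsum_le_tsum key).trans ?_
  rw [← lintegral_iUnion (fun n => measurableSet_Ioc) (pairwise_disjoint_Ioc_intCast ℝ),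
    iUnion_Ioc_intCast, setLIntegral_univ]
  simp_rw [ENNReal.ofReal_mul (by norm_num : (0 : ℝ) ≤ 4)]
  rw [lintegral_const_mul' _ _ ENNReal.ofReal_ne_top, lintegral_add_abs_rpow hK0 (by norm_num),
    ← ENNReal.ofReal_mul (by norm_num)]
  refine ENNReal.ofReal_le_ofReal (le_of_eq ?_)
  ring

/-- The contributions of the boundary layers to the different Fourier modes are square summable. -/
theorem tsum_lintegral_resonance_sq_le {K : ℝ} (hK : 1 ≤ K) :
    ∑' n : ℤ, (∫⁻ s, ENNReal.ofReal (1 / ((K + |s|) * (K + |2 * Real.pi * n - s|)))) ^ 2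
      ≤ ENNReal.ofReal (16384 / K) := by
  have hK0 : 0 < K := zero_lt_one.trans_le hK
  have key : ∀ n : ℤ,
      (∫⁻ s, ENNReal.ofReal (1 / ((K + |s|) * (K + |2 * Real.pi * n - s|)))) ^ 2
      ≤ ENNReal.ofReal (1024 * K ^ (-(1 / 2) : ℝ))
        * ENNReal.ofReal ((K + |2 * Real.pi * n|) ^ (-1 - 1 / 2 : ℝ)) := by
    intro n
    refine (pow_le_pow_left₀ zero_le (lintegral_resonance_le hK0 _) 2).trans (le_of_eq ?_)
    have e1 : (K ^ (-(1 / 4) : ℝ)) ^ 2 = K ^ (-(1 / 2) : ℝ) := by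
      rw [← Real.rpow_natCast, ← Real.rpow_mul hK0.le]; norm_num
    have e2 : ((K + |2 * Real.pi * n|) ^ (-(3 / 4) : ℝ)) ^ 2
        = (K + |2 * Real.pi * n|) ^ (-1 - 1 / 2 : ℝ) := by
      rw [← Real.rpow_natCast, ← Real.rpow_mul (by positivity)]; norm_num
    rw [← ENNReal.ofReal_pow (by positivity), ← ENNReal.ofReal_mul (by positivity), mul_pow, mul_pow,
      e1, e2]
    norm_num
  refine (ENNReal.tsum_le_tsum key).trans ?_
  rw [ENNReal.tsum_mul_left]
  refine (mul_le_mul_right (tsum_add_abs_rpow_le hK) _).trans ?_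
  rw [← ENNReal.ofReal_mul (by positivity)]
  refine ENNReal.ofReal_le_ofReal (le_of_eq ?_)
  have : K ^ (-(1 / 2) : ℝ) * K ^ (-(1 / 2) : ℝ) = K⁻¹ := by
    rw [← Real.rpow_add hK0, ← Real.rpow_neg_one]; norm_num
  linear_combination (16384 : ℝ) * this

/-- The Cauchy-Schwarz inequality with a weight. -/
theorem sq_lintegral_le {α : Type*} [MeasurableSpace α] (μ : Measure α) {w : α → ℝ}
    (hw : ∀ s, 0 < w s) (mw : Measurable w) {r : α → ℝ≥0∞} (hr : AEMeasurable r μ) :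
    (∫⁻ s, r s ∂μ) ^ 2
      ≤ (∫⁻ s, ENNReal.ofReal (1 / w s) ∂μ) * ∫⁻ s, ENNReal.ofReal (w s) * r s ^ 2 ∂μ := by
  have h := ENNReal.lintegral_mul_le_Lp_mul_Lq μ Real.HolderConjugate.two_two
    (f := fun s => ENNReal.ofReal (1 / √(w s))) (g := fun s => ENNReal.ofReal (√(w s)) * r s)
    (by fun_prop) (by fun_prop)
  have e : ∀ s, ((fun s => ENNReal.ofReal (1 / √(w s)))
      * fun s => ENNReal.ofReal (√(w s)) * r s) s = r s := by
    intro s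
    have := Real.sqrt_pos.2 (hw s)
    simp only [Pi.mul_apply]
    rw [← mul_assoc, ← ENNReal.ofReal_mul (by positivity), one_div_mul_cancel this.ne',
      ENNReal.ofReal_one, one_mul]
  simp_rw [e] at h
  have e1 : ∀ s, ENNReal.ofReal (1 / √(w s)) ^ (2 : ℝ) = ENNReal.ofReal (1 / w s) := by
    intro s
    rw [ENNReal.rpow_two, ← ENNReal.ofReal_pow (by positivity), div_pow, Real.sq_sqrt (hw s).le,
      one_pow]
  have e2 : ∀ s, (ENNReal.ofReal (√(w s)) * r s) ^ (2 : ℝ) = ENNReal.ofReal (w s) * r s ^ 2 := by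
    intro s
    rw [ENNReal.rpow_two, mul_pow, ← ENNReal.ofReal_pow (by positivity), Real.sq_sqrt (hw s).le]
  simp_rw [e1, e2] at h
  refine (pow_le_pow_left₀ zero_le h 2).trans (le_of_eq ?_)
  rw [mul_pow, ← ENNReal.rpow_two, ← ENNReal.rpow_two, ← ENNReal.rpow_mul, ← ENNReal.rpow_mul]
  norm_num

end FiniteChannel

namespace FiniteChannel

/-! ### Closing the estimate in time -/

theorem add_sq_le_two_mul (a b : ℝ≥0∞) : (a + b) ^ 2 ≤ 2 * a ^ 2 + 2 * b ^ 2 := by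
  have := ENNReal.rpow_add_le_mul_rpow_add_rpow a b (p := 2) (by norm_num)
  norm_num at this
  rw [mul_add] at this
  exact this

section closure

variable {K c : ℝ} {μ : Measure ℝ} {Q e : ℤ → ℝ → ℝ≥0∞}

/-- The time integrals of the Fourier coefficients of the forcing are controlled without any
loss from the length of the time interval: in the energy bound, each mode is resonant only for a
time of order `K`. -/
theorem tsum_sq_lintegral_le (hK : 1 ≤ K) (hc : 0 ≤ c) (hμ : μ ≤ volume)
    (mQ : ∀ n, Measurable (Q n)) {B : ℤ → ℝ≥0∞} {S : ℝ≥0∞}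
    (hQ : ∀ᵐ s ∂μ, ∀ n, Q n s ≤ e n s + ENNReal.ofReal c * S *
      ENNReal.ofReal (1 / ((K + |s|) * (K + |2 * Real.pi * n - s|))))
    (he : ∀ᵐ s ∂μ, ∑' n : ℤ, ENNReal.ofReal (K ^ 2 + (2 * Real.pi * n - s) ^ 2) * e n s ^ 2
      ≤ ENNReal.ofReal c ^ 2 *
        (∑' n : ℤ, B n ^ 2 * ENNReal.ofReal (1 / (K ^ 2 + (2 * Real.pi * n - s) ^ 2))
          + ENNReal.ofReal K * S ^ 2 * ENNReal.ofReal (1 / (K ^ 2 + (0 - s) ^ 2)))) :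
    ∑' n : ℤ, (∫⁻ s, Q n s ∂μ) ^ 2 ≤ ENNReal.ofReal (32800 * (c / K) ^ 2) *
      (∑' n : ℤ, B n ^ 2 + ENNReal.ofReal K * S ^ 2) := by
  have hK0 : 0 < K := zero_lt_one.trans_le hK
  set l : ℤ → ℝ → ℝ≥0∞ := fun n s => ENNReal.ofReal c * S *
    ENNReal.ofReal (1 / ((K + |s|) * (K + |2 * Real.pi * n - s|))) with hl
  have ml : ∀ n, Measurable (l n) := fun n => by fun_prop
  set w : ℤ → ℝ → ℝ := fun n s => K ^ 2 + (2 * Real.pi * n - s) ^ 2 with hw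
  have w0 : ∀ n s, 0 < w n s := fun n s => by positivity
  have mw : ∀ n, Measurable (w n) := fun n => by fun_prop
  have hinv : ∀ x : ℝ, ∫⁻ s, ENNReal.ofReal (1 / (K ^ 2 + (x - s) ^ 2)) ∂μ
      ≤ ENNReal.ofReal (Real.pi / K) := fun x =>
    (lintegral_mono' hμ le_rfl).trans_eq (lintegral_inv_sq_add_sq hK0 x)
  set Z : ℝ≥0∞ := ∑' n : ℤ, B n ^ 2 with hZ
  -- the interior part
  set r : ℤ → ℝ → ℝ≥0∞ := fun n s => Q n s - l n s with hr
  have mr : ∀ n, Measurable (r n) := fun n => (mQ n).sub (ml n)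
  have rint : ∑' n : ℤ, (∫⁻ s, r n s ∂μ) ^ 2
      ≤ ENNReal.ofReal ((Real.pi / K) ^ 2 * c ^ 2) * (Z + ENNReal.ofReal K * S ^ 2) := by
    calc ∑' n : ℤ, (∫⁻ s, r n s ∂μ) ^ 2
        ≤ ∑' n : ℤ, ENNReal.ofReal (Real.pi / K)
          * ∫⁻ s, ENNReal.ofReal (w n s) * r n s ^ 2 ∂μ :=
          ENNReal.tsum_le_tsum fun n => (sq_lintegral_le μ (w0 n) (mw n)
            (mr n).aemeasurable).trans (mul_le_mul_left (hinv _) _)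
      _ = ENNReal.ofReal (Real.pi / K)
          * ∫⁻ s, ∑' n : ℤ, ENNReal.ofReal (w n s) * r n s ^ 2 ∂μ := by
          rw [ENNReal.tsum_mul_left, lintegral_tsum fun n => by
            have := mr n; have := mw n; fun_prop]
      _ ≤ ENNReal.ofReal (Real.pi / K) * ∫⁻ s, ENNReal.ofReal c ^ 2 *
        (∑' n : ℤ, B n ^ 2 * ENNReal.ofReal (1 / w n s)
          + ENNReal.ofReal K * S ^ 2 * ENNReal.ofReal (1 / (K ^ 2 + (0 - s) ^ 2))) ∂μ := by
          refine mul_le_mul_right (lintegral_mono_ae ?_) _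
          filter_upwards [hQ, he] with s h1 h2
          refine le_trans (ENNReal.tsum_le_tsum fun n => ?_) h2
          exact mul_le_mul_right (pow_le_pow_left₀ zero_le (tsub_le_iff_right.2 (h1 n)) 2) _
      _ = ENNReal.ofReal (Real.pi / K) * (ENNReal.ofReal c ^ 2 *
          (∑' n : ℤ, B n ^ 2 * ∫⁻ s, ENNReal.ofReal (1 / w n s) ∂μ
          + ENNReal.ofReal K * S ^ 2 *
            ∫⁻ s, ENNReal.ofReal (1 / (K ^ 2 + (0 - s) ^ 2)) ∂μ)) := by
          have m1 : ∀ n : ℤ, Measurable fun s => B n ^ 2 * ENNReal.ofReal (1 / w n s) := fun n => by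
            have := mw n; fun_prop
          have m2 : ∀ n : ℤ, ∫⁻ s, B n ^ 2 * ENNReal.ofReal (1 / w n s) ∂μ
              = B n ^ 2 * ∫⁻ s, ENNReal.ofReal (1 / w n s) ∂μ := fun n =>
            lintegral_const_mul _ (by have := mw n; fun_prop)
          rw [lintegral_const_mul _ (by fun_prop), lintegral_add_left (by fun_prop),
            lintegral_tsum fun n => (m1 n).aemeasurable, lintegral_const_mul _ (by fun_prop)]
          simp_rw [m2]
      _ ≤ ENNReal.ofReal (Real.pi / K) * (ENNReal.ofReal c ^ 2 *
          (∑' n : ℤ, B n ^ 2 * ENNReal.ofReal (Real.pi / K)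
          + ENNReal.ofReal K * S ^ 2 * ENNReal.ofReal (Real.pi / K))) := by
          refine mul_le_mul_right (mul_le_mul_right (add_le_add (ENNReal.tsum_le_tsum fun n =>
            mul_le_mul_right (hinv _) _) (mul_le_mul_right (hinv _) _)) _) _
      _ = _ := by
          rw [ENNReal.tsum_mul_right, ENNReal.ofReal_mul (by positivity),
            ENNReal.ofReal_pow (by positivity), ENNReal.ofReal_pow hc]
          ring
  have lint : ∑' n : ℤ, (∫⁻ s, l n s ∂μ) ^ 2
      ≤ ENNReal.ofReal (c ^ 2 * (16384 / K)) * S ^ 2 := by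
    have : ∀ n : ℤ, (∫⁻ s, l n s ∂μ) ^ 2 ≤ (ENNReal.ofReal c * S) ^ 2 *
        (∫⁻ s, ENNReal.ofReal (1 / ((K + |s|) * (K + |2 * Real.pi * n - s|)))) ^ 2 := by
      intro n
      rw [hl, lintegral_const_mul _ (by fun_prop), mul_pow]
      exact mul_le_mul_right (pow_le_pow_left₀ zero_le (lintegral_mono' hμ le_rfl) 2) _
    refine (ENNReal.tsum_le_tsum this).trans ?_
    rw [ENNReal.tsum_mul_left]
    refine (mul_le_mul_right (tsum_lintegral_resonance_sq_le hK) _).trans (le_of_eq ?_)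
    rw [ENNReal.ofReal_mul (by positivity), ENNReal.ofReal_pow hc]
    ring
  have hsplit : ∀ n : ℤ, (∫⁻ s, Q n s ∂μ) ^ 2
      ≤ 2 * (∫⁻ s, r n s ∂μ) ^ 2 + 2 * (∫⁻ s, l n s ∂μ) ^ 2 := by
    intro n
    refine le_trans (pow_le_pow_left₀ zero_le ?_ 2) (add_sq_le_two_mul _ _)
    rw [← lintegral_add_left (mr n)]
    exact lintegral_mono fun s => le_tsub_add
  refine (ENNReal.tsum_le_tsum hsplit).trans ?_
  rw [ENNReal.tsum_add, ENNReal.tsum_mul_left, ENNReal.tsum_mul_left]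
  have two : (2 : ℝ≥0∞) = ENNReal.ofReal 2 := by simp
  have pi4 : Real.pi ^ 2 ≤ 16 := by nlinarith [Real.pi_le_four, Real.pi_pos]
  have f1 : 2 * ENNReal.ofReal ((Real.pi / K) ^ 2 * c ^ 2) ≤ ENNReal.ofReal (32 * (c / K) ^ 2) := by
    rw [two, ← ENNReal.ofReal_mul (by norm_num)]
    refine ENNReal.ofReal_le_ofReal ?_
    have : 2 * ((Real.pi / K) ^ 2 * c ^ 2) = 2 * Real.pi ^ 2 * (c / K) ^ 2 := by
      field_simp
    rw [this]; gcongr; linarith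
  have f2 : 2 * (ENNReal.ofReal (c ^ 2 * (16384 / K)) * S ^ 2)
      = ENNReal.ofReal (32768 * (c / K) ^ 2) * (ENNReal.ofReal K * S ^ 2) := by
    rw [two, ← mul_assoc, ← mul_assoc, ← ENNReal.ofReal_mul (by norm_num),
      ← ENNReal.ofReal_mul (by positivity)]
    congr 2; field_simp; ring
  calc _ ≤ 2 * (ENNReal.ofReal ((Real.pi / K) ^ 2 * c ^ 2) * (Z + ENNReal.ofReal K * S ^ 2))
        + 2 * (ENNReal.ofReal (c ^ 2 * (16384 / K)) * S ^ 2) :=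
        add_le_add (mul_le_mul_right rint _) (mul_le_mul_right lint _)
    _ ≤ ENNReal.ofReal (32 * (c / K) ^ 2) * (Z + ENNReal.ofReal K * S ^ 2)
        + ENNReal.ofReal (32768 * (c / K) ^ 2) * (Z + ENNReal.ofReal K * S ^ 2) := by
        rw [f2, ← mul_assoc]
        exact add_le_add (mul_le_mul_left f1 _) (mul_le_mul_right le_add_self _)
    _ = _ := by
        rw [← add_mul, ← ENNReal.ofReal_add (by positivity) (by positivity)]
        congr 2; ring

/-- The algebra behind the smallness condition. -/
theorem closure_algebra {K c y a σ S : ℝ} (hK : 1 ≤ K) (hc : 0 ≤ c) (hcK : c ≤ K / 1200)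
    (hy : 0 ≤ y) (hS : 0 ≤ S) (h1 : S ≤ σ + c * (S * (Real.pi / K)) + 1 / √K * y)
    (h2 : y ^ 2 ≤ 2 * a + 2 * (32800 * (c / K) ^ 2 * (y ^ 2 + K * S ^ 2))) :
    y ^ 2 ≤ 4 * a + 1049600 * c ^ 2 * σ ^ 2 := by
  have hK0 : 0 < K := zero_lt_one.trans_le hK
  have hsK : 0 < √K := Real.sqrt_pos.2 hK0
  obtain ⟨δ, hδ⟩ : ∃ δ, δ = c / K := ⟨_, rfl⟩
  have hδ0 : 0 ≤ δ := by rw [hδ]; positivity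
  have hδ1 : δ ≤ 1 / 1200 := by rw [hδ, div_le_iff₀ hK0]; linarith
  have hδ2 : δ ^ 2 ≤ (1 / 1200) ^ 2 := by gcongr
  have e1 : c * (S * (Real.pi / K)) = Real.pi * δ * S := by rw [hδ]; ring
  have e2 : Real.pi * δ * S ≤ 4 * (1 / 1200) * S := by gcongr; exact Real.pi_le_four
  rw [e1] at h1
  have h3 : S ≤ 2 * (σ + 1 / √K * y) := by
    have : 0 ≤ 1 / √K * y := by positivity
    linarith
  have h4 : K * S ^ 2 ≤ 8 * (K * σ ^ 2 + y ^ 2) := by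
    have e : K * (1 / √K * y) ^ 2 = y ^ 2 := by
      rw [mul_pow, div_pow, Real.sq_sqrt hK0.le]; field_simp
    calc K * S ^ 2 ≤ K * (2 * (σ + 1 / √K * y)) ^ 2 := by gcongr
      _ ≤ K * (8 * (σ ^ 2 + (1 / √K * y) ^ 2)) := by
        gcongr; nlinarith [sq_nonneg (σ - 1 / √K * y)]
      _ = _ := by rw [← e]; ring
  rw [← hδ] at h2
  have h5 : δ ^ 2 * (y ^ 2 + K * S ^ 2) ≤ δ ^ 2 * (9 * y ^ 2 + 8 * (K * σ ^ 2)) := by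
    exact mul_le_mul_of_nonneg_left (by linarith) (sq_nonneg δ)
  have h6 : δ ^ 2 * y ^ 2 ≤ (1 / 1200) ^ 2 * y ^ 2 := by gcongr
  have h7 : δ ^ 2 * (K * σ ^ 2) ≤ c ^ 2 * σ ^ 2 := by
    have : δ ^ 2 * K ≤ c ^ 2 := by
      rw [hδ, div_pow, div_mul_eq_mul_div, div_le_iff₀ (by positivity)]
      gcongr; nlinarith
    calc _ = (δ ^ 2 * K) * σ ^ 2 := by ring
      _ ≤ _ := by gcongr
  nlinarith

/-- A closed system of inequalities on a bounded time interval, with a bound that does not depend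
on the length of the interval. All quantities are norms: `V` of the Fourier coefficients of the second
derivative of the vorticity, `S` of its boundary data, `Q` and `x` of their time derivatives. -/
theorem tsum_sq_le_of_closure (hK : 1 ≤ K) (hc : 0 ≤ c) (hcK : c ≤ K / 1200) [IsFiniteMeasure μ]
    (hμ : μ ≤ volume) (mQ : ∀ n, Measurable (Q n)) {V : ℤ → ℝ → ℝ≥0∞} {a : ℤ → ℝ≥0∞}
    {x S : ℝ → ℝ≥0∞} {σ M : ℝ≥0∞} (hM : M ≠ ⊤) (hσ : σ ≠ ⊤) (ha : ∑' n, a n ^ 2 ≠ ⊤)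
    (hQM : ∀ᵐ s ∂μ, ∑' n, Q n s ^ 2 ≤ M) (hxM : ∀ᵐ s ∂μ, x s ≤ M)
    (hV : ∀ᵐ s ∂μ, ∀ n, V n s ≤ a n + ∫⁻ s, Q n s ∂μ)
    (hS : ∀ᵐ s ∂μ, S s ≤ σ + ∫⁻ s, x s ∂μ
      + ENNReal.ofReal (1 / √K) * (∑' n, V n s ^ 2) ^ (1 / 2 : ℝ))
    (hx : ∀ᵐ s ∂μ, x s ≤ ENNReal.ofReal c * (S s * ENNReal.ofReal (1 / (K ^ 2 + (0 - s) ^ 2))))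
    (hQ : ∀ᵐ s ∂μ, ∀ n, Q n s ≤ e n s + ENNReal.ofReal c * S s *
      ENNReal.ofReal (1 / ((K + |s|) * (K + |2 * Real.pi * n - s|))))
    (he : ∀ᵐ s ∂μ, ∑' n : ℤ, ENNReal.ofReal (K ^ 2 + (2 * Real.pi * n - s) ^ 2) * e n s ^ 2
      ≤ ENNReal.ofReal c ^ 2 *
        (∑' n : ℤ, V n s ^ 2 * ENNReal.ofReal (1 / (K ^ 2 + (2 * Real.pi * n - s) ^ 2))
          + ENNReal.ofReal K * S s ^ 2 * ENNReal.ofReal (1 / (K ^ 2 + (0 - s) ^ 2)))) :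
    ∑' n : ℤ, (a n + ∫⁻ s, Q n s ∂μ) ^ 2
      ≤ 4 * ∑' n, a n ^ 2 + ENNReal.ofReal (1049600 * c ^ 2) * σ ^ 2 := by
  have hK0 : 0 < K := zero_lt_one.trans_le hK
  have hsK : 0 < √K := Real.sqrt_pos.2 hK0
  set B : ℤ → ℝ≥0∞ := fun n => a n + ∫⁻ s, Q n s ∂μ with hB
  -- finiteness
  have fQ : ∑' n : ℤ, (∫⁻ s, Q n s ∂μ) ^ 2 ≠ ⊤ := by
    have h1 : ∀ n, (∫⁻ s, Q n s ∂μ) ^ 2 ≤ μ univ * ∫⁻ s, Q n s ^ 2 ∂μ := fun n => by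
      have := sq_lintegral_le μ (w := fun _ => 1) (fun _ => one_pos) measurable_const
        (mQ n).aemeasurable
      simpa using this
    refine ne_top_of_le_ne_top ?_ (ENNReal.tsum_le_tsum h1)
    rw [ENNReal.tsum_mul_left, ← lintegral_tsum fun n => by have := mQ n; fun_prop]
    refine ENNReal.mul_ne_top (measure_ne_top _ _)
      (ne_top_of_le_ne_top ?_ (lintegral_mono_ae hQM))
    rw [lintegral_const]
    exact ENNReal.mul_ne_top hM (measure_ne_top _ _)
  have hB2 : ∑' n, B n ^ 2 ≤ 2 * ∑' n, a n ^ 2 + 2 * ∑' n : ℤ, (∫⁻ s, Q n s ∂μ) ^ 2 := by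
    refine (ENNReal.tsum_le_tsum fun n => add_sq_le_two_mul _ _).trans ?_
    rw [ENNReal.tsum_add, ENNReal.tsum_mul_left, ENNReal.tsum_mul_left]
  have fB : ∑' n, B n ^ 2 ≠ ⊤ := ne_top_of_le_ne_top (ENNReal.add_ne_top.2
    ⟨ENNReal.mul_ne_top (by norm_num) ha, ENNReal.mul_ne_top (by norm_num) fQ⟩) hB2
  have fx : ∫⁻ s, x s ∂μ ≠ ⊤ := by
    refine ne_top_of_le_ne_top ?_ (lintegral_mono_ae hxM)
    rw [lintegral_const]
    exact ENNReal.mul_ne_top hM (measure_ne_top _ _)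
  -- the suprema over the interval
  obtain ⟨Y, hY⟩ : ∃ Y, Y = (∑' n, B n ^ 2) ^ (1 / 2 : ℝ) := ⟨_, rfl⟩
  have hY2 : ∑' n, B n ^ 2 = Y ^ 2 := by
    rw [hY, ← ENNReal.rpow_two, ← ENNReal.rpow_mul]; norm_num
  have fY : Y ≠ ⊤ := by rw [hY]; exact ENNReal.rpow_ne_top_of_nonneg (by norm_num) fB
  obtain ⟨S', hS'⟩ : ∃ S', S' = σ + ∫⁻ s, x s ∂μ + ENNReal.ofReal (1 / √K) * Y := ⟨_, rfl⟩
  have fS : S' ≠ ⊤ := by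
    rw [hS']
    exact ENNReal.add_ne_top.2 ⟨ENNReal.add_ne_top.2 ⟨hσ, fx⟩,
      ENNReal.mul_ne_top ENNReal.ofReal_ne_top fY⟩
  have hVB : ∀ᵐ s ∂μ, ∑' n, V n s ^ 2 ≤ ∑' n, B n ^ 2 := hV.mono fun s hs =>
    ENNReal.tsum_le_tsum fun n => pow_le_pow_left₀ zero_le (hs n) 2
  have hSS : ∀ᵐ s ∂μ, S s ≤ S' := by
    filter_upwards [hS, hVB] with s h1 h2
    rw [hS', hY]
    exact h1.trans (add_le_add le_rfl (mul_le_mul_right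
      (ENNReal.rpow_le_rpow h2 (by norm_num)) _))
  have key := tsum_sq_lintegral_le (e := e) (B := B) (S := S') hK hc hμ mQ
    (by
      filter_upwards [hQ, hSS] with s h1 h2 n
      exact (h1 n).trans (add_le_add le_rfl (mul_le_mul_left (mul_le_mul_right h2 _) _)))
    (by
      filter_upwards [he, hSS, hV] with s h1 h2 h3
      refine h1.trans (mul_le_mul_right (add_le_add (ENNReal.tsum_le_tsum fun n =>
        mul_le_mul_left (pow_le_pow_left₀ zero_le (h3 n) 2) _) (mul_le_mul_left
          (mul_le_mul_right (pow_le_pow_left₀ zero_le h2 2) _) _)) _))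
  have hX : ∫⁻ s, x s ∂μ ≤ ENNReal.ofReal c * (S' * ENNReal.ofReal (Real.pi / K)) := by
    calc ∫⁻ s, x s ∂μ
        ≤ ∫⁻ s, ENNReal.ofReal c * (S' * ENNReal.ofReal (1 / (K ^ 2 + (0 - s) ^ 2))) ∂μ := by
          refine lintegral_mono_ae ?_
          filter_upwards [hx, hSS] with s h1 h2
          exact h1.trans (mul_le_mul_right (mul_le_mul_left h2 _) _)
      _ = ENNReal.ofReal c * (S' * ∫⁻ s, ENNReal.ofReal (1 / (K ^ 2 + (0 - s) ^ 2)) ∂μ) := by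
          rw [lintegral_const_mul _ (by fun_prop), lintegral_const_mul _ (by fun_prop)]
      _ ≤ _ := by
          refine mul_le_mul_right (mul_le_mul_right ?_ _) _
          exact (lintegral_mono' hμ le_rfl).trans_eq (lintegral_inv_sq_add_sq hK0 0)
  have i1 : S' ≤ σ + ENNReal.ofReal c * (S' * ENNReal.ofReal (Real.pi / K))
      + ENNReal.ofReal (1 / √K) * Y := by
    conv_lhs => rw [hS']
    gcongr
  have i2 : Y ^ 2 ≤ 2 * ∑' n, a n ^ 2 + 2 * (ENNReal.ofReal (32800 * (c / K) ^ 2)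
      * (Y ^ 2 + ENNReal.ofReal K * S' ^ 2)) := by
    rw [← hY2]
    exact hB2.trans (add_le_add le_rfl (mul_le_mul_right key _))
  rw [hY2]
  obtain ⟨y, hy, rfl⟩ : ∃ y, 0 ≤ y ∧ Y = ENNReal.ofReal y :=
    ⟨_, ENNReal.toReal_nonneg, (ENNReal.ofReal_toReal fY).symm⟩
  obtain ⟨t, ht, rfl⟩ : ∃ y, 0 ≤ y ∧ S' = ENNReal.ofReal y :=
    ⟨_, ENNReal.toReal_nonneg, (ENNReal.ofReal_toReal fS).symm⟩
  obtain ⟨σ', hσ', rfl⟩ : ∃ y, 0 ≤ y ∧ σ = ENNReal.ofReal y :=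
    ⟨_, ENNReal.toReal_nonneg, (ENNReal.ofReal_toReal hσ).symm⟩
  obtain ⟨α, hα, eα⟩ : ∃ y, 0 ≤ y ∧ ∑' n, a n ^ 2 = ENNReal.ofReal y :=
    ⟨_, ENNReal.toReal_nonneg, (ENNReal.ofReal_toReal ha).symm⟩
  have two : (2 : ℝ≥0∞) = ENNReal.ofReal 2 := by simp
  have four : (4 : ℝ≥0∞) = ENNReal.ofReal 4 := by simp
  have hδ : 0 ≤ (c / K) ^ 2 := by positivity
  rw [eα, two, ← ENNReal.ofReal_pow hy, ← ENNReal.ofReal_pow ht, ← ENNReal.ofReal_mul hK0.le,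
    ← ENNReal.ofReal_add (by positivity) (by positivity), ← ENNReal.ofReal_mul (by positivity),
    ← ENNReal.ofReal_mul (by positivity), ← ENNReal.ofReal_mul (by positivity),
    ← ENNReal.ofReal_add (by positivity) (by positivity),
    ENNReal.ofReal_le_ofReal_iff (by positivity)] at i2
  rw [← ENNReal.ofReal_mul (by positivity), ← ENNReal.ofReal_mul (by positivity),
    ← ENNReal.ofReal_mul (by positivity),
    ← ENNReal.ofReal_add (by positivity) (by positivity),
    ← ENNReal.ofReal_add (by positivity) (by positivity),
    ENNReal.ofReal_le_ofReal_iff (by positivity)] at i1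
  rw [eα, four, ← ENNReal.ofReal_pow hy, ← ENNReal.ofReal_pow hσ',
    ← ENNReal.ofReal_mul (by positivity), ← ENNReal.ofReal_mul (by positivity),
    ← ENNReal.ofReal_add (by positivity) (by positivity)]
  exact ENNReal.ofReal_le_ofReal (closure_algebra hK hc hcK hy ht i1 i2)

end closure

end FiniteChannel

namespace FiniteChannel

/-! ### Weak derivatives and primitives -/

/-- `φ` is a test function on `(0,1)`. -/
structure IsTest (φ : ℝ → ℝ) : Prop where
  contDiff : ContDiff ℝ ∞ φ
  compact : HasCompactSupport φ
  tsupport_subset : tsupport φ ⊆ Ioo (0 : ℝ) 1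

namespace IsTest

variable {φ : ℝ → ℝ}

theorem eq_zero (h : IsTest φ) {x : ℝ} (hx : x ∉ Ioo (0 : ℝ) 1) : φ x = 0 :=
  image_eq_zero_of_notMem_tsupport fun hx' => hx (h.tsupport_subset hx')

theorem deriv (h : IsTest φ) : IsTest (deriv φ) where
  contDiff := (contDiff_infty_iff_deriv.1 h.contDiff).2
  compact := h.compact.deriv
  tsupport_subset := tsupport_deriv_subset.trans h.tsupport_subset

theorem isPrimitive (h : IsTest φ) :
    IsPrimitive (fun y => (φ y : ℂ)) (fun y => ((_root_.deriv φ y : ℝ) : ℂ)) :=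
  .of_hasDerivAt (fun y _ => ((h.contDiff.differentiable (by simp)) y).hasDerivAt.ofReal_comp)
    (Complex.continuous_ofReal.comp h.deriv.contDiff.continuous).continuousOn

theorem integrable_smul {E : Type*} [NormedAddCommGroup E] [NormedSpace ℝ E] (h : IsTest φ)
    {u : ℝ → E} (hu : LocallyIntegrableOn u (Ioo (0 : ℝ) 1)) :
    Integrable (fun y => φ y • u y) unitVol := by
  have hi : IntegrableOn u (tsupport φ) := hu.integrableOn_compact_subset h.tsupport_subset h.compact
  have h2 : Integrable (fun y => φ y • u y) := by
    have : IntegrableOn (fun y => φ y • u y) (tsupport φ) :=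
      hi.continuousOn_smul h.contDiff.continuous.continuousOn h.compact
    refine (integrableOn_iff_integrable_of_support_subset ?_).1 this
    intro y hy
    by_contra hy'
    exact hy (by simp [image_eq_zero_of_notMem_tsupport hy'])
  exact h2.restrict

theorem sub_const_mul {φ' : ℝ → ℝ} (h : IsTest φ) (h' : IsTest φ') (a : ℝ) :
    IsTest (fun y => φ y - a * φ' y) where
  contDiff := h.contDiff.sub (contDiff_const.mul h'.contDiff)
  compact := h.compact.sub h'.compact.mul_left
  tsupport_subset := by
    refine (closure_mono ?_).trans (closure_union.subset.trans
      (union_subset h.tsupport_subset h'.tsupport_subset))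
    intro y hy
    by_contra hy'
    simp only [mem_union, Function.mem_support, not_or, not_not] at hy'
    exact hy (by simp [hy'.1, hy'.2])

/-- A test function of zero mean is the derivative of a test function. -/
theorem exists_deriv_eq (h : IsTest φ) (h0 : ∫ y, φ y ∂unitVol = 0) :
    ∃ χ, IsTest χ ∧ _root_.deriv χ = φ := by
  obtain ⟨a, b, ha, hb, hab⟩ : ∃ a b : ℝ, 0 < a ∧ b < 1 ∧ tsupport φ ⊆ Icc a b := by
    rcases (tsupport φ).eq_empty_or_nonempty with he | hne
    · exact ⟨1 / 2, 1 / 2, by norm_num, by norm_num, by simp [he]⟩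
    · obtain ⟨a, ha, ha'⟩ := h.compact.exists_isLeast hne
      obtain ⟨b, hb, hb'⟩ := h.compact.exists_isGreatest hne
      exact ⟨a, b, (h.tsupport_subset ha).1, (h.tsupport_subset hb).2,
        fun y hy => ⟨ha' hy, hb' hy⟩⟩
  have hz : ∀ x, x ∉ Icc a b → φ x = 0 := fun x hx =>
    image_eq_zero_of_notMem_tsupport fun hx' => hx (hab hx')
  have hc := h.contDiff.continuous
  have hd : ∀ x, HasDerivAt (fun x => ∫ s in (0 : ℝ)..x, φ s) (φ x) x := fun x =>
    intervalIntegral.integral_hasDerivAt_right (hc.intervalIntegrable _ _)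
      hc.stronglyMeasurable.stronglyMeasurableAtFilter hc.continuousAt
  have hde : _root_.deriv (fun x => ∫ s in (0 : ℝ)..x, φ s) = φ := funext fun x => (hd x).deriv
  have hsupp : Function.support (fun x => ∫ s in (0 : ℝ)..x, φ s) ⊆ Icc a b := by
    intro x hx
    by_contra hx'
    refine hx ?_
    change ∫ s in (0 : ℝ)..x, φ s = 0
    simp only [mem_Icc, not_and_or, not_le] at hx'
    rcases hx' with hx' | hx'
    · rw [intervalIntegral.integral_congr (g := fun _ => (0 : ℝ)) fun s hs => ?_]
      · simp
      · refine hz s fun hs' => ?_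
        have : s ≤ max 0 x := hs.2
        exact absurd (hs'.1.trans this) (not_le.2 (max_lt ha hx'))
    · have e1 : ∫ s in (0 : ℝ)..1, φ s = 0 := by
        rw [intervalIntegral.integral_of_le zero_le_one, ← unitVol_eq_restrict_Ioc, h0]
      have e2 : ∫ s in x..1, φ s = 0 := by
        rw [intervalIntegral.integral_congr (g := fun _ => (0 : ℝ)) fun s hs => ?_]
        · simp
        · refine hz s fun hs' => ?_
          have : min x 1 ≤ s := hs.1
          exact absurd (this.trans hs'.2) (not_le.2 (lt_min hx' hb))
      have := intervalIntegral.integral_add_adjacent_intervals (hc.intervalIntegrable 0 x)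
        (hc.intervalIntegrable (μ := volume) x 1)
      rw [e1, e2, add_zero] at this
      exact this
  have hts : tsupport (fun x => ∫ s in (0 : ℝ)..x, φ s) ⊆ Icc a b :=
    closure_minimal hsupp isClosed_Icc
  refine ⟨_, ⟨?_, ?_, hts.trans fun y hy => ⟨ha.trans_le hy.1, hy.2.trans_lt hb⟩⟩, hde⟩
  · rw [contDiff_infty_iff_deriv, hde]
    exact ⟨fun x => (hd x).differentiableAt, h.contDiff⟩
  · exact isCompact_Icc.of_isClosed_subset (isClosed_tsupport _) hts

end IsTest

theorem exists_isTest_integral_eq_one : ∃ φ, IsTest φ ∧ ∫ y, φ y ∂unitVol = 1 := by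
  obtain ⟨f, h1, h2, h3, h4, h5⟩ := exists_contDiff_tsupport_subset (n := ⊤)
    (isOpen_Ioo.mem_nhds (by norm_num : (1 / 2 : ℝ) ∈ Ioo (0 : ℝ) 1))
  have hf : IsTest f := ⟨h3, h2, h1⟩
  have e : ∫ y, f y ∂unitVol = ∫ y, f y := setIntegral_eq_integral_of_forall_compl_eq_zero
    fun y hy => hf.eq_zero hy
  have hpos : 0 < ∫ y, f y := h3.continuous.integral_pos_of_hasCompactSupport_nonneg_nonzero h2
    (fun y => (h4 (mem_range_self y)).1) (x := 1 / 2) (by rw [h5]; exact one_ne_zero)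
  refine ⟨fun y => 0 - (-(∫ y, f y)⁻¹) * f y, ?_, ?_⟩
  · refine IsTest.sub_const_mul (φ := fun _ => 0) ⟨contDiff_const, HasCompactSupport.zero, ?_⟩ hf _
    have : tsupport (fun _ : ℝ => (0 : ℝ)) = ∅ := tsupport_eq_empty_iff.2 rfl
    rw [this]; exact empty_subset _
  · simp only [zero_sub, neg_mul, neg_neg]
    rw [integral_const_mul, e, inv_mul_cancel₀ hpos.ne']

section general

theorem locallyIntegrableOn_congr {E : Type*} [NormedAddCommGroup E] {u u' : ℝ → E}
    (h : LocallyIntegrableOn u (Ioo (0 : ℝ) 1))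
    (e : u =ᵐ[unitVol] u') : LocallyIntegrableOn u' (Ioo (0 : ℝ) 1) := by
  intro x hx
  obtain ⟨s, hs, hi⟩ := h x hx
  refine ⟨s ∩ Ioo 0 1, Filter.inter_mem hs self_mem_nhdsWithin, ?_⟩
  exact (hi.mono_set inter_subset_left).congr
    (ae_mono (Measure.restrict_mono inter_subset_right le_rfl) e)

variable {E : Type*} [NormedAddCommGroup E] [NormedSpace ℝ E] {u u' v v' : ℝ → E}

theorem IsWeakDeriv.congr (h : IsWeakDeriv u v) (e : u =ᵐ[unitVol] u') (e' : v =ᵐ[unitVol] v') :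
    IsWeakDeriv u' v' where
  left := locallyIntegrableOn_congr h.left e
  right := locallyIntegrableOn_congr h.right e'
  integral_eq φ h1 h2 h3 := by
    have := h.integral_eq φ h1 h2 h3
    have e1 : ∫ y, deriv φ y • u y ∂unitVol = ∫ y, deriv φ y • u' y ∂unitVol :=
      integral_congr_ae (e.mono fun y hy => by simp only [hy])
    have e2 : ∫ y, φ y • v y ∂unitVol = ∫ y, φ y • v' y ∂unitVol :=
      integral_congr_ae (e'.mono fun y hy => by simp only [hy])
    exact e1.symm.trans (this.trans (congrArg _ e2))

theorem ae_eq_zero_of_integral_test [CompleteSpace E]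
    (hu : LocallyIntegrableOn u (Ioo (0 : ℝ) 1))
    (h : ∀ φ, IsTest φ → ∫ y, φ y • u y ∂unitVol = 0) : u =ᵐ[unitVol] 0 := by
  refine ae_unitVol_iff.2 (isOpen_Ioo.ae_eq_zero_of_integral_contDiff_smul_eq_zero hu ?_)
  intro φ h1 h2 h3
  rw [← h φ ⟨h1, h2, h3⟩]
  exact (setIntegral_eq_integral_of_forall_compl_eq_zero fun y hy => by
    rw [IsTest.eq_zero ⟨h1, h2, h3⟩ hy, zero_smul]).symm

theorem IsWeakDeriv.ae_eq [CompleteSpace E] (h : IsWeakDeriv u v) (h' : IsWeakDeriv u' v')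
    (e : u =ᵐ[unitVol] u') : v =ᵐ[unitVol] v' := by
  have h1 : (fun y => v y - v' y) =ᵐ[unitVol] 0 := by
    refine ae_eq_zero_of_integral_test (h.right.sub h'.right) fun φ hφ => ?_
    have h2 := h.integral_eq φ hφ.contDiff hφ.compact hφ.tsupport_subset
    have h3 := h'.integral_eq φ hφ.contDiff hφ.compact hφ.tsupport_subset
    have h4 : ∫ y, deriv φ y • u y ∂unitVol = ∫ y, deriv φ y • u' y ∂unitVol :=
      integral_congr_ae (e.mono fun y hy => by simp only [hy])
    simp_rw [smul_sub]
    rw [integral_sub (hφ.integrable_smul h.right) (hφ.integrable_smul h'.right), sub_eq_zero]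
    exact neg_injective (h2.symm.trans (h4.trans h3))
  exact h1.mono fun y hy => sub_eq_zero.1 hy

theorem isWeakDeriv_weakDeriv (h : ∃ v, IsWeakDeriv u v) : IsWeakDeriv u (weakDeriv u) := by
  rw [weakDeriv, dif_pos h]; exact h.choose_spec

theorem IsWeakDeriv.weakDeriv_ae_eq [CompleteSpace E] (h : IsWeakDeriv u v) :
    weakDeriv u =ᵐ[unitVol] v :=
  (isWeakDeriv_weakDeriv ⟨v, h⟩).ae_eq h (ae_eq_refl _)

end general

theorem IsPrimitive.isWeakDeriv {u u' : ℝ → ℂ} (h : IsPrimitive u u') : IsWeakDeriv u u' where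
  left := IntegrableOn.locallyIntegrableOn (integrable_of_continuousOn h.continuousOn)
  right := IntegrableOn.locallyIntegrableOn h.integrable
  integral_eq φ h1 h2 h3 := by
    have hφ : IsTest φ := ⟨h1, h2, h3⟩
    have h4 := hφ.isPrimitive.integral_mul_eq h
    rw [hφ.eq_zero (by simp), hφ.eq_zero (by simp), Complex.ofReal_zero, zero_mul, zero_mul,
      sub_zero] at h4
    have i1 := hφ.deriv.integrable_smul
      (IntegrableOn.locallyIntegrableOn (integrable_of_continuousOn h.continuousOn))
    have i2 := hφ.integrable_smul (IntegrableOn.locallyIntegrableOn h.integrable)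
    simp only [Complex.real_smul] at i1 i2 ⊢
    rw [integral_add i1 i2] at h4
    exact eq_neg_of_add_eq_zero_left h4

theorem IsPrimitive.ae_eq {u u' v v' : ℝ → ℂ} (h : IsPrimitive u u') (h' : IsPrimitive v v')
    (e : u =ᵐ[unitVol] v) : u' =ᵐ[unitVol] v' :=
  h.isWeakDeriv.ae_eq h'.isWeakDeriv e

/-- The lemma of du Bois-Reymond. -/
theorem exists_ae_eq_const {d : ℝ → ℂ} (hd : IsWeakDeriv d 0) :
    ∃ a : ℂ, d =ᵐ[unitVol] fun _ => a := by
  obtain ⟨ψ, hψ, h1⟩ := exists_isTest_integral_eq_one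
  refine ⟨∫ y, ψ y • d y ∂unitVol, ?_⟩
  set a := ∫ y, ψ y • d y ∂unitVol with ha
  have hc : LocallyIntegrableOn (fun _ : ℝ => a) (Ioo (0 : ℝ) 1) :=
    (continuous_const.locallyIntegrable).locallyIntegrableOn _
  have h2 : (fun y => d y - a) =ᵐ[unitVol] 0 := by
    refine ae_eq_zero_of_integral_test (hd.left.sub hc) fun φ hφ => ?_
    set b := ∫ y, φ y ∂unitVol with hb
    have iφ : Integrable φ unitVol := hφ.contDiff.continuous.continuousOn.integrableOn_Icc.mono_set
      Ioo_subset_Icc_self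
    have iψ : Integrable ψ unitVol := hψ.contDiff.continuous.continuousOn.integrableOn_Icc.mono_set
      Ioo_subset_Icc_self
    obtain ⟨χ, hχ, eχ⟩ := (hφ.sub_const_mul hψ b).exists_deriv_eq (by
      rw [integral_sub iφ (iψ.const_mul b), integral_const_mul, h1, mul_one, sub_self])
    have h3 := hd.integral_eq χ hχ.contDiff hχ.compact hχ.tsupport_subset
    have jφ := hφ.integrable_smul hd.left
    have jψ := hψ.integrable_smul hd.left
    have h4 : ∫ y, (φ y • d y - (b : ℂ) * ψ y • d y) ∂unitVol = 0 := by
      rw [eχ] at h3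
      simp only [Pi.zero_apply, smul_zero, integral_zero, neg_zero] at h3
      rw [← h3]
      refine integral_congr_ae (Filter.Eventually.of_forall fun y => ?_)
      simp only [Complex.real_smul]; push_cast; ring
    rw [integral_sub jφ (jψ.const_mul _), integral_const_mul, ← ha] at h4
    simp_rw [smul_sub]
    rw [integral_sub jφ (hφ.integrable_smul hc), integral_smul_const, ← hb, Complex.real_smul]
    exact h4
  exact h2.mono fun y hy => sub_eq_zero.1 hy

/-- A function with an integrable weak derivative has an absolutely continuous representative. -/
theorem IsWeakDeriv.exists_isPrimitive {u v : ℝ → ℂ} (h : IsWeakDeriv u v)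
    (hv : Integrable v unitVol) : ∃ U, IsPrimitive U v ∧ u =ᵐ[unitVol] U := by
  have hV : IsPrimitive (fun y => ∫ s in (0 : ℝ)..y, v s) v := ⟨hv, fun y _ => by simp⟩
  have hVw := hV.isWeakDeriv
  have hd : IsWeakDeriv (fun y => u y - ∫ s in (0 : ℝ)..y, v s) 0 := by
    refine ⟨h.left.sub hVw.left, ?_, fun φ h1 h2 h3 => ?_⟩
    · exact (continuous_const (y := (0 : ℂ))).locallyIntegrable.locallyIntegrableOn _
    · have hφ : IsTest φ := ⟨h1, h2, h3⟩
      simp_rw [smul_sub]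
      rw [integral_sub (hφ.deriv.integrable_smul h.left) (hφ.deriv.integrable_smul hVw.left),
        h.integral_eq φ h1 h2 h3, hVw.integral_eq φ h1 h2 h3]
      simp
  obtain ⟨a, ha⟩ := exists_ae_eq_const hd
  refine ⟨fun y => a + ∫ s in (0 : ℝ)..y, v s, ?_, ha.mono fun y hy => ?_⟩
  · exact ((IsPrimitive.const a).add hV).congr (fun _ _ => rfl)
      (Filter.Eventually.of_forall fun y => by simp)
  · simp only at hy ⊢
    rw [← hy]; ring

theorem IsWeakDeriv.ofReal {u v : ℝ → ℝ} (h : IsWeakDeriv u v) :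
    IsWeakDeriv (fun y => (u y : ℂ)) (fun y => (v y : ℂ)) where
  left := by
    intro x hx
    obtain ⟨s, hs, hi⟩ := h.left x hx
    exact ⟨s, hs, hi.ofReal⟩
  right := by
    intro x hx
    obtain ⟨s, hs, hi⟩ := h.right x hx
    exact ⟨s, hs, hi.ofReal⟩
  integral_eq φ h1 h2 h3 := by
    have := congrArg (fun x : ℝ => (x : ℂ)) (h.integral_eq φ h1 h2 h3)
    simp only [Complex.ofReal_neg, ← integral_complex_ofReal, smul_eq_mul, Complex.ofReal_mul]
      at this
    simpa only [Complex.real_smul] using this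

/-! ### Pointwise bounds from almost everywhere bounds -/

theorem forall_mem_of_ae_mem {p : ℝ → ℝ} (hp : ContinuousOn p (Icc 0 1)) {s : Set ℝ} (hs : IsClosed s)
    (h : ∀ᵐ y ∂unitVol, p y ∈ s) : ∀ y ∈ Icc (0 : ℝ) 1, p y ∈ s := by
  have h1 : ∀ y ∈ Ioo (0 : ℝ) 1, p y ∈ s := by
    intro y hy
    by_contra hy'
    have hc : ContinuousAt p y := hp.continuousAt (Icc_mem_nhds hy.1 hy.2)
    have h2 : ∀ᶠ x in nhds y, x ∈ Ioo (0 : ℝ) 1 ∧ p x ∉ s :=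
      Filter.Eventually.and (isOpen_Ioo.mem_nhds hy) (hc.eventually (hs.isOpen_compl.mem_nhds hy'))
    obtain ⟨t, ht, hto, hyt⟩ := mem_nhds_iff.1 h2
    have h3 : volume t = 0 := by
      refine measure_mono_null (fun x hx => ?_) (ae_unitVol_iff.1 h)
      simp only [mem_compl_iff, mem_ofPred_eq, Classical.not_imp]
      exact ht hx
    exact (hto.measure_pos volume ⟨y, hyt⟩).ne' h3
  have h2 : closure (Ioo (0 : ℝ) 1) = Icc 0 1 := closure_Ioo zero_ne_one
  intro y hy
  have h3 : p y ∈ closure (p '' Ioo 0 1) :=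
    (h2 ▸ hp).image_closure ⟨y, h2 ▸ hy, rfl⟩
  exact hs.closure_subset_iff.2 (image_subset_iff.2 h1) h3

theorem norm_le_of_ae {u : ℝ → ℂ} (hu : ContinuousOn u (Icc 0 1)) {m : ℝ}
    (h : ∀ᵐ y ∂unitVol, ‖u y‖ ≤ m) : ∀ y ∈ Icc (0 : ℝ) 1, ‖u y‖ ≤ m :=
  forall_mem_of_ae_mem hu.norm isClosed_Iic h

theorem eqOn_of_ae {u v : ℝ → ℂ} (hu : ContinuousOn u (Icc 0 1)) (hv : ContinuousOn v (Icc 0 1))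
    (h : u =ᵐ[unitVol] v) : ∀ y ∈ Icc (0 : ℝ) 1, u y = v y := by
  intro y hy
  have := norm_le_of_ae (hu.sub hv) (m := 0) (h.mono fun x hx => by simp [hx]) y hy
  exact sub_eq_zero.1 (norm_le_zero_iff.1 this)

end FiniteChannel

namespace FiniteChannel

/-! ### The Dirichlet problem for the second derivative -/

section green

variable {W W₁ v w : ℝ → ℂ}

namespace IsProfile

theorem deriv_zero_eq (hW : IsProfile W W₁ v) : W₁ 0 = ∫ y, (y - 1) * v y ∂unitVol := by
  have h : IsPrimitive (fun y : ℝ => (y : ℂ) - 1) (fun _ => 1) :=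
    .of_hasDerivAt (fun y _ => ((hasDerivAt_id y).ofReal_comp).sub_const 1) continuousOn_const
  have h1 := h.integral_mul_eq hW.prim₁
  have i1 : Integrable (fun y => 1 * W₁ y) unitVol := by simpa using hW.prim.integrable
  have i2 : Integrable (fun y : ℝ => ((y : ℂ) - 1) * v y) unitVol :=
    (memLp_mul_continuousOn hW.memLp h.continuousOn).integrable (by norm_num)
  rw [integral_add i1 i2] at h1
  simp only [one_mul] at h1
  rw [hW.prim.integral_eq_sub, hW.one, hW.zero] at h1
  simp only [Complex.ofReal_one, Complex.ofReal_zero] at h1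
  linear_combination -h1

theorem deriv_one_eq (hW : IsProfile W W₁ v) : W₁ 1 = ∫ y, y * v y ∂unitVol := by
  have h : IsPrimitive (fun y : ℝ => (y : ℂ)) (fun _ => 1) :=
    .of_hasDerivAt (fun y _ => (hasDerivAt_id y).ofReal_comp) continuousOn_const
  have h1 := h.integral_mul_eq hW.prim₁
  have i1 : Integrable (fun y => 1 * W₁ y) unitVol := by simpa using hW.prim.integrable
  have i2 : Integrable (fun y : ℝ => (y : ℂ) * v y) unitVol :=
    (memLp_mul_continuousOn hW.memLp h.continuousOn).integrable (by norm_num)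
  rw [integral_add i1 i2] at h1
  simp only [one_mul] at h1
  rw [hW.prim.integral_eq_sub, hW.one, hW.zero] at h1
  simp only [Complex.ofReal_one, Complex.ofReal_zero] at h1
  linear_combination -h1

theorem congr (hW : IsProfile W W₁ v) (h : v =ᵐ[unitVol] w) : IsProfile W W₁ w :=
  ⟨hW.prim, hW.prim₁.congr (fun _ _ => rfl) h, hW.memLp.ae_eq h, hW.zero, hW.one⟩

theorem add {V V₁ : ℝ → ℂ} (hW : IsProfile W W₁ v) (hV : IsProfile V V₁ w) :
    IsProfile (fun y => W y + V y) (fun y => W₁ y + V₁ y) (fun y => v y + w y) :=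
  ⟨hW.prim.add hV.prim, hW.prim₁.add hV.prim₁, hW.memLp.add hV.memLp,
    by simp [hW.zero, hV.zero], by simp [hW.one, hV.one]⟩

theorem const_mul (hW : IsProfile W W₁ v) (a : ℂ) :
    IsProfile (fun y => a * W y) (fun y => a * W₁ y) (fun y => a * v y) :=
  ⟨hW.prim.const_mul a, hW.prim₁.const_mul a, hW.memLp.const_mul a, by simp [hW.zero],
    by simp [hW.one]⟩

end IsProfile

/-- The derivative of `green v`. -/
noncomputable def greenDeriv (v : ℝ → ℂ) (y : ℝ) : ℂ :=
  (∫ s, (s - 1) * v s ∂unitVol) + ∫ s in (0 : ℝ)..y, v s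

/-- The solution of `u'' = v` with `u = 0` at `0` and `1`. -/
noncomputable def green (v : ℝ → ℂ) (y : ℝ) : ℂ := ∫ s in (0 : ℝ)..y, greenDeriv v s

theorem isProfile_green (hv : MemLp v 2 unitVol) : IsProfile (green v) (greenDeriv v) v := by
  have h1 : IsPrimitive (greenDeriv v) v := ⟨hv.integrable (by norm_num), fun y _ => by
    simp [greenDeriv]⟩
  have h2 : IsPrimitive (green v) (greenDeriv v) :=
    ⟨integrable_of_continuousOn h1.continuousOn, fun y _ => by simp [green]⟩
  refine ⟨h2, h1, hv, by simp [green], ?_⟩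
  have h : IsPrimitive (fun y : ℝ => (y : ℂ) - 1) (fun _ => 1) :=
    .of_hasDerivAt (fun y _ => ((hasDerivAt_id y).ofReal_comp).sub_const 1) continuousOn_const
  have h3 := h.integral_mul_eq h1
  have i1 : Integrable (fun y => 1 * greenDeriv v y) unitVol := by simpa using h2.integrable
  have i2 : Integrable (fun y : ℝ => ((y : ℂ) - 1) * v y) unitVol :=
    (memLp_mul_continuousOn hv h.continuousOn).integrable (by norm_num)
  rw [integral_add i1 i2] at h3
  simp only [one_mul] at h3
  rw [h2.integral_eq_sub] at h3
  have h4 : greenDeriv v 0 = ∫ s, (s - 1) * v s ∂unitVol := by simp [greenDeriv]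
  have h5 : green v 0 = 0 := by simp [green]
  rw [h4, h5] at h3
  simp only [Complex.ofReal_one, Complex.ofReal_zero] at h3
  linear_combination h3

theorem IsProfile.eq_green (hW : IsProfile W W₁ v) :
    (∀ y ∈ Icc (0 : ℝ) 1, W y = green v y) ∧ ∀ y ∈ Icc (0 : ℝ) 1, W₁ y = greenDeriv v y := by
  have h1 : ∀ y ∈ Icc (0 : ℝ) 1, W₁ y = greenDeriv v y := fun y hy => by
    rw [hW.prim₁.eq y hy, hW.deriv_zero_eq, greenDeriv]
  refine ⟨fun y hy => ?_, h1⟩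
  rw [hW.prim.eq y hy, hW.zero, zero_add, green]
  refine intervalIntegral.integral_congr fun s hs => h1 s ?_
  rw [uIcc_of_le hy.1] at hs
  exact ⟨hs.1, hs.2.trans hy.2⟩

theorem l2_toLp (hv : MemLp v 2 unitVol) : ‖hv.toLp v‖ = l2 v := Lp.norm_toLp v hv

theorem memLp_green (v : Lp ℂ 2 unitVol) : MemLp (green v) 2 unitVol :=
  (isProfile_green (Lp.memLp v)).prim.memLp 2

/-- The solution operator of the Dirichlet problem for `∂_y²`, on `L²`. -/
noncomputable def greenCLM : Lp ℂ 2 unitVol →L[ℂ] Lp ℂ 2 unitVol :=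
  LinearMap.mkContinuous
    { toFun := fun v => (memLp_green v).toLp (green v)
      map_add' := fun v w => by
        rw [← MemLp.toLp_add, MemLp.toLp_eq_toLp_iff]
        have h := ((isProfile_green (Lp.memLp v)).add (isProfile_green (Lp.memLp w))).congr
          (Lp.coeFn_add v w).symm
        exact (ae_unitVol_of_forall h.eq_green.1).mono fun y hy => hy.symm
      map_smul' := fun a v => by
        rw [RingHom.id_apply, ← MemLp.toLp_const_smul, MemLp.toLp_eq_toLp_iff]
        have h := ((isProfile_green (Lp.memLp v)).const_mul a).congr (Lp.coeFn_smul a v).symm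
        exact (ae_unitVol_of_forall h.eq_green.1).mono fun y hy => hy.symm } 1
    fun v => by
      rw [one_mul]
      exact (l2_toLp (memLp_green v)).trans_le (isProfile_green (Lp.memLp v)).l2_le

theorem greenCLM_ae_eq (v : Lp ℂ 2 unitVol) : greenCLM v =ᵐ[unitVol] green v :=
  (memLp_green v).coeFn_toLp

theorem injective_greenCLM : Function.Injective greenCLM := by
  intro v w h
  have h1 := (greenCLM_ae_eq v).symm.trans ((h ▸ ae_eq_refl _ : (greenCLM v : ℝ → ℂ)
    =ᵐ[unitVol] greenCLM w).trans (greenCLM_ae_eq w))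
  have hv := isProfile_green (Lp.memLp v)
  have hw := isProfile_green (Lp.memLp w)
  exact Lp.ext (hv.prim₁.ae_eq hw.prim₁ (hv.prim.ae_eq hw.prim h1))

theorem IsProfile.greenCLM_eq {U : Lp ℂ 2 unitVol} (hW : IsProfile W W₁ v)
    (hU : U =ᵐ[unitVol] W) : greenCLM (hW.memLp.toLp v) = U := by
  refine Lp.ext ((greenCLM_ae_eq _).trans ?_)
  have h := (hW.congr hW.memLp.coeFn_toLp.symm).eq_green.1
  exact Filter.EventuallyEq.trans ((ae_unitVol_of_forall h).mono fun y hy => hy.symm) hU.symm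

/-- Integration against a continuous function, as a functional on `L²`. -/
theorem exists_functional {m : ℝ → ℂ} (hm : ContinuousOn m (Icc 0 1)) :
    ∃ Λ : Lp ℂ 2 unitVol →L[ℂ] ℂ, ∀ v : Lp ℂ 2 unitVol, Λ v = ∫ y, m y * v y ∂unitVol := by
  have mm := memLp_conj (memLp_of_continuousOn hm 2)
  refine ⟨innerSL ℂ (mm.toLp _), fun v => ?_⟩
  rw [innerSL_apply_apply, L2.inner_def]
  refine integral_congr_ae (mm.coeFn_toLp.mono fun y hy => ?_)
  simp only [hy, RCLike.inner_apply, Complex.conj_conj]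
  ring

end green

/-! ### Regularity in time -/

/-- A differentiable curve whose velocity is locally bounded for a stronger norm stays in the
stronger space. The stronger space is the image of an injective operator, which is a measurable
embedding by the theorem of Lusin and Souslin. -/
theorem eq_integral_of_hasDerivAt {X : Type*} [NormedAddCommGroup X] [NormedSpace ℂ X]
    [CompleteSpace X] [SecondCountableTopology X] (G : X →L[ℂ] X) (hG : Function.Injective G)
    {W q : ℝ → X} (hW : ∀ s, HasDerivAt W (G (q s)) s) {b : ℝ → ℝ}
    (hb : ∀ T s, |s| ≤ T → ‖q s‖ ≤ b T) {v₀ : X} (h0 : W 0 = G v₀) :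
    StronglyMeasurable q ∧ (∀ t, IntervalIntegrable q volume 0 t) ∧
      ∀ t, W t = G (v₀ + ∫ s in (0 : ℝ)..t, q s) := by
  borelize X
  have hd : G ∘ q = deriv W := funext fun s => ((hW s).deriv).symm
  have hm : Measurable q := by
    rw [← (G.continuous.measurableEmbedding hG).measurable_comp_iff, hd]
    exact measurable_deriv W
  have hs : StronglyMeasurable q := hm.stronglyMeasurable
  have hi : ∀ t, IntervalIntegrable q volume 0 t := by
    intro t
    rw [intervalIntegrable_iff]
    refine Measure.integrableOn_of_bounded (M := b |t|) (by simp) hs.aestronglyMeasurable ?_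
    refine (ae_restrict_iff' measurableSet_uIoc).2 (Filter.Eventually.of_forall fun s hs => ?_)
    refine hb _ _ ?_
    have := abs_sub_left_of_mem_uIcc (uIoc_subset_uIcc hs)
    simpa using this
  refine ⟨hs, hi, fun t => ?_⟩
  have h1 : ∫ s in (0 : ℝ)..t, G (q s) = W t - W 0 :=
    intervalIntegral.integral_eq_sub_of_hasDerivAt (fun s _ => hW s)
      ⟨G.integrable_comp (hi t).1, G.integrable_comp (hi t).2⟩
  rw [map_add, ← h0, ← G.intervalIntegral_comp_comm (hi t), h1]
  abel

end FiniteChannel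

namespace FiniteChannel

/-! ### The linearized Euler evolution -/

variable {A κ τ m : ℝ} {h : ℝ → ℝ} {β ρ ρ' f f₁ f₂ f₃ : ℝ → ℂ}
  {p ξ s q η q₂ W W₁ v : ℝ → ℂ}

theorem isProfile_forcing (hB : Background A h β ρ ρ') (hf : IsCoeff m f f₁ f₂ f₃)
    (hp : IsElliptic h κ p ξ s) (ms : MemLp s 2 unitVol) (h0 : p 0 = 0) (h1 : p 1 = 0)
    (hq : q = twist h τ p ξ) (hη : η = twistFlux h β κ τ p ξ s) (hq₂ : q₂ = twist h τ q η) :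
    IsProfile (fun y => phase τ y * (f y * p y)) (fun y => phase τ y * (f₁ y * p y + f y * q y))
      (forcingDeriv τ f f₁ f₂ p q q₂) := by
  have mp := hp.prim_p.memLp 2
  have mξ := hp.memLp_ξ
  have mq : MemLp q 2 unitVol := hq ▸ memLp_twist hB mp mξ
  have mη : MemLp η 2 unitVol := hη ▸ memLp_twistFlux hB mp mξ ms
  exact ⟨isPrimitive_forcing hf hp hq, isPrimitive_forcing_deriv hB hf hp hq hη hq₂,
    memLp_forcingDeriv hf mp mq (hq₂ ▸ memLp_twist hB mq mη), by simp [h0], by simp [h1]⟩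

theorem tsum_enorm_fc_sq {u : ℝ → ℂ} (hu : MemLp u 2 unitVol) :
    ∑' n : ℤ, ‖fc u n‖ₑ ^ 2 = ENNReal.ofReal (l2 u ^ 2) := by
  have h1 := hasSum_sq_fc hu
  rw [← h1.tsum_eq, ENNReal.ofReal_tsum_of_nonneg (fun n => by positivity) h1.summable]
  refine tsum_congr fun n => ?_
  rw [ENNReal.ofReal_pow (norm_nonneg _), ofReal_norm]

/-- The boundary data and the size of the second derivative of a vorticity profile. -/
noncomputable def profileSize (K : ℝ) (W₁ v : ℝ → ℂ) : ℝ := ‖W₁ 0‖ + ‖W₁ 1‖ + l2 v / √K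

theorem ofReal_profileSize {K : ℝ} (mv : MemLp v 2 unitVol) :
    ENNReal.ofReal (profileSize K W₁ v) = ‖W₁ 0‖ₑ + ‖W₁ 1‖ₑ
      + ENNReal.ofReal (1 / √K) * (∑' n : ℤ, ‖fc v n‖ₑ ^ 2) ^ (1 / 2 : ℝ) := by
  have hv := l2_nonneg v
  rw [profileSize, ENNReal.ofReal_add (by positivity) (by positivity),
    ENNReal.ofReal_add (by positivity) (by positivity), ofReal_norm, ofReal_norm,
    tsum_enorm_fc_sq mv, ENNReal.ofReal_pow hv, ← ENNReal.rpow_two, ← ENNReal.rpow_mul,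
    show (2 : ℝ) * (1 / 2) = 1 by norm_num, ENNReal.rpow_one, ← ENNReal.ofReal_mul (by positivity),
    one_div_mul_eq_div]

/-- The velocity of a Fourier mode: a part with a bounded energy, resonant at the time `2πn`, and
the contribution of the boundary layers. -/
theorem exists_mode_bound (A : ℝ) : ∃ D : ℝ, 0 < D ∧
    ∀ (h : ℝ → ℝ) (β ρ ρ' f f₁ f₂ f₃ W W₁ v p ξ q η q₂ : ℝ → ℂ) (κ τ m K c : ℝ) (S : ℝ≥0∞),
      Background A h β ρ ρ' → 0 < κ → IsCoeff m f f₁ f₂ f₃ → IsProfile W W₁ v →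
      IsElliptic h κ p ξ (fun y => phase (-τ) y * W y) → p 0 = 0 → p 1 = 0 →
      q = twist h τ p ξ → η = twistFlux h β κ τ p ξ (fun y => phase (-τ) y * W y) →
      q₂ = twist h τ q η → K = max κ 1 → S = ENNReal.ofReal (profileSize K W₁ v) → c = D * m →
      ‖f 0 * q 0‖ₑ + ‖f 1 * q 1‖ₑ
        ≤ ENNReal.ofReal c * (S * ENNReal.ofReal (1 / (K ^ 2 + (0 - τ) ^ 2))) ∧
      ∃ e : ℤ → ℝ≥0∞,
        (∀ n, ‖fc (forcingDeriv τ f f₁ f₂ p q q₂) n‖ₑ ≤ e n + ENNReal.ofReal c * S *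
          ENNReal.ofReal (1 / ((K + |τ|) * (K + |2 * Real.pi * n - τ|)))) ∧
        ∑' n : ℤ, ENNReal.ofReal (K ^ 2 + (2 * Real.pi * n - τ) ^ 2) * e n ^ 2
          ≤ ENNReal.ofReal c ^ 2 *
            (∑' n : ℤ, ‖fc v n‖ₑ ^ 2 * ENNReal.ofReal (1 / (K ^ 2 + (2 * Real.pi * n - τ) ^ 2))
              + ENNReal.ofReal K * S ^ 2 * ENNReal.ofReal (1 / (K ^ 2 + (0 - τ) ^ 2))) := by
  obtain ⟨D, hD, H⟩ := exists_forcingDeriv_decomposition A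
  refine ⟨2 * D, by positivity, ?_⟩
  intro h β ρ ρ' f f₁ f₂ f₃ W W₁ v p ξ q η q₂ κ τ m K c S hB hκ hf hW hp h0 h1 hq hη hq₂ hK hS hc
  obtain ⟨P, P', hP, mP', P0, P1, bP, bQ, b0, b1⟩ := H h β ρ ρ' f f₁ f₂ f₃ W W₁ v p ξ q η q₂ κ τ m K
    (profileSize K W₁ v) hB hκ hf hW hp h0 h1 hq hη hq₂ hK rfl
  have hm := hf.nonneg
  have hK1 : 1 ≤ K := hK ▸ le_max_right _ _
  have hK0 : 0 < K := zero_lt_one.trans_le hK1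
  have hv := l2_nonneg v
  obtain ⟨R, hR⟩ : ∃ R, R = profileSize K W₁ v := ⟨_, rfl⟩
  have hR0 : 0 ≤ R := by rw [hR, profileSize]; positivity
  rw [← hR] at bP bQ b0 b1 hS
  have hc0 : 0 ≤ c := by rw [hc]; positivity
  have ht := abs_nonneg τ
  subst hS
  refine ⟨?_, fun n => ‖fc (fun y => phase τ y * P y) n‖ₑ, fun n => ?_, ?_⟩
  · rw [← ofReal_norm, ← ofReal_norm, ← ENNReal.ofReal_add (norm_nonneg _) (norm_nonneg _),
      ← ENNReal.ofReal_mul hR0, ← ENNReal.ofReal_mul hc0]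
    refine ENNReal.ofReal_le_ofReal ((add_le_add b0 b1).trans (le_of_eq ?_))
    rw [hc, zero_sub, neg_sq]; ring
  · simp only []
    rw [← ofReal_norm, ← ofReal_norm, ← ENNReal.ofReal_mul hc0, ← ENNReal.ofReal_mul (by positivity),
      ← ENNReal.ofReal_add (norm_nonneg _) (by positivity)]
    refine ENNReal.ofReal_le_ofReal ((bQ n).trans (add_le_add le_rfl ?_))
    rw [mul_one_div, hc]
    have hn := abs_nonneg (2 * Real.pi * n - τ)
    gcongr
    linarith
  · have hs := hasSum_weighted_sq_fc hP mP' P0 P1 K τ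
    have hsv := hasSum_sq_fc hW.memLp
    have hw : ∀ n : ℤ, 0 < K ^ 2 + (2 * Real.pi * n - τ) ^ 2 := fun n => by positivity
    have sv : Summable fun n : ℤ => ‖fc v n‖ ^ 2 / (K ^ 2 + (2 * Real.pi * n - τ) ^ 2) := by
      refine Summable.of_nonneg_of_le (fun n => div_nonneg (sq_nonneg _) (hw n).le) (fun n => ?_)
        hsv.summable
      refine div_le_self (sq_nonneg _) ?_
      nlinarith [sq_nonneg (2 * Real.pi * n - τ)]
    have e1 : ∑' n : ℤ, ENNReal.ofReal (K ^ 2 + (2 * Real.pi * n - τ) ^ 2)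
          * ‖fc (fun y => phase τ y * P y) n‖ₑ ^ 2
        = ENNReal.ofReal (K ^ 2 * l2 P ^ 2 + l2 P' ^ 2) := by
      rw [← hs.tsum_eq, ENNReal.ofReal_tsum_of_nonneg
        (fun n => mul_nonneg (hw n).le (sq_nonneg _)) hs.summable]
      refine tsum_congr fun n => ?_
      rw [ENNReal.ofReal_mul (hw n).le, ENNReal.ofReal_pow (norm_nonneg _), ofReal_norm]
    have e2 : ∑' n : ℤ, ‖fc v n‖ₑ ^ 2 * ENNReal.ofReal (1 / (K ^ 2 + (2 * Real.pi * n - τ) ^ 2))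
        = ENNReal.ofReal (∑' n : ℤ, ‖fc v n‖ ^ 2 / (K ^ 2 + (2 * Real.pi * n - τ) ^ 2)) := by
      rw [ENNReal.ofReal_tsum_of_nonneg (fun n => div_nonneg (sq_nonneg _) (hw n).le) sv]
      refine tsum_congr fun n => ?_
      rw [← ofReal_norm, ← ENNReal.ofReal_pow (norm_nonneg _), ← ENNReal.ofReal_mul (by positivity),
        mul_one_div]
    have g0 : 0 ≤ ∑' n : ℤ, ‖fc v n‖ ^ 2 / (K ^ 2 + (2 * Real.pi * n - τ) ^ 2) :=
      tsum_nonneg fun n => div_nonneg (sq_nonneg _) (hw n).le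
    rw [e1, e2, ← ENNReal.ofReal_pow hc0, ← ENNReal.ofReal_pow hR0, ← ENNReal.ofReal_mul hK0.le,
      ← ENNReal.ofReal_mul (by positivity), ← ENNReal.ofReal_add g0 (by positivity),
      ← ENNReal.ofReal_mul (by positivity)]
    refine ENNReal.ofReal_le_ofReal ?_
    obtain ⟨g, hg⟩ : ∃ g, g = √(∑' n : ℤ, ‖fc v n‖ ^ 2 / (K ^ 2 + (2 * Real.pi * n - τ) ^ 2)) :=
      ⟨_, rfl⟩
    have hg2 : ∑' n : ℤ, ‖fc v n‖ ^ 2 / (K ^ 2 + (2 * Real.pi * n - τ) ^ 2) = g ^ 2 := by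
      rw [hg, Real.sq_sqrt g0]
    have hg0 : 0 ≤ g := hg ▸ Real.sqrt_nonneg _
    rw [← hg] at bP
    rw [hg2]
    have hP0 := l2_nonneg P
    have hP'0 := l2_nonneg P'
    obtain ⟨r, hr⟩ : ∃ r, r = √K * R / (K + |τ|) := ⟨_, rfl⟩
    have hr0 : 0 ≤ r := by rw [hr]; positivity
    have hr2 : r ^ 2 ≤ K * R ^ 2 * (1 / (K ^ 2 + (0 - τ) ^ 2)) := by
      rw [hr, div_pow, mul_pow, Real.sq_sqrt hK0.le, mul_one_div, zero_sub, neg_sq]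
      gcongr
      rw [← sq_abs τ]; nlinarith
    rw [← hr] at bP
    calc K ^ 2 * l2 P ^ 2 + l2 P' ^ 2 ≤ (K * l2 P + l2 P') ^ 2 := by
          have : 0 ≤ K * l2 P * l2 P' := by positivity
          nlinarith
      _ ≤ (D * m * (g + r)) ^ 2 := by gcongr
      _ = (D * m) ^ 2 * (g + r) ^ 2 := by ring
      _ ≤ (D * m) ^ 2 * (4 * (g ^ 2 + r ^ 2)) := by
          gcongr; nlinarith [sq_nonneg (g - r), sq_nonneg (g + r)]
      _ = c ^ 2 * (g ^ 2 + r ^ 2) := by rw [hc]; ring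
      _ ≤ _ := by gcongr

/-- Growth of a functional along an integrated curve. -/
theorem enorm_functional_le {X : Type*} [NormedAddCommGroup X] [NormedSpace ℂ X] [CompleteSpace X]
    (Λ : X →L[ℂ] ℂ) {q : ℝ → X} (hq : ∀ t, IntervalIntegrable q volume 0 t) (v₀ : X) {s T : ℝ}
    (hs : |s| ≤ T) :
    ‖Λ (v₀ + ∫ r in (0 : ℝ)..s, q r)‖ₑ ≤ ‖Λ v₀‖ₑ + ∫⁻ r in Icc (-T) T, ‖Λ (q r)‖ₑ := by
  rw [map_add, ← Λ.intervalIntegral_comp_comm (hq s)]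
  refine (enorm_add_le _ _).trans (add_le_add le_rfl ?_)
  have hsT := abs_le.1 hs
  have hT : 0 ≤ T := (abs_nonneg s).trans hs
  have hsub : uIoc 0 s ⊆ Icc (-T) T := fun r hr => by
    have h1 : min 0 s < r := hr.1
    have h2 : r ≤ max 0 s := hr.2
    exact ⟨(le_min (by linarith) hsT.1).trans h1.le, h2.trans (max_le hT hsT.2)⟩
  rw [← ofReal_norm, intervalIntegral.norm_intervalIntegral_eq, ofReal_norm]
  exact (enorm_integral_le_lintegral_enorm _).trans (lintegral_mono_set hsub)

end FiniteChannel

namespace FiniteChannel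

variable {A κ m : ℝ} {h : ℝ → ℝ} {β ρ ρ' f f₁ f₂ f₃ : ℝ → ℂ} {p ξ s W W₁ v : ℝ → ℂ}

/-- The linearized Euler evolution, as a first order system in `y`, for a unit shear. -/
def IsEvolution (h : ℝ → ℝ) (κ : ℝ) (f : ℝ → ℂ) (W : ℝ → Lp ℂ 2 unitVol) : Prop :=
  ∀ τ : ℝ, ∃ p ξ : ℝ → ℂ, IsElliptic h κ p ξ (fun y => phase (-τ) y * W τ y) ∧ p 0 = 0 ∧ p 1 = 0 ∧
    ∃ D : Lp ℂ 2 unitVol, (D =ᵐ[unitVol] fun y => Complex.I * (phase τ y * (f y * p y))) ∧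
      HasDerivAt W D τ

theorem IsElliptic.congr_source {s' : ℝ → ℂ} (hp : IsElliptic h κ p ξ s)
    (e : s =ᵐ[unitVol] s') : IsElliptic h κ p ξ s' :=
  ⟨hp.prim_p, hp.prim_ξ.congr (fun _ _ => rfl) (e.mono fun y hy => by simp only [hy])⟩

/-- The velocity of the evolution is the solution of a Dirichlet problem, whose source is bounded
on bounded time intervals. -/
theorem IsEvolution.exists_velocity {W : ℝ → Lp ℂ 2 unitVol} (hW : IsEvolution h κ f W)
    (hκ : 0 < κ) (hB : Background A h β ρ ρ') (hf : IsCoeff m f f₁ f₂ f₃) :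
    ∃ (r : ℝ → Lp ℂ 2 unitVol) (b : ℝ → ℝ), (∀ τ, HasDerivAt W (greenCLM (r τ)) τ) ∧
      (∀ T τ, |τ| ≤ T → ‖r τ‖ ≤ b T) ∧
      ∀ τ, ∀ W' : ℝ → ℂ, W τ =ᵐ[unitVol] W' → MemLp W' 2 unitVol → ∃ p ξ q η q₂ : ℝ → ℂ,
        IsElliptic h κ p ξ (fun y => phase (-τ) y * W' y) ∧ p 0 = 0 ∧ p 1 = 0 ∧
        q = twist h τ p ξ ∧ η = twistFlux h β κ τ p ξ (fun y => phase (-τ) y * W' y) ∧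
        q₂ = twist h τ q η ∧
        (r τ =ᵐ[unitVol] fun y => Complex.I * forcingDeriv τ f f₁ f₂ p q q₂ y) := by
  choose p ξ hp h0 h1 D hD hd using hW
  have mW : ∀ τ, MemLp (fun y => phase (-τ) y * W τ y) 2 unitVol := fun τ =>
    memLp_phase_mul (Lp.memLp _) _
  have hF : ∀ τ, IsProfile (fun y => Complex.I * (phase τ y * (f y * p τ y))) _ _ := fun τ =>
    (isProfile_forcing (τ := τ) hB hf (hp τ) (mW τ) (h0 τ) (h1 τ) rfl rfl rfl).const_mul Complex.I
  choose B hBd using fun T : ℝ => (isCompact_Icc (a := -T) (b := T)).exists_bound_of_continuousOn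
    (f := W) (fun τ _ => (hd τ).continuousAt.continuousWithinAt)
  choose E hE0 hE using fun T => exists_l2_forcingDeriv_le A κ m T hκ
  refine ⟨fun τ => (hF τ).memLp.toLp _, fun T => E T * B T, fun τ => ?_, fun T τ hT => ?_,
    fun τ W' hW' mW' => ?_⟩
  · rw [(hF τ).greenCLM_eq (hD τ)]; exact hd τ
  · rw [l2_toLp]
    have e1 := l2_le_mul (u := fun y => Complex.I * forcingDeriv τ f f₁ f₂ (p τ)
        (twist h τ (p τ) (ξ τ)) (twist h τ (twist h τ (p τ) (ξ τ))
          (twistFlux h β κ τ (p τ) (ξ τ) fun y => phase (-τ) y * W τ y)) y)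
      (isProfile_forcing (τ := τ) hB hf (hp τ) (mW τ) (h0 τ) (h1 τ) rfl rfl rfl).memLp
      zero_le_one (Filter.Eventually.of_forall fun y => by simp)
    have e2 := hE T h β ρ ρ' f f₁ f₂ f₃ (p τ) (ξ τ) _ _ _ _ τ hT hB hf (hp τ) (mW τ) (h0 τ) (h1 τ)
      rfl rfl rfl
    have e3 : l2 (fun y => phase (-τ) y * W τ y) ≤ B T :=
      (l2_phase_mul _ _).trans_le (hBd T τ (abs_le.1 hT))
    rw [one_mul] at e1
    exact e1.trans (e2.trans (mul_le_mul_of_nonneg_left e3 (hE0 T)))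
  · have e : (fun y => phase (-τ) y * W τ y) =ᵐ[unitVol] fun y => phase (-τ) y * W' y :=
      hW'.mono fun y hy => by simp only [hy]
    have hp' := (hp τ).congr_source e
    refine ⟨p τ, ξ τ, _, _, _, hp', h0 τ, h1 τ, rfl, rfl, rfl, (hF τ).memLp.coeFn_toLp.trans ?_⟩
    have hF' := (isProfile_forcing (τ := τ) hB hf hp' (memLp_phase_mul mW' _) (h0 τ) (h1 τ)
      rfl rfl rfl).const_mul Complex.I
    exact (hF τ).prim₁.ae_eq hF'.prim₁ (ae_eq_refl _)

/-- Stability: the second derivative of the vorticity is bounded uniformly in time. -/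
theorem exists_evolution_bound (A : ℝ) : ∃ D : ℝ, 0 < D ∧
    ∀ (h : ℝ → ℝ) (β ρ ρ' f f₁ f₂ f₃ W₀ W₁ v₀ : ℝ → ℂ) (κ m : ℝ) (W : ℝ → Lp ℂ 2 unitVol),
      Background A h β ρ ρ' → 0 < κ → IsCoeff m f f₁ f₂ f₃ → D * m ≤ max κ 1 →
      IsEvolution h κ f W → IsProfile W₀ W₁ v₀ → W 0 =ᵐ[unitVol] W₀ →
      ∀ t, ∃ U U₁ v : ℝ → ℂ, IsProfile U U₁ v ∧ W t =ᵐ[unitVol] U ∧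
        l2 v ≤ (2 + D * m) * l2 v₀ := by
  obtain ⟨D, hD, H⟩ := exists_mode_bound A
  refine ⟨2050 * D, by positivity, ?_⟩
  intro h β ρ ρ' f f₁ f₂ f₃ W₀ W₁ v₀ κ m W hB hκ hf hsmall hW hW₀ h0 t
  obtain ⟨K, hK⟩ : ∃ K, K = max κ 1 := ⟨_, rfl⟩
  have hK1 : 1 ≤ K := hK ▸ le_max_right _ _
  have hm := hf.nonneg
  obtain ⟨c, hc⟩ : ∃ c, c = D * m := ⟨_, rfl⟩
  have hc0 : 0 ≤ c := by rw [hc]; positivity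
  have hcK : c ≤ K / 1200 := by
    rw [← hK, mul_assoc, ← hc] at hsmall
    linarith
  obtain ⟨r, b, hr, hrb, hrQ⟩ := hW.exists_velocity hκ hB hf
  have : Fact ((2 : ℝ≥0∞) ≠ ⊤) := ⟨by simp⟩
  obtain ⟨sr, ir, hWt⟩ := eq_integral_of_hasDerivAt greenCLM injective_greenCLM hr hrb
    (hW₀.greenCLM_eq h0).symm
  obtain ⟨V, hV⟩ : ∃ V : ℝ → Lp ℂ 2 unitVol,
      V = fun t => hW₀.memLp.toLp v₀ + ∫ s in (0 : ℝ)..t, r s := ⟨_, rfl⟩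
  have hWV : ∀ s, W s =ᵐ[unitVol] green (V s) := fun s => by
    rw [hWt s, hV]; exact greenCLM_ae_eq _
  have hprof : ∀ s, IsProfile (green (V s)) (greenDeriv (V s)) (V s) := fun s =>
    isProfile_green (Lp.memLp _)
  -- the Fourier coefficients and the slopes at the walls as functionals
  have hΛ : ∀ n : ℤ, ∃ Λ : Lp ℂ 2 unitVol →L[ℂ] ℂ, ∀ u : Lp ℂ 2 unitVol, Λ u = fc u n := fun n =>
    exists_functional (continuous_phase _).continuousOn
  choose Λ hΛ using hΛ
  obtain ⟨Λ₀, hΛ₀⟩ := exists_functional (m := fun y : ℝ => (y : ℂ) - 1) (by fun_prop)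
  obtain ⟨Λ₁, hΛ₁⟩ := exists_functional (m := fun y : ℝ => (y : ℂ)) (by fun_prop)
  have slope : ∀ {u : Lp ℂ 2 unitVol} {U U₁ w : ℝ → ℂ}, IsProfile U U₁ w → u =ᵐ[unitVol] w →
      Λ₀ u = U₁ 0 ∧ Λ₁ u = U₁ 1 := by
    intro u U U₁ w hU hu
    have hU' := hU.congr hu.symm
    exact ⟨(hΛ₀ u).trans hU'.deriv_zero_eq.symm, (hΛ₁ u).trans hU'.deriv_one_eq.symm⟩
  have norm_slope : ∀ u : Lp ℂ 2 unitVol, ‖Λ₀ u‖ ≤ ‖u‖ ∧ ‖Λ₁ u‖ ≤ ‖u‖ := by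
    intro u
    have hu := isProfile_green (Lp.memLp u)
    obtain ⟨e0, e1⟩ := slope hu (ae_eq_refl _)
    rw [e0, e1]
    exact ⟨hu.norm_deriv_le (by simp), hu.norm_deriv_le (by simp)⟩
  have m₀ : Measurable fun s => ‖Λ₀ (r s)‖ₑ :=
    (Λ₀.continuous.comp_stronglyMeasurable sr).enorm
  have m₁ : Measurable fun s => ‖Λ₁ (r s)‖ₑ :=
    (Λ₁.continuous.comp_stronglyMeasurable sr).enorm
  -- bounds on the interval `[-T, T]`
  obtain ⟨T, hT⟩ : ∃ T, T = |t| := ⟨_, rfl⟩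
  have hI : ∀ s ∈ Icc (-T) T, |s| ≤ T := fun s hs => abs_le.2 hs
  have aeI : ∀ {P : ℝ → Prop}, (∀ s ∈ Icc (-T) T, P s) → ∀ᵐ s ∂volume.restrict (Icc (-T) T), P s :=
    fun hP => (ae_restrict_iff' measurableSet_Icc).2 (Filter.Eventually.of_forall hP)
  have modes : ∀ s, ‖Λ₀ (r s)‖ₑ + ‖Λ₁ (r s)‖ₑ ≤ ENNReal.ofReal c *
        (ENNReal.ofReal (profileSize K (greenDeriv (V s)) (V s))
          * ENNReal.ofReal (1 / (K ^ 2 + (0 - s) ^ 2))) ∧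
      ∃ e : ℤ → ℝ≥0∞,
        (∀ n, ‖fc (r s) n‖ₑ ≤ e n + ENNReal.ofReal c *
          ENNReal.ofReal (profileSize K (greenDeriv (V s)) (V s)) *
          ENNReal.ofReal (1 / ((K + |s|) * (K + |2 * Real.pi * n - s|)))) ∧
        ∑' n : ℤ, ENNReal.ofReal (K ^ 2 + (2 * Real.pi * n - s) ^ 2) * e n ^ 2
          ≤ ENNReal.ofReal c ^ 2 *
            (∑' n : ℤ, ‖fc (V s) n‖ₑ ^ 2 * ENNReal.ofReal (1 / (K ^ 2 + (2 * Real.pi * n - s) ^ 2))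
              + ENNReal.ofReal K * ENNReal.ofReal (profileSize K (greenDeriv (V s)) (V s)) ^ 2
                * ENNReal.ofReal (1 / (K ^ 2 + (0 - s) ^ 2))) := by
    intro s
    obtain ⟨p, ξ, q, η, q₂, hp, p0, p1, hq, hη, hq₂, hrs⟩ :=
      hrQ s _ (hWV s) ((hprof s).prim.memLp 2)
    obtain ⟨i1, e, i2, i3⟩ := H h β ρ ρ' f f₁ f₂ f₃ _ _ _ p ξ q η q₂ κ s m K c _ hB hκ hf (hprof s)
      hp p0 p1 hq hη hq₂ hK rfl hc
    have hF := (isProfile_forcing (τ := s) hB hf hp (memLp_phase_mul ((hprof s).prim.memLp 2) _) p0 p1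
      hq hη hq₂).const_mul Complex.I
    obtain ⟨s0, s1⟩ := slope hF hrs
    have nI : ‖Complex.I‖ₑ = 1 := by rw [← ofReal_norm, Complex.norm_I, ENNReal.ofReal_one]
    have nphase : ∀ y, ‖phase s y‖ₑ = 1 := fun y => by
      rw [← ofReal_norm, norm_phase, ENNReal.ofReal_one]
    refine ⟨?_, e, fun n => ?_, i3⟩
    · rw [s0, s1, p0, p1]
      simpa only [mul_zero, zero_add, enorm_mul, nphase, nI, one_mul] using i1
    · rw [fc_congr hrs, fc_const_mul, enorm_mul, nI, one_mul]
      exact i2 n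
  choose x_le e fc_le e_le using modes
  have hsum : ∀ u : Lp ℂ 2 unitVol, ∑' n : ℤ, ‖fc u n‖ₑ ^ 2 = ENNReal.ofReal (‖u‖ ^ 2) := fun u =>
    tsum_enorm_fc_sq (Lp.memLp u)
  have key := tsum_sq_le_of_closure (μ := volume.restrict (Icc (-T) T)) (K := K) (c := c)
    (Q := fun n s => ‖fc (r s) n‖ₑ) (e := fun n s => e s n) (V := fun n s => ‖fc (V s) n‖ₑ)
    (a := fun n => ‖fc (hW₀.memLp.toLp v₀) n‖ₑ) (x := fun s => ‖Λ₀ (r s)‖ₑ + ‖Λ₁ (r s)‖ₑ)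
    (S := fun s => ENNReal.ofReal (profileSize K (greenDeriv (V s)) (V s)))
    (σ := ‖Λ₀ (hW₀.memLp.toLp v₀)‖ₑ + ‖Λ₁ (hW₀.memLp.toLp v₀)‖ₑ)
    (M := ENNReal.ofReal (b T ^ 2) + ENNReal.ofReal (2 * b T))
    hK1 hc0 hcK Measure.restrict_le_self
    (fun n => by
      simp_rw [← hΛ]
      exact ((Λ n).continuous.comp_stronglyMeasurable sr).enorm)
    (ENNReal.add_ne_top.2 ⟨ENNReal.ofReal_ne_top, ENNReal.ofReal_ne_top⟩) (by simp)
    (by rw [hsum]; simp)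
    (aeI fun s hs => by
      rw [hsum]
      refine le_trans (ENNReal.ofReal_le_ofReal ?_) le_self_add
      exact pow_le_pow_left₀ (norm_nonneg _) (hrb T s (hI s hs)) 2)
    (aeI fun s hs => by
      refine le_trans ?_ le_add_self
      rw [← ofReal_norm, ← ofReal_norm, ← ENNReal.ofReal_add (norm_nonneg _) (norm_nonneg _)]
      refine ENNReal.ofReal_le_ofReal ?_
      have := hrb T s (hI s hs)
      linarith [(norm_slope (r s)).1, (norm_slope (r s)).2])
    (aeI fun s hs n => by
      simp_rw [← hΛ, hV]
      exact enorm_functional_le (Λ n) ir _ (hI s hs))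
    (aeI fun s hs => by
      rw [ofReal_profileSize (hprof s).memLp, lintegral_add_left m₀]
      refine add_le_add ?_ le_rfl
      obtain ⟨s0, s1⟩ := slope (hprof s) (ae_eq_refl _)
      rw [← s0, ← s1, hV]
      refine (add_le_add (enorm_functional_le Λ₀ ir _ (hI s hs))
        (enorm_functional_le Λ₁ ir _ (hI s hs))).trans (le_of_eq ?_)
      ring)
    (aeI fun s _ => x_le s) (aeI fun s _ => fc_le s) (aeI fun s _ => e_le s)
  refine ⟨_, _, _, hprof t, hWV t, ?_⟩
  have hv₀ : ‖hW₀.memLp.toLp v₀‖ = l2 v₀ := l2_toLp _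
  have nv₀ := l2_nonneg v₀
  have last : ENNReal.ofReal (l2 (V t) ^ 2)
      ≤ ENNReal.ofReal (4 * l2 v₀ ^ 2 + 1049600 * c ^ 2 * (2 * l2 v₀) ^ 2) := by
    rw [← tsum_enorm_fc_sq (Lp.memLp (V t))]
    calc ∑' n : ℤ, ‖fc (V t) n‖ₑ ^ 2
        ≤ ∑' n : ℤ, (‖fc (hW₀.memLp.toLp v₀) n‖ₑ
            + ∫⁻ s in Icc (-T) T, ‖fc (r s) n‖ₑ) ^ 2 := by
          refine ENNReal.tsum_le_tsum fun n => pow_le_pow_left₀ zero_le ?_ 2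
          simp_rw [← hΛ, hV]
          exact enorm_functional_le (Λ n) ir _ hT.ge
      _ ≤ _ := key
      _ ≤ 4 * ENNReal.ofReal (l2 v₀ ^ 2) + ENNReal.ofReal (1049600 * c ^ 2)
            * ENNReal.ofReal (2 * l2 v₀) ^ 2 := by
          rw [hsum, hv₀]
          refine add_le_add le_rfl (mul_le_mul_right (pow_le_pow_left₀ zero_le ?_ 2) _)
          rw [← ofReal_norm, ← ofReal_norm, ← ENNReal.ofReal_add (norm_nonneg _) (norm_nonneg _)]
          refine ENNReal.ofReal_le_ofReal ?_
          have := norm_slope (hW₀.memLp.toLp v₀)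
          rw [hv₀] at this
          linarith [this.1, this.2]
      _ = _ := by
          rw [ENNReal.ofReal_add (by positivity) (by positivity),
            ENNReal.ofReal_mul (by norm_num : (0 : ℝ) ≤ 4),
            ENNReal.ofReal_mul (by positivity : (0 : ℝ) ≤ 1049600 * c ^ 2),
            ENNReal.ofReal_pow (by positivity : 0 ≤ 2 * l2 v₀)]
          norm_num
  rw [ENNReal.ofReal_le_ofReal_iff (by positivity)] at last
  refine abs_le_of_sq_le_sq' ?_ (by positivity) |>.2
  refine last.trans ?_
  have e : 2 + 2050 * D * m = 2 + 2050 * c := by rw [hc]; ring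
  rw [e]
  have : 0 ≤ c * l2 v₀ ^ 2 := by positivity
  have : 0 ≤ c ^ 2 * l2 v₀ ^ 2 := by positivity
  nlinarith

end FiniteChannel

namespace FiniteChannel

/-! ### Coefficients and profiles in Sobolev spaces -/

theorem norm_le_of_normWInf_le {n j : ℕ} {f : ℝ → ℝ} {m : ℝ} (hm : 0 ≤ m)
    (h : normWInf n f ≤ ENNReal.ofReal m) (hj : j ≤ n) :
    ∀ᵐ y ∂unitVol, ‖((weakDeriv^[j] f y : ℝ) : ℂ)‖ ≤ m := by
  have h1 : eLpNorm (weakDeriv^[j] f) ∞ unitVol ≤ ENNReal.ofReal m :=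
    (Finset.le_sup (f := fun j => eLpNorm (weakDeriv^[j] f) ∞ unitVol)
      (Finset.mem_range.2 (Nat.lt_succ_of_le hj))).trans h
  rw [eLpNorm_exponent_top] at h1
  filter_upwards [enorm_ae_le_eLpNormEssSup (weakDeriv^[j] f) unitVol] with y hy
  have h2 := hy.trans h1
  rw [← ofReal_norm, ENNReal.ofReal_le_ofReal_iff hm] at h2
  rwa [Complex.norm_real]

/-- A coefficient in `W^{3,∞}` has a continuous representative, with its derivatives. -/
theorem exists_isCoeff {f : ℝ → ℝ} (hf : MemSobolev 3 ∞ f) {m : ℝ} (hm : 0 ≤ m)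
    (h : normWInf 3 f ≤ ENNReal.ofReal m) :
    ∃ F F₁ F₂ F₃ : ℝ → ℂ, IsCoeff m F F₁ F₂ F₃ ∧ (fun y => (f y : ℂ)) =ᵐ[unitVol] F := by
  have w : ∀ j < 3, IsWeakDeriv (fun y => ((weakDeriv^[j] f y : ℝ) : ℂ))
      (fun y => ((weakDeriv (weakDeriv^[j] f) y : ℝ) : ℂ)) := fun j hj =>
    (isWeakDeriv_weakDeriv (hf.1 j hj)).ofReal
  have i3 : Integrable (fun y => ((weakDeriv^[3] f y : ℝ) : ℂ)) unitVol :=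
    ((hf.2 3 le_rfl).ofReal (K := ℂ)).integrable (by norm_num)
  have b := fun j hj => norm_le_of_normWInf_le (j := j) hm h hj
  obtain ⟨F₂, h2, e2⟩ := (w 2 (by norm_num)).exists_isPrimitive i3
  obtain ⟨F₁, h1, e1⟩ := ((w 1 (by norm_num)).congr (ae_eq_refl _) e2).exists_isPrimitive
    (integrable_of_continuousOn h2.continuousOn)
  obtain ⟨F, h0, e0⟩ := ((w 0 (by norm_num)).congr (ae_eq_refl _) e1).exists_isPrimitive
    (integrable_of_continuousOn h1.continuousOn)
  refine ⟨F, F₁, F₂, _, ⟨h0, h1, h2, ?_, ?_, ?_, b 3 le_rfl⟩, e0⟩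
  · exact norm_le_of_ae h0.continuousOn (by
      filter_upwards [b 0 (by norm_num), e0] with y hy he; rwa [← he])
  · exact norm_le_of_ae h1.continuousOn (by
      filter_upwards [b 1 (by norm_num), e1] with y hy he; rwa [← he])
  · exact norm_le_of_ae h2.continuousOn (by
      filter_upwards [b 2 (by norm_num), e2] with y hy he; rwa [← he])

/-- The background of a channel flow, in terms of the inverse of the shear. -/
theorem exists_background {c M : ℝ} (hc : 0 < c) {A : ℝ}
    (hA : A = 1 + c⁻¹ + c⁻¹ * M + (M + M ^ 2 * c⁻¹) + (M + 2 * M ^ 2 * c⁻¹ + M ^ 3 * c⁻¹ ^ 2))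
    {g : ℝ → ℝ} (hg : ∀ᵐ y ∂unitVol, c < g y ∧ g y < c⁻¹)
    {G G₁ G₂ G₃ : ℝ → ℂ} (hG : IsCoeff M G G₁ G₂ G₃) (e : (fun y => (g y : ℂ)) =ᵐ[unitVol] G) :
    ∃ (h : ℝ → ℝ) (β ρ ρ' : ℝ → ℂ), Background A h β ρ ρ' ∧ ∀ᵐ y ∂unitVol, h y * g y = 1 := by
  have hM := hG.nonneg
  have hci : 0 < c⁻¹ := inv_pos.2 hc
  have hcont := hG.prim.continuousOn
  have hre : ContinuousOn (fun y => (G y).re) (Icc 0 1) :=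
    Complex.continuous_re.comp_continuousOn hcont
  have him : ContinuousOn (fun y => (G y).im) (Icc 0 1) :=
    Complex.continuous_im.comp_continuousOn hcont
  have hmem : ∀ y ∈ Icc (0 : ℝ) 1, (G y).re ∈ Icc c c⁻¹ := forall_mem_of_ae_mem hre isClosed_Icc (by
    filter_upwards [hg, e] with y h1 h2
    rw [← h2, Complex.ofReal_re]; exact ⟨h1.1.le, h1.2.le⟩)
  have hreal : ∀ y ∈ Icc (0 : ℝ) 1, (G y).im ∈ ({0} : Set ℝ) :=
    forall_mem_of_ae_mem him isClosed_singleton (by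
      filter_upwards [e] with y h2
      rw [← h2, Complex.ofReal_im]; rfl)
  have hGre : ∀ y ∈ Icc (0 : ℝ) 1, G y = ((G y).re : ℂ) := fun y hy =>
    Complex.ext (by simp) (by simpa using hreal y hy)
  have hne : ∀ y ∈ Icc (0 : ℝ) 1, G y ≠ 0 := fun y hy h0 => by
    have := (hmem y hy).1
    rw [h0, Complex.zero_re] at this
    linarith
  have ninv : ∀ y ∈ Icc (0 : ℝ) 1, ‖(G y)⁻¹‖ ≤ c⁻¹ := fun y hy => by
    have h1 := (hmem y hy).1
    rw [hGre y hy, norm_inv, Complex.norm_real, Real.norm_of_nonneg (hc.le.trans h1)]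
    exact inv_anti₀ hc h1
  have hinv : IsPrimitive (fun y => (G y)⁻¹) (fun y => -G₁ y / G y ^ 2) := by
    have c1 : ContinuousOn (fun y => -G₁ y / G y ^ 2) (Icc 0 1) :=
      hG.prim₁.continuousOn.neg.div (hcont.pow 2) fun y hy => pow_ne_zero 2 (hne y hy)
    refine ⟨integrable_of_continuousOn c1, fun y hy => ?_⟩
    have hsub : Icc 0 y ⊆ Icc (0 : ℝ) 1 := Icc_subset_Icc_right hy.2
    rw [intervalIntegral.integral_eq_sub_of_hasDerivAt_of_le hy.1
      ((hcont.inv₀ hne).mono hsub) (fun x hx => ?_)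
      (intervalIntegrable_sub (integrable_of_continuousOn c1) (by simp) hy)]
    · simp only [Pi.inv_apply]
      ring
    · have hx' : x ∈ Ioo (0 : ℝ) 1 := ⟨hx.1, hx.2.trans_le hy.2⟩
      exact (hG.prim.hasDerivAt hG.prim₁.continuousOn hx').fun_inv (hne x ⟨hx'.1.le, hx'.2.le⟩)
  have hic : ContinuousOn (fun y => (G y)⁻¹) (Icc 0 1) := hinv.continuousOn
  have eh : ∀ y ∈ Icc (0 : ℝ) 1, (((G y).re⁻¹ : ℝ) : ℂ) = (G y)⁻¹ := fun y hy => by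
    rw [Complex.ofReal_inv, ← hGre y hy]
  have hA1 : 0 ≤ c⁻¹ * M := by positivity
  have hA2 : 0 ≤ M ^ 2 * c⁻¹ := by positivity
  have hA3 : 0 ≤ M ^ 3 * c⁻¹ ^ 2 := by positivity
  refine ⟨fun y => (G y).re⁻¹, fun y => -((G y)⁻¹ * G₁ y), fun y => -G₂ y + G₁ y * G₁ y * (G y)⁻¹,
    fun y => -G₃ y + ((G₂ y * G₁ y + G₁ y * G₂ y) * (G y)⁻¹ + G₁ y * G₁ y * (-G₁ y / G y ^ 2)),
    ⟨?_, fun y hy => ?_, fun y hy => ?_, ?_, ?_, ?_, fun y hy => ?_, fun y hy => ?_, ?_⟩, ?_⟩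
  · linarith
  · rw [inv_le_inv₀ (by linarith) (hc.trans_le (hmem y hy).1)]
    exact (hmem y hy).2.trans (by linarith)
  · exact (inv_anti₀ hc (hmem y hy).1).trans (by linarith)
  · refine hinv.congr eh (ae_unitVol_of_forall fun y hy => ?_)
    simp only []
    rw [eh y hy]; field_simp
  · refine (hinv.mul hG.prim₁).neg.congr (fun _ _ => rfl) (ae_unitVol_of_forall fun y hy => ?_)
    have := hne y hy
    simp only []
    rw [eh y hy]; field_simp; ring
  · exact hG.prim₂.neg.add ((hG.prim₁.mul hG.prim₁).mul hinv)
  · rw [norm_neg, norm_mul]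
    calc _ ≤ c⁻¹ * M := mul_le_mul (ninv y hy) (hG.norm₁_le y hy) (norm_nonneg _) hci.le
      _ ≤ A := by linarith
  · have n1 := hG.norm₁_le y hy
    calc _ ≤ ‖G₂ y‖ + ‖G₁ y‖ * ‖G₁ y‖ * ‖(G y)⁻¹‖ := by
          refine (norm_add_le _ _).trans (le_of_eq ?_)
          rw [norm_neg, norm_mul, norm_mul]
      _ ≤ M + M * M * c⁻¹ := by
          gcongr
          · exact hG.norm₂_le y hy
          · exact ninv y hy
      _ ≤ A := by linarith
  · filter_upwards [hG.norm₃_le, ae_unitVol_of_forall hG.norm₁_le,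
      ae_unitVol_of_forall hG.norm₂_le, ae_unitVol_of_forall ninv] with y n3 n1 n2 ni
    calc _ ≤ ‖G₃ y‖ + ((‖G₂ y‖ * ‖G₁ y‖ + ‖G₁ y‖ * ‖G₂ y‖) * ‖(G y)⁻¹‖
            + ‖G₁ y‖ * ‖G₁ y‖ * (‖G₁ y‖ * ‖(G y)⁻¹‖ ^ 2)) := by
          refine (norm_add_le _ _).trans (add_le_add (norm_neg _).le ?_)
          refine (norm_add_le _ _).trans (add_le_add ?_ (le_of_eq ?_))
          · rw [norm_mul]
            refine mul_le_mul_of_nonneg_right ((norm_add_le _ _).trans ?_) (norm_nonneg _)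
            rw [norm_mul, norm_mul]
          · rw [norm_mul, norm_mul, norm_div, norm_neg, norm_pow, norm_inv, inv_pow, div_eq_mul_inv]
      _ ≤ M + ((M * M + M * M) * c⁻¹ + M * M * (M * c⁻¹ ^ 2)) := by gcongr
      _ ≤ A := by linarith
  · filter_upwards [e, hg] with y h1 h2
    rw [← h1, Complex.ofReal_re, inv_mul_cancel₀ (hc.trans h2.1).ne']

/-- A vorticity in `H²` that vanishes on the walls. -/
theorem exists_isProfile {w : ℝ → ℂ} (hw : MemSobolev 2 2 w) (h0 : VanishesAtBoundary w) :
    ∃ W W₁ v : ℝ → ℂ, IsProfile W W₁ v ∧ w =ᵐ[unitVol] W ∧ ENNReal.ofReal (l2 v) ≤ normH 2 w := by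
  obtain ⟨u, hu, eu, u0, u1⟩ := h0
  have m2 := hw.2 2 le_rfl
  obtain ⟨W₁, h1, e1⟩ := (isWeakDeriv_weakDeriv (hw.1 1 (by norm_num))).exists_isPrimitive
    (m2.integrable (by norm_num))
  obtain ⟨W, hW, eW⟩ := ((isWeakDeriv_weakDeriv (hw.1 0 (by norm_num))).congr (ae_eq_refl _)
    e1).exists_isPrimitive (integrable_of_continuousOn h1.continuousOn)
  have hWu := eqOn_of_ae hW.continuousOn hu (Filter.EventuallyEq.trans eW.symm eu)
  refine ⟨W, W₁, _, ⟨hW, h1, m2, ?_, ?_⟩, eW, ?_⟩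
  · rw [hWu 0 (by simp), u0]
  · rw [hWu 1 (by simp), u1]
  · have e2 : ENNReal.ofReal (l2 (weakDeriv^[2] w)) = eLpNorm (weakDeriv^[2] w) 2 unitVol :=
      ofReal_l2 m2
    have h2 : eLpNorm (weakDeriv^[2] w) 2 unitVol ^ 2
        ≤ ∑ j ∈ Finset.range (2 + 1), eLpNorm (weakDeriv^[j] w) 2 unitVol ^ 2 :=
      Finset.single_le_sum (f := fun j => eLpNorm (weakDeriv^[j] w) 2 unitVol ^ 2)
        (fun _ _ => zero_le) (Finset.mem_range.2 (by norm_num))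
    calc ENNReal.ofReal (l2 (weakDeriv^[2] w))
        = (eLpNorm (weakDeriv^[2] w) 2 unitVol ^ 2) ^ (1 / 2 : ℝ) := by
          rw [e2, ← ENNReal.rpow_two, ← ENNReal.rpow_mul]; norm_num
      _ ≤ _ := ENNReal.rpow_le_rpow h2 (by norm_num)

theorem IsProfile.memSobolev {W W₁ v u : ℝ → ℂ} (hW : IsProfile W W₁ v) (e : u =ᵐ[unitVol] W) :
    MemSobolev 2 2 u ∧ normH 2 u ≤ ENNReal.ofReal (2 * l2 v) := by
  have d0 : IsWeakDeriv u W₁ := hW.prim.isWeakDeriv.congr e.symm (ae_eq_refl _)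
  have e1 : weakDeriv u =ᵐ[unitVol] W₁ := d0.weakDeriv_ae_eq
  have d1 : IsWeakDeriv (weakDeriv u) v := hW.prim₁.isWeakDeriv.congr e1.symm (ae_eq_refl _)
  have e2 : weakDeriv (weakDeriv u) =ᵐ[unitVol] v := d1.weakDeriv_ae_eq
  have m0 := (hW.prim.memLp 2).ae_eq e.symm
  have m1 := hW.memLp₁.ae_eq e1.symm
  have m2 := hW.memLp.ae_eq e2.symm
  have n : ∀ {a b : ℝ → ℂ}, a =ᵐ[unitVol] b → MemLp b 2 unitVol → l2 b ≤ l2 v →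
      eLpNorm a 2 unitVol ≤ ENNReal.ofReal (l2 v) := fun hab mb hb => by
    rw [eLpNorm_congr_ae hab, ← ofReal_l2 mb]; exact ENNReal.ofReal_le_ofReal hb
  have hv := l2_nonneg v
  refine ⟨⟨fun j hj => ?_, fun j hj => ?_⟩, ?_⟩
  · interval_cases j
    · exact ⟨_, d0⟩
    · exact ⟨_, d1⟩
  · interval_cases j
    · exact m0
    · exact m1
    · exact m2
  · have n0 := n e (hW.prim.memLp 2) hW.l2_le
    have n1 := n e1 hW.memLp₁ hW.l2_deriv_le
    have n2 := n e2 hW.memLp le_rfl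
    have h2 : ∑ j ∈ Finset.range (2 + 1), eLpNorm (weakDeriv^[j] u) 2 unitVol ^ 2
        ≤ ENNReal.ofReal (2 * l2 v) ^ 2 := by
      rw [Finset.sum_range_succ, Finset.sum_range_succ, Finset.sum_range_one]
      calc _ ≤ ENNReal.ofReal (l2 v) ^ 2 + ENNReal.ofReal (l2 v) ^ 2 + ENNReal.ofReal (l2 v) ^ 2 :=
            add_le_add (add_le_add (pow_le_pow_left₀ zero_le n0 2) (pow_le_pow_left₀ zero_le n1 2))
              (pow_le_pow_left₀ zero_le n2 2)
        _ ≤ _ := by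
            rw [← ENNReal.ofReal_pow hv, ← ENNReal.ofReal_pow (by positivity),
              ← ENNReal.ofReal_add (by positivity) (by positivity),
              ← ENNReal.ofReal_add (by positivity) (by positivity)]
            exact ENNReal.ofReal_le_ofReal (by nlinarith)
    calc normH 2 u ≤ (ENNReal.ofReal (2 * l2 v) ^ 2) ^ (1 / 2 : ℝ) :=
          ENNReal.rpow_le_rpow h2 (by norm_num)
      _ = _ := by rw [← ENNReal.rpow_two, ← ENNReal.rpow_mul]; norm_num

/-! ### Passage to the moving frame -/

/-- In the moving frame, the stream function solves an elliptic problem whose coefficients do not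
depend on time. -/
theorem IsStreamFunction.exists_isElliptic {g h : ℝ → ℝ} {k t : ℝ} {w Φ : ℝ → ℂ} (hk : k ≠ 0)
    (hh : ∀ᵐ y ∂unitVol, h y * g y = 1) (hΦ : IsStreamFunction g k t w Φ) :
    ∃ p ξ : ℝ → ℂ, IsElliptic h |k| p ξ (fun y => phase (-(k * t)) y * w y) ∧ p 0 = 0 ∧ p 1 = 0 ∧
      ∀ᵐ y ∂unitVol, Φ y = k ^ 2 * (phase (k * t) y * p y) := by
  have hkc : (k : ℂ) ≠ 0 := Complex.ofReal_ne_zero.2 hk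
  obtain ⟨Ψ, hΨ, eΨ⟩ : ∃ Ψ, IsPrimitive Ψ (weakDeriv Φ) ∧ Φ =ᵐ[unitVol] Ψ := (isWeakDeriv_weakDeriv (hΦ.mem.1 0 one_pos)).exists_isPrimitive
    ((hΦ.mem.2 1 le_rfl).integrable (by norm_num))
  obtain ⟨X, hX, eX⟩ : ∃ X, IsPrimitive X (weakDeriv (twistedDeriv g k t Φ)) ∧
      twistedDeriv g k t Φ =ᵐ[unitVol] X := (isWeakDeriv_weakDeriv (hΦ.mem_twistedDeriv.1 0 one_pos)).exists_isPrimitive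
    ((hΦ.mem_twistedDeriv.2 1 le_rfl).integrable (by norm_num))
  obtain ⟨u, hu, eu, u0, u1⟩ := hΦ.boundary
  have hΨu := eqOn_of_ae hΨ.continuousOn hu (Filter.EventuallyEq.trans eΨ.symm eu)
  refine ⟨fun y => (k : ℂ)⁻¹ ^ 2 * (phase (-(k * t)) y * Ψ y),
    fun y => (k : ℂ)⁻¹ * (phase (-(k * t)) y * X y), ⟨?_, ?_⟩, ?_, ?_, ?_⟩
  · refine ((hΨ.phase_mul (k * t)).const_mul ((k : ℂ)⁻¹ ^ 2)).congr (fun _ _ => rfl) ?_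
    filter_upwards [hh, eΨ, eX] with y h1 h2 h3
    have h1' : (h y : ℂ) * g y = 1 := by exact_mod_cast h1
    rw [← h2, ← h3, twistedDeriv]
    push_cast
    field_simp
    linear_combination (-(phase (-(k * t)) y * (weakDeriv Φ y - k * Complex.I * t * Φ y))) * h1'
  · refine ((hX.phase_mul (k * t)).const_mul (k : ℂ)⁻¹).congr (fun _ _ => rfl) ?_
    filter_upwards [hh, eΨ, eX, hΦ.eqn] with y h1 h2 h3 h4
    have h1' : (h y : ℂ) * g y = 1 := by exact_mod_cast h1
    have hab : ((|k| : ℝ) : ℂ) ^ 2 = (k : ℂ) ^ 2 := by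
      rw [← Complex.ofReal_pow, sq_abs, Complex.ofReal_pow]
    have h5 : ∀ u : ℝ → ℂ, twistedDeriv g k t u y
        = g y * (weakDeriv u y / k - Complex.I * t * u y) := fun _ => rfl
    rw [← h2, ← h3, hab, ← h4, h5 (twistedDeriv g k t Φ)]
    push_cast
    field_simp
    linear_combination (-(phase (-(k * t)) y * (weakDeriv (twistedDeriv g k t Φ) y
      - k * Complex.I * t * twistedDeriv g k t Φ y))) * h1'
  · simp only []
    rw [hΨu 0 (by simp), u0]; ring
  · simp only []
    rw [hΨu 1 (by simp), u1]; ring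
  · filter_upwards [eΨ] with y h2
    rw [h2]
    have := phase_mul_neg (k * t) y
    field_simp
    linear_combination (-Ψ y) * this

theorem IsScatteringSolution.isEvolution {f g h : ℝ → ℝ} {k : ℝ} {F : ℝ → ℂ}
    {W : ℝ → Lp ℂ 2 unitVol} (hW : IsScatteringSolution f g k W) (hk : k ≠ 0)
    (hh : ∀ᵐ y ∂unitVol, h y * g y = 1) (hF : (fun y => (f y : ℂ)) =ᵐ[unitVol] F) :
    IsEvolution h |k| F fun τ => W (τ / k) := by
  intro τ
  have hkc : (k : ℂ) ≠ 0 := Complex.ofReal_ne_zero.2 hk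
  obtain ⟨Φ, hΦ, D, hD, hd⟩ := hW (τ / k)
  obtain ⟨p, ξ, hp, p0, p1, e⟩ := hΦ.exists_isElliptic hk hh
  rw [mul_div_cancel₀ τ hk] at hp e
  refine ⟨p, ξ, hp, p0, p1, (1 / k) • D, ?_, ?_⟩
  · filter_upwards [Lp.coeFn_smul (1 / k) D, hD, e, hF] with y h1 h2 h3 h4
    rw [h1, Pi.smul_apply, h2, h3, ← h4, Complex.real_smul]
    push_cast
    field_simp
  · exact HasDerivAt.scomp τ hd ((hasDerivAt_id τ).div_const k)

end FiniteChannel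

theorem theorem5p1 :
    ∀ c : ℝ, 0 < c → ∀ M : ℝ, ∃ ε : ℝ, 0 < ε ∧ ∀ L : ℝ, 0 < L → ∃ C : ℝ, 0 < C ∧
      ∀ f g : ℝ → ℝ,
        FiniteChannel.MemSobolev 3 ∞ f → FiniteChannel.MemSobolev 3 ∞ g →
        (∀ᵐ y ∂FiniteChannel.unitVol, c < g y ∧ g y < c⁻¹) →
        FiniteChannel.normWInf 3 g ≤ ENNReal.ofReal M →
        ENNReal.ofReal L * FiniteChannel.normWInf 3 f ≤ ENNReal.ofReal ε →
        ∀ n : ℤ, n ≠ 0 →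
        ∀ W : ℝ → Lp ℂ 2 FiniteChannel.unitVol,
          FiniteChannel.IsScatteringSolution f g (2 * Real.pi * (n : ℝ) / L) W →
        ∀ ω₀ : ℝ → ℂ, FiniteChannel.MemSobolev 2 2 ω₀ →
          FiniteChannel.VanishesAtBoundary ω₀ → W 0 =ᵐ[FiniteChannel.unitVol] ω₀ →
        ∀ t : ℝ, FiniteChannel.MemSobolev 2 2 (W t) ∧
          FiniteChannel.normH 2 (W t) ≤ ENNReal.ofReal C * FiniteChannel.normH 2 ω₀ := by
  intro c hc M
  obtain ⟨A, hA⟩ : ∃ A, A = 1 + c⁻¹ + c⁻¹ * |M| + (|M| + |M| ^ 2 * c⁻¹)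
    + (|M| + 2 * |M| ^ 2 * c⁻¹ + |M| ^ 3 * c⁻¹ ^ 2) := ⟨_, rfl⟩
  obtain ⟨D, hD, H⟩ := FiniteChannel.exists_evolution_bound A
  refine ⟨1 / D, by positivity, fun L hL => ⟨2 * (2 + 1 / L), by positivity, ?_⟩⟩
  intro f g hf hg hgc hgM hfε n hn W hW ω₀ hω hω0 hWω t
  have hfm : FiniteChannel.normWInf 3 f ≤ ENNReal.ofReal (1 / D / L) := by
    rw [ENNReal.ofReal_div_of_pos hL, ENNReal.le_div_iff_mul_le (by simp [hL]) (by simp), mul_comm]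
    exact hfε
  obtain ⟨F, F₁, F₂, F₃, hF, eF⟩ := FiniteChannel.exists_isCoeff hf (by positivity) hfm
  obtain ⟨G, G₁, G₂, G₃, hG, eG⟩ := FiniteChannel.exists_isCoeff hg (abs_nonneg M)
    (hgM.trans (ENNReal.ofReal_le_ofReal (le_abs_self M)))
  obtain ⟨h, β, ρ, ρ', hB, hh⟩ := FiniteChannel.exists_background hc hA hgc hG eG
  obtain ⟨W₀, W₁, v₀, hW₀, e₀, hv₀⟩ := FiniteChannel.exists_isProfile hω hω0
  have hn1 : (1 : ℝ) ≤ |(n : ℝ)| := by exact_mod_cast Int.one_le_abs hn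
  obtain ⟨k, hk⟩ : ∃ k, k = 2 * Real.pi * (n : ℝ) / L := ⟨_, rfl⟩
  rw [← hk] at hW
  have hkabs : 1 / L ≤ |k| := by
    rw [hk, abs_div, abs_mul, abs_of_pos hL, abs_of_pos Real.two_pi_pos]
    gcongr
    nlinarith [Real.pi_gt_three]
  have hk0 : k ≠ 0 := abs_pos.1 (lt_of_lt_of_le (by positivity) hkabs)
  have hDm : D * (1 / D / L) = 1 / L := by field_simp
  obtain ⟨U, U₁, v, hU, eU, hv⟩ := H h β ρ ρ' F F₁ F₂ F₃ W₀ W₁ v₀ |k| (1 / D / L)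
    (fun τ => W (τ / k)) hB (abs_pos.2 hk0) hF (hDm.trans_le (hkabs.trans (le_max_left _ _)))
    (hW.isEvolution hk0 hh eF) hW₀ (by simpa using hWω.trans e₀) (k * t)
  simp only [mul_div_cancel_left₀ t hk0] at eU
  obtain ⟨h1, h2⟩ := hU.memSobolev eU
  refine ⟨h1, h2.trans ?_⟩
  rw [hDm] at hv
  calc ENNReal.ofReal (2 * FiniteChannel.l2 v)
      ≤ ENNReal.ofReal (2 * (2 + 1 / L) * FiniteChannel.l2 v₀) :=
        ENNReal.ofReal_le_ofReal (by linarith)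
    _ = ENNReal.ofReal (2 * (2 + 1 / L)) * ENNReal.ofReal (FiniteChannel.l2 v₀) :=
        ENNReal.ofReal_mul (by positivity)
    _ ≤ _ := mul_le_mul_right hv₀ _
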